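/- Let $R$ be a commutative Noetherian local ring and let $M$ be a finitely generated $R$-module; all modules below are finitely generated. Let $\Omega^n_R K$ denote the $n$-th syzygy of a module $K$ in its minimal free resolution ($\Omega^0_RK=K$) and let $\beta_n(K)$ denote its $n$-th Betti number. The complexity $\operatorname{cx}_R(K)\in\mathbb{N}\cup\{\infty\}$ is the least integer $r\ge 0$ for which there is a real number $A$ with $\beta_n(K)\le A\,n^{r-1}$ for all $n\gg 0$ ($\infty$ if there is no such $r$). The reducing projective dimension $\operatorname{red\text{-}pd}_R(M)$ is $0$ if $\operatorname{pd}_R(M)<\infty$. If $\operatorname{pd}_R(M)=\infty$, it is the infimum (in $\mathbb{N}\cup\{\infty\}$) of the integers $r\ge 1$ for which there are modules $K_0=M,K_1,\dots,K_r$ with $\operatorname{pd}_R(K_r)<\infty$ and, for each $i=1,\dots,r$, integers $a_i,b_i\ge 1$, $n_i\ge 0$ and a short exact sequence $$0\to K_{i-1}^{\oplus a_i}\to K_i\to (\Omega^{n_i}_R K_{i-1})^{\oplus b_i}\to 0 .$$ The module $M$ has reducible complexity if either $\operatorname{pd}_R(M)<\infty$, or $0<\operatorname{cx}_R(M)<\infty$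 and there are an integer $r\ge 1$ and modules $K_0=M,\dots,K_r$ with $\operatorname{pd}_R(K_r)<\infty$ such that, for each $0\le i<r$, $\operatorname{cx}_R(K_{i+1})<\operatorname{cx}_R(K_i)$ and there are an integer $n_i\ge 0$ and a short exact sequence $0\to K_i\to K_{i+1}\to\Omega^{n_i}_RK_i\to 0$. A quasi-deformation of $R$ is a diagram $R\to R'\twoheadleftarrow S$ of local homomorphisms of Noetherian local rings with $R\to R'$ flat and $S\to R'$ surjective with kernel generated by an $S$-regular sequence; the complete intersection dimension $\operatorname{CI-dim}_R(M)$ is the infimum of $\operatorname{pd}_S(M\otimes_RR')-\operatorname{pd}_S(R')$ over all quasi-deformations of $R$. Then the following hold. 1. If $\operatorname{cx}_R(M)<\infty$, then $\operatorname{cx}_R(M)\le\operatorname{red\text{-}pd}_R(M)$. 2. If $M$ has reducible complexity, then $\operatorname{cx}_R(M)=\operatorname{red\text{-}pd}_R(M)$. 3. If $\operatorname{CI-dim}_R(M)<\infty$, then $M$ has reducible complexity, and hence $\operatorname{cx}_R(M)=\operatorname{red\text{-}pd}_R(M)$. -/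

import Mathlib

universe u

open CategoryTheory Filter

namespace ReducingDim

section Resolutions

variable {R : Type u} [CommRing R]

/-- The canonical map onto `M` from the free module on a generating set of `M` of least
cardinality (`Submodule.generators` is Mathlib's choice of such a set). For a finitely generated
module over a Noetherian local ring this is a minimal free cover of `M`. -/
noncomputable def minimalCover (M : ModuleCat.{u} R) :
    ((⊤ : Submodule R M).generators →₀ R) →ₗ[R] M :=
  Finsupp.linearCombination R (fun g : (⊤ : Submodule R M).generators => (g : M))

/-- The `n`-th syzygy `Ω^n M` in a minimal free resolution of `M`: `Ω^0 M = M`, and `Ω^(n+1) M` is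
the kernel of a minimal free cover of `Ω^n M`. -/
noncomputable def syzygy : ℕ → ModuleCat.{u} R → ModuleCat.{u} R
  | 0, M => M
  | n + 1, M => ModuleCat.of R (LinearMap.ker (minimalCover (syzygy n M)))

/-- The `n`-th Betti number of `M`: the rank of the `n`-th free module in a minimal free
resolution, that is, the minimal number of generators of `Ω^n M`. -/
noncomputable def betti (M : ModuleCat.{u} R) (n : ℕ) : ℕ :=
  (⊤ : Submodule R (syzygy n M)).spanFinrank

/-- The complexity of `M`: the least integer `r ≥ 0` such that for some real number `A` one has
`β_n(M) ≤ A * n ^ (r - 1)` for all large `n`, and `⊤` if there is no such `r`. -/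
noncomputable def complexity (M : ModuleCat.{u} R) : ℕ∞ :=
  ⨅ (r : ℕ) (_ : ∃ A : ℝ, ∀ᶠ n : ℕ in atTop, (betti M n : ℝ) ≤ A * (n : ℝ) ^ ((r : ℤ) - 1)),
    (r : ℕ∞)

/-- Finite projective dimension (the zero module has projective dimension `⊥`). -/
def FinitePd (M : ModuleCat.{u} R) : Prop :=
  projectiveDimension M < ⊤

/-- There is a short exact sequence `0 → A → B → C → 0` of `R`-modules. -/
def HasShortExact (A B C : Type u) [AddCommGroup A] [Module R A] [AddCommGroup B] [Module R B]
    [AddCommGroup C] [Module R C] : Prop :=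
  ∃ (f : A →ₗ[R] B) (g : B →ₗ[R] C),
    Function.Injective f ∧ Function.Exact f g ∧ Function.Surjective g

/-- `M` has reducible complexity: either `M` has finite projective dimension, or
`0 < cx M < ∞` and there are `r ≥ 1`, finitely generated modules `K_0 = M, …, K_r` with `K_r` of
finite projective dimension, and, for `0 ≤ i < r`, short exact sequences
`0 → K_i → K_{i+1} → Ω^{n_i} K_i → 0` with `cx K_{i+1} < cx K_i`. -/
def HasReducibleComplexity (M : ModuleCat.{u} R) : Prop :=
  FinitePd M ∨
    (0 < complexity M ∧ complexity M < ⊤ ∧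
      ∃ r : ℕ, 1 ≤ r ∧ ∃ K : ℕ → ModuleCat.{u} R,
        K 0 = M ∧ (∀ i ≤ r, Module.Finite R (K i)) ∧ FinitePd (K r) ∧
        ∀ i < r,
          (∃ n : ℕ, HasShortExact (R := R) (K i) (K (i + 1)) (syzygy n (K i))) ∧
          complexity (K (i + 1)) < complexity (K i))

/-- `M` has a reducing projective-dimension sequence `K_0 = M, …, K_r` with `r ≥ 1`: the `K_i` are
finitely generated, `K_r` has finite projective dimension, and for `0 ≤ i < r` there are
`a, b ≥ 1`, `n ≥ 0` and a short exact sequence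
`0 → K_i^{⊕ a} → K_{i+1} → (Ω^n K_i)^{⊕ b} → 0`. -/
def HasReducingSequence (M : ModuleCat.{u} R) (r : ℕ) : Prop :=
  1 ≤ r ∧ ∃ K : ℕ → ModuleCat.{u} R,
    K 0 = M ∧ (∀ i ≤ r, Module.Finite R (K i)) ∧ FinitePd (K r) ∧
    ∀ i < r, ∃ a b n : ℕ, 1 ≤ a ∧ 1 ≤ b ∧
      HasShortExact (R := R) (Fin a → K i) (K (i + 1)) (Fin b → syzygy n (K i))

open Classical in
/-- The reducing projective dimension of `M`: `0` if `M` has finite projective dimension, and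
otherwise the infimum of the `r` such that `M` has a reducing sequence `K_0, …, K_r`. -/
noncomputable def reducingPd (M : ModuleCat.{u} R) : ℕ∞ :=
  if FinitePd M then 0 else ⨅ (r : ℕ) (_ : HasReducingSequence M r), (r : ℕ∞)

end Resolutions

section CIDimension

/-- A quasi-deformation `R → R' ↞ S` of a local ring `R`: a diagram of local homomorphisms of
Noetherian local rings in which `R → R'` is flat and `S → R'` is surjective with kernel generated
by an `S`-regular sequence. -/
structure QuasiDeformation (R : Type u) [CommRing R] [IsLocalRing R] where
  /-- the flat extension of `R` -/
  R' : Type u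
  /-- the deformation of `R'` -/
  S : Type u
  [commRingR' : CommRing R']
  [isLocalRingR' : IsLocalRing R']
  [isNoetherianRingR' : IsNoetherianRing R']
  [commRingS : CommRing S]
  [isLocalRingS : IsLocalRing S]
  [isNoetherianRingS : IsNoetherianRing S]
  /-- the flat map `R → R'` -/
  ext : R →+* R'
  isLocalHom_ext : IsLocalHom ext
  flat_ext : ext.Flat
  /-- the surjection `S → R'` -/
  proj : S →+* R'
  isLocalHom_proj : IsLocalHom proj
  surjective_proj : Function.Surjective proj
  ker_proj : ∃ rs : List S,
    RingTheory.Sequence.IsRegular S rs ∧ RingHom.ker proj = Ideal.ofList rs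

attribute [instance] QuasiDeformation.commRingR' QuasiDeformation.isLocalRingR'
  QuasiDeformation.isNoetherianRingR' QuasiDeformation.commRingS QuasiDeformation.isLocalRingS
  QuasiDeformation.isNoetherianRingS

variable {R : Type u} [CommRing R] [IsLocalRing R]

/-- `M ⊗_R R'` as an `S`-module. -/
noncomputable def QuasiDeformation.baseChange (Q : QuasiDeformation R) (M : ModuleCat.{u} R) :
    ModuleCat.{u} Q.S :=
  (ModuleCat.restrictScalars Q.proj).obj ((ModuleCat.extendScalars Q.ext).obj M)

/-- `R'` as an `S`-module. -/
noncomputable def QuasiDeformation.ringAsModule (Q : QuasiDeformation R) : ModuleCat.{u} Q.S :=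
  (ModuleCat.restrictScalars Q.proj).obj (ModuleCat.of Q.R' Q.R')

/-- The inclusion of `{-∞} ∪ ℕ ∪ {∞}` in the extended reals. -/
noncomputable def toExtendedReal : WithBot ℕ∞ → EReal :=
  WithBot.recBotCoe ⊥ (fun n => ((n : ENNReal) : EReal))

/-- The complete intersection dimension of `M`: the infimum of `pd_S (M ⊗_R R') - pd_S R'` over all
quasi-deformations `R → R' ↞ S`. (The number `pd_S R'` is always finite.) -/
noncomputable def ciDim (M : ModuleCat.{u} R) : EReal :=
  ⨅ Q : QuasiDeformation R,
    toExtendedReal (projectiveDimension (Q.baseChange M)) -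
      toExtendedReal (projectiveDimension Q.ringAsModule)

end CIDimension

end ReducingDim

/-! Betti numbers are lengths of `Ext^n(-, k)`, so exact sequences of modules become inequalities
between Betti sequences, and finite projective dimension is complexity zero.

Items 1 and 2. One sequence `0 → K^a → K₁ → (Ω^n K)^b → 0` with `cx K < ∞` lowers the complexity by
at most one (`complexity_le_add_one_of_hasShortExact`). If `a ≤ b`, then `β_{j+n+1}(K) ≤ β_j(K) +
β_{j+1}(K₁)`, and summation costs one power of `j`. If `b < a`, then `a β_j(K) ≤ β_j(K₁) + b
β_{j+n+1}(K)`, and a violation would make `β(K)` grow exponentially. Conversely, each step of a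
reduction of complexity lowers the complexity by at least one, so such a chain has at most `cx M`
steps; it is also a reducing sequence with `a = b = 1`.

Item 3. Choose a quasi-deformation `R → R' ↞ S` with `R' ⊗ M` of finite projective dimension over
`S`, where `R' = S/(f)`. The minimal resolution `F` of `M`, base changed to `R'` and lifted to `S`,
has a differential whose square is `∑ f_a t_a`; the `t_a` are Eisenbud's operators. Removing one
`f_a` at a time by a mapping cone reduces to a resolution over `S` itself, which splits in high
degrees. This gives polynomial growth of the Betti numbers and shows that the `t_a` have no common
kernel in high degrees (`LiftedComplex.exists_bound`); dually, cohomology is finitely generated over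
them.

By flatness each `t_a` is, up to homotopy, an `R'`-combination of chain maps of `F` over `R`
(`ExactAug.exists_descent`). Modulo the maximal ideal these give commuting operators on `F ⊗ k`,
central among reductions of chain maps, and still without common kernel in high degrees
(`ExactAug.exists_operators`). Prime avoidance on the graded dual then yields a homogeneous central
operator that is surjective in high degrees, and whose kernel grows strictly more slowly than `F`
(`exists_surjective_of_growth`).

A chain map `φ` of degree `-(e+1)` inducing it has a mapping cone that resolves a module `K` with `0
→ M → K → Ω^e M → 0`. In high degrees the Betti numbers of `K` are bounded by the ranks of `ker φ`,
so `cx K < cx M` (`MinimalResolution.exists_reduction`). The hypothesis on `R' ⊗ M` passes to `K`,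
and induction on the complexity ends the proof. -/

namespace ReducingDim

/-! ### Graded vector spaces and homogeneous operators -/

section Grading

variable {k : Type*} [CommRing k] {E : Type*} [AddCommGroup E] [Module k E]

/-- A grading of `E` by `ℕ`, given by the projections onto its graded pieces. -/
structure IsGrading (p : ℕ → Module.End k E) : Prop where
  apply_same : ∀ j x, p j (p j x) = p j x
  apply_ne : ∀ i j, i ≠ j → ∀ x, p i (p j x) = 0
  eventually_zero : ∀ x, ∃ N, ∀ j, N ≤ j → p j x = 0
  ext_zero : ∀ x, (∀ j, p j x = 0) → x = 0

/-- `f` is homogeneous of degree `-n`. -/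
def Lowers (p : ℕ → Module.End k E) (n : ℕ) (f : Module.End k E) : Prop :=
  ∀ j x, p j (f x) = f (p (j + n) x)

variable {p : ℕ → Module.End k E}

lemma Lowers.add {n : ℕ} {f g : Module.End k E} (hf : Lowers p n f) (hg : Lowers p n g) :
    Lowers p n (f + g) := fun j x => by simp [hf j x, hg j x]

lemma Lowers.smul {n : ℕ} {f : Module.End k E} (c : k) (hf : Lowers p n f) :
    Lowers p n (c • f) := fun j x => by simp [hf j x]

lemma Lowers.neg {n : ℕ} {f : Module.End k E} (hf : Lowers p n f) :
    Lowers p n (-f) := fun j x => by simp [hf j x]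

lemma Lowers.sub {n : ℕ} {f g : Module.End k E} (hf : Lowers p n f) (hg : Lowers p n g) :
    Lowers p n (f - g) := fun j x => by simp [hf j x, hg j x]

lemma Lowers.zero {n : ℕ} : Lowers p n 0 := fun j x => by simp

lemma Lowers.sum {n : ℕ} {α : Type*} (s : Finset α) {f : α → Module.End k E}
    (hf : ∀ a ∈ s, Lowers p n (f a)) : Lowers p n (∑ a ∈ s, f a) := by
  classical
  induction s using Finset.induction_on with
  | empty => simpa using Lowers.zero
  | insert a s ha ih =>
    rw [Finset.sum_insert ha]
    exact (hf a (Finset.mem_insert_self a s)).add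
      (ih fun b hb => hf b (Finset.mem_insert_of_mem hb))

lemma Lowers.mul {m n : ℕ} {f g : Module.End k E} (hf : Lowers p m f) (hg : Lowers p n g) :
    Lowers p (m + n) (f * g) := fun j x => by
  simp [hf j, hg (j + m), add_assoc]

lemma Lowers.apply_low (hp : IsGrading p) {n : ℕ} {f : Module.End k E} (hf : Lowers p n f)
    {j : ℕ} (hj : j < n) (x : E) : f (p j x) = 0 := by
  refine hp.ext_zero _ fun i => ?_
  rw [hf, hp.apply_ne _ _ (by omega), map_zero]

lemma IsGrading.sum_eq (hp : IsGrading p) {N : ℕ} {x : E} (hx : ∀ j, N ≤ j → p j x = 0) :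
    ∑ j ∈ Finset.range N, p j x = x := by
  rw [← sub_eq_zero]
  refine hp.ext_zero _ fun i => ?_
  rw [map_sub, map_sum]
  by_cases hi : i < N
  · rw [Finset.sum_eq_single i (fun b _ hb => hp.apply_ne _ _ hb.symm x)
      (fun h => absurd (Finset.mem_range.2 hi) h), hp.apply_same, sub_self]
  · rw [hx i (by omega), Finset.sum_eq_zero, sub_self]
    intro b hb
    exact hp.apply_ne _ _ (by have := Finset.mem_range.1 hb; omega) x

lemma IsGrading.induction (hp : IsGrading p) {P : Submodule k E}
    (h : ∀ j x, p j x ∈ P) (x : E) : x ∈ P := by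
  obtain ⟨N, hN⟩ := hp.eventually_zero x
  rw [← hp.sum_eq hN]
  exact Submodule.sum_mem _ fun j _ => h j x

/-- The `j`-th graded piece. -/
def piece (p : ℕ → Module.End k E) (j : ℕ) : Submodule k E := LinearMap.range (p j)

lemma IsGrading.mem_piece (hp : IsGrading p) {j : ℕ} {x : E} : x ∈ piece p j ↔ p j x = x := by
  constructor
  · rintro ⟨y, rfl⟩
    exact hp.apply_same j y
  · intro h
    exact ⟨x, h⟩

lemma Lowers.map_piece {n : ℕ} {f : Module.End k E} (hf : Lowers p n f) {j : ℕ} {x : E}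
    (hx : x ∈ piece p (j + n)) : f x ∈ piece p j := by
  obtain ⟨y, rfl⟩ := hx
  exact ⟨f y, hf j y⟩

end Grading

/-! ### Finite generation of the graded dual -/

section GradedDual

variable {k : Type*} [Field k] {E : Type*} [AddCommGroup E] [Module k E]
variable {p : ℕ → Module.End k E} {m : Type*} {z : m → Module.End k E}
variable {A : Type*} [CommRing A] [Module A (Module.Dual k E)] {ζ : m → A}

/-- The joint kernel of the operators `z i` vanishes in large degrees. -/
def JointlyInjective (p : ℕ → Module.End k E) (z : m → Module.End k E) : Prop :=
  ∃ N, ∀ j, N ≤ j → ∀ x, (∀ i, z i (p (j + 2) x) = 0) → p (j + 2) x = 0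

lemma smul_mem_of_adjoin [Algebra k A] [IsScalarTower k A (Module.Dual k E)]
    (hgen : Algebra.adjoin k (Set.range ζ) = ⊤)
    (U : Submodule k (Module.Dual k E)) (hU : ∀ i, ∀ u ∈ U, ζ i • u ∈ U) (a : A)
    {u : Module.Dual k E} (hu : u ∈ U) : a • u ∈ U := by
  have ha : a ∈ Algebra.adjoin k (Set.range ζ) := hgen ▸ Algebra.mem_top
  induction ha using Algebra.adjoin_induction generalizing u with
  | mem x hx => obtain ⟨i, rfl⟩ := hx; exact hU i u hu
  | algebraMap r => rw [algebraMap_smul]; exact U.smul_mem r hu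
  | add x y _ _ hx hy => rw [add_smul]; exact U.add_mem (hx hu) (hy hu)
  | mul x y _ _ hx hy => rw [mul_smul]; exact hx (hy hu)

/-- A `k`-subspace stable under generators of the `k`-algebra `A` is an `A`-submodule. -/
def submoduleOfStable [Algebra k A] [IsScalarTower k A (Module.Dual k E)]
    (hgen : Algebra.adjoin k (Set.range ζ) = ⊤)
    (U : Submodule k (Module.Dual k E)) (hU : ∀ i, ∀ u ∈ U, ζ i • u ∈ U) :
    Submodule A (Module.Dual k E) where
  carrier := U
  add_mem' := U.add_mem
  zero_mem' := U.zero_mem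
  smul_mem' a _ hu := smul_mem_of_adjoin hgen U hU a hu

/-- The functionals which vanish on all pieces of degree at least `N`. -/
def dualBelow (p : ℕ → Module.End k E) (N : ℕ) : Submodule k (Module.Dual k E) where
  carrier := {u | ∀ j, N ≤ j → ∀ x, u (p j x) = 0}
  add_mem' hu hv j hj x := by simp [hu j hj x, hv j hj x]
  zero_mem' j _ x := rfl
  smul_mem' c u hu j hj x := by simp [hu j hj x]

lemma dualBelow_mono {M N : ℕ} (h : M ≤ N) : dualBelow p M ≤ dualBelow p N :=
  fun _ hu j hj x => hu j (h.trans hj) x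

/-- The graded dual: the functionals which vanish on all pieces of large degree. -/
def gradedDual (p : ℕ → Module.End k E) : Submodule k (Module.Dual k E) where
  carrier := {u | ∃ N, u ∈ dualBelow p N}
  add_mem' := by
    rintro u v ⟨M, hM⟩ ⟨N, hN⟩
    exact ⟨max M N, (dualBelow p _).add_mem (dualBelow_mono (le_max_left _ _) hM)
      (dualBelow_mono (le_max_right _ _) hN)⟩
  zero_mem' := ⟨0, (dualBelow p 0).zero_mem⟩
  smul_mem' c u := by
    rintro ⟨N, hN⟩
    exact ⟨N, (dualBelow p N).smul_mem c hN⟩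

lemma finite_dualBelow (hp : IsGrading p) [∀ j, Module.Finite k (piece p j)] (N : ℕ) :
    Module.Finite k (dualBelow p N) := by
  let Φ : dualBelow p N →ₗ[k] ((j : Fin N) → Module.Dual k (piece p j)) :=
    LinearMap.pi fun j => (piece p j).subtype.dualMap ∘ₗ (dualBelow p N).subtype
  refine Module.Finite.of_injective Φ ?_
  intro u v huv
  ext x
  have : x ∈ LinearMap.ker ((u : Module.Dual k E) - (v : Module.Dual k E)) := by
    refine hp.induction (fun j y => ?_) x
    rw [LinearMap.mem_ker, LinearMap.sub_apply, sub_eq_zero]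
    by_cases hj : j < N
    · have := congrFun huv ⟨j, hj⟩
      exact LinearMap.congr_fun this ⟨p j y, y, rfl⟩
    · rw [u.2 j (by omega) y, v.2 j (by omega) y]
  simpa [sub_eq_zero] using this

lemma smul_mem_dualBelow (hz : ∀ i, Lowers p 2 (z i))
    (hact : ∀ i (u : Module.Dual k E), ζ i • u = u ∘ₗ z i) {N : ℕ} (i : m)
    {u : Module.Dual k E} (hu : u ∈ dualBelow p N) : ζ i • u ∈ dualBelow p (N + 2) := by
  intro j hj x
  rw [hact, LinearMap.comp_apply]
  obtain ⟨l, rfl⟩ := Nat.exists_eq_add_of_le' (show 2 ≤ j by omega)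
  rw [← hz i l]
  exact hu l (by omega) _

lemma smul_mem_gradedDual (hz : ∀ i, Lowers p 2 (z i))
    (hact : ∀ i (u : Module.Dual k E), ζ i • u = u ∘ₗ z i) (i : m)
    {u : Module.Dual k E} (hu : u ∈ gradedDual p) : ζ i • u ∈ gradedDual p := by
  obtain ⟨N, hN⟩ := hu
  exact ⟨N + 2, smul_mem_dualBelow hz hact i hN⟩

/-- Linear duality: `u` vanishes on the kernel of `x ↦ (z i (p (j+2) x))_i`, hence factors through
this map. -/
lemma exists_sum_comp_eq [Fintype m] (hp : IsGrading p) (hz : ∀ i, Lowers p 2 (z i)) {j : ℕ}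
    (hj : ∀ x, (∀ i, z i (p (j + 2) x) = 0) → p (j + 2) x = 0) (u : Module.Dual k E)
    (hu : ∀ x, u (p (j + 2) x) = u x) :
    ∃ v : m → Module.Dual k E, (∀ i, v i ∈ dualBelow p (j + 1)) ∧ u = ∑ i, v i ∘ₗ z i := by
  classical
  let Φ : E →ₗ[k] (m → E) := LinearMap.pi fun i => z i ∘ₗ p (j + 2)
  have hmem : u ∈ (LinearMap.ker Φ).dualAnnihilator := by
    rw [Submodule.mem_dualAnnihilator]
    intro x hx
    rw [← hu, hj x (fun i => congrFun hx i), map_zero]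
  rw [← LinearMap.range_dualMap_eq_dualAnnihilator_ker] at hmem
  obtain ⟨w, rfl⟩ := hmem
  refine ⟨fun i => w ∘ₗ LinearMap.single k (fun _ => E) i ∘ₗ p j, ?_, ?_⟩
  · intro i l hl x
    simp [hp.apply_ne j l (by omega) x]
  · ext x
    simp only [LinearMap.dualMap_apply, LinearMap.sum_apply, LinearMap.comp_apply, ← map_sum]
    congr 1
    ext i
    simp [Φ, hz i j, Finset.sum_apply, Pi.single_apply]

/-- Joint injectivity is dual to generation: in high degrees every functional is a sum of `ζ i`
applied to functionals of lower degree. So the finite-dimensional space of functionals supported in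
low degrees generates. -/
lemma finite_gradedDual [Fintype m] [Algebra k A] [IsScalarTower k A (Module.Dual k E)]
    (hp : IsGrading p) [∀ j, Module.Finite k (piece p j)]
    (hz : ∀ i, Lowers p 2 (z i)) (hinj : JointlyInjective p z)
    (hgen : Algebra.adjoin k (Set.range ζ) = ⊤)
    (hact : ∀ i (u : Module.Dual k E), ζ i • u = u ∘ₗ z i) :
    (submoduleOfStable hgen (gradedDual p)
      (fun i _ => smul_mem_gradedDual hz hact i)).FG := by
  obtain ⟨N, hN⟩ := hinj
  have hfg : (dualBelow p (N + 2)).FG := by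
    have := finite_dualBelow hp (N + 2)
    rwa [Module.Finite.iff_fg] at this
  obtain ⟨s, hs⟩ := hfg
  refine ⟨s, ?_⟩
  have hle : ∀ u ∈ dualBelow p (N + 2), u ∈ Submodule.span A (s : Set (Module.Dual k E)) := by
    rw [← hs]
    exact fun u hu => Submodule.span_le_restrictScalars k A _ hu
  apply le_antisymm
  · rw [Submodule.span_le]
    intro u hu
    refine ⟨N + 2, ?_⟩
    rw [← hs]
    exact Submodule.subset_span hu
  · rintro u ⟨M, hM⟩
    induction M using Nat.strong_induction_on generalizing u with
    | _ M ih =>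
      by_cases hMN : M ≤ N + 2
      · exact hle u (dualBelow_mono hMN hM)
      · obtain ⟨l, rfl⟩ := Nat.exists_eq_add_of_le' (show 3 ≤ M by omega)
        obtain ⟨v, hv, hv'⟩ := exists_sum_comp_eq hp hz (hN l (by omega)) (u ∘ₗ p (l + 2))
          (fun x => by simp [hp.apply_same])
        have h1 : u - u ∘ₗ p (l + 2) ∈ dualBelow p (l + 2) := by
          intro j hj x
          rcases hj.eq_or_lt with rfl | hj
          · simp [hp.apply_same]
          · simp [hp.apply_ne (l + 2) j (by omega), hM j (by omega)]
        rw [← sub_add_cancel u (u ∘ₗ p (l + 2))]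
        refine Submodule.add_mem _ (ih _ (by omega) h1) ?_
        rw [hv']
        refine Submodule.sum_mem _ fun i _ => ?_
        rw [← hact]
        exact Submodule.smul_mem _ _ (ih (l + 1) (by omega) (hv i))

/-- Lets a polynomial ring act on the dual through commuting operators; with finitely many operators
Hilbert's basis theorem then applies. -/
lemma exists_mvPolynomial_algHom {k m B : Type*} [CommRing k] [Ring B] [Algebra k B] (b : m → B)
    (hb : ∀ i j, b i * b j = b j * b i) :
    ∃ ψ : MvPolynomial m k →ₐ[k] B, ∀ i, ψ (MvPolynomial.X i) = b i := by
  have hc : IsMulCommutative (Algebra.adjoin k (Set.range b)) := by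
    refine Algebra.isMulCommutative_adjoin k ?_
    rintro _ ⟨i, rfl⟩ _ ⟨j, rfl⟩
    exact hb i j
  open scoped IsMulCommutative in
  exact ⟨(Algebra.adjoin k (Set.range b)).val.comp
    (MvPolynomial.aeval fun i => ⟨b i, Algebra.subset_adjoin ⟨i, rfl⟩⟩), fun i => by simp⟩

/-- The graded dual of `E / U` is a submodule of the Noetherian graded dual of `E`, so it is
generated in degrees below some `N`. A class of degree at least `N` killed by all operators is then
annihilated by every functional. -/
lemma mem_of_forall_apply_mem_aux [Fintype m] [IsNoetherianRing A] [Algebra k A]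
    [IsScalarTower k A (Module.Dual k E)] (hp : IsGrading p)
    [∀ j, Module.Finite k (piece p j)] (hz : ∀ i, Lowers p 2 (z i))
    (hinj : JointlyInjective p z) (hgen : Algebra.adjoin k (Set.range ζ) = ⊤)
    (hact : ∀ i (u : Module.Dual k E), ζ i • u = u ∘ₗ z i)
    (U : Submodule k E) (hpU : ∀ j, ∀ x ∈ U, p j x ∈ U) (hzU : ∀ i, ∀ x ∈ U, z i x ∈ U) :
    ∃ N, ∀ j, N ≤ j → ∀ x, (∀ i, z i (p j x) ∈ U) → p j x ∈ U := by
  let W := submoduleOfStable hgen (gradedDual p) (fun i _ => smul_mem_gradedDual hz hact i)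
  have hW : W.FG := finite_gradedDual hp hz hinj hgen hact
  have hWn : IsNoetherian A W := isNoetherian_of_fg_of_noetherian W hW
  let B := submoduleOfStable hgen (gradedDual p ⊓ U.dualAnnihilator) (by
    rintro i u ⟨hu, hu'⟩
    refine ⟨smul_mem_gradedDual hz hact i hu, ?_⟩
    rw [SetLike.mem_coe, Submodule.mem_dualAnnihilator] at hu' ⊢
    exact fun x hx => by rw [hact]; exact hu' _ (hzU i x hx))
  have hB : B.FG := isNoetherian_submodule.1 hWn B fun u hu => hu.1
  obtain ⟨s, hs⟩ := hB
  have hbound : ∃ N, ∀ u ∈ s, u ∈ dualBelow p N := by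
    have : ∀ u ∈ s, ∃ N, u ∈ dualBelow p N := fun u hu => by
      have : u ∈ B := hs ▸ Submodule.subset_span hu
      exact this.1
    choose! N hN using this
    exact ⟨s.sup N, fun u hu => dualBelow_mono (Finset.le_sup hu) (hN u hu)⟩
  obtain ⟨N, hN⟩ := hbound
  refine ⟨N, fun j hj x hx => ?_⟩
  by_contra hxU
  -- This is stable because `ζ i • u` takes the value `u (z i (p j x))` at `p j x`, which is zero
  -- since `z i (p j x) ∈ U`.
  let B' := submoduleOfStable hgen ((gradedDual p ⊓ U.dualAnnihilator) ⊓
      (k ∙ p j x).dualAnnihilator) (by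
    rintro i u ⟨hu, -⟩
    refine ⟨B.smul_mem _ hu, ?_⟩
    rw [SetLike.mem_coe, Submodule.mem_dualAnnihilator]
    intro y hy
    obtain ⟨c, rfl⟩ := Submodule.mem_span_singleton.1 hy
    rw [map_smul, hact, LinearMap.comp_apply, (Submodule.mem_dualAnnihilator u).1 hu.2 _ (hx i),
      smul_zero])
  have hBB' : B ≤ B' := by
    rw [← hs, Submodule.span_le]
    intro u hu
    refine ⟨(hs ▸ Submodule.subset_span hu : u ∈ B), ?_⟩
    rw [SetLike.mem_coe, Submodule.mem_dualAnnihilator]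
    intro y hy
    obtain ⟨c, rfl⟩ := Submodule.mem_span_singleton.1 hy
    rw [map_smul, hN u hu j hj, smul_zero]
  -- If `p j x ∉ U`, some functional separates it from `U`; its component of degree `j` lies in `B`
  -- but not in `B'`.
  obtain ⟨u, hu, huU⟩ := Submodule.exists_le_ker_of_notMem hxU
  have hmem : u ∘ₗ p j ∈ B := by
    refine ⟨⟨j + 1, fun i hi y => ?_⟩, ?_⟩
    · rw [LinearMap.comp_apply, hp.apply_ne _ _ (by omega), map_zero]
    · rw [SetLike.mem_coe, Submodule.mem_dualAnnihilator]
      exact fun y hy => huU (hpU j y hy)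
  have := (Submodule.mem_dualAnnihilator _).1 (hBB' hmem).2 _ (Submodule.mem_span_singleton_self _)
  rw [LinearMap.comp_apply, hp.apply_same] at this
  exact hu this

/-- If commuting operators are jointly injective in large degrees, then so are the operators they
induce on the quotient by any stable graded subspace `U`. -/
theorem mem_of_forall_apply_mem [Fintype m] (hp : IsGrading p)
    [∀ j, Module.Finite k (piece p j)] (hz : ∀ i, Lowers p 2 (z i))
    (hcomm : ∀ i j, z i * z j = z j * z i) (hinj : JointlyInjective p z)
    (U : Submodule k E) (hpU : ∀ j, ∀ x ∈ U, p j x ∈ U) (hzU : ∀ i, ∀ x ∈ U, z i x ∈ U) :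
    ∃ N, ∀ j, N ≤ j → ∀ x, (∀ i, z i (p j x) ∈ U) → p j x ∈ U := by
  obtain ⟨ψ, hψ⟩ := exists_mvPolynomial_algHom (k := k) (fun i => (z i).dualMap) fun i j => by
    ext u x
    exact congrArg u (LinearMap.congr_fun (hcomm j i) x)
  let _ : Module (MvPolynomial m k) (Module.Dual k E) := Module.compHom _ ψ.toRingHom
  have hsmul : ∀ (a : MvPolynomial m k) (u : Module.Dual k E), a • u = ψ a u := fun _ _ => rfl
  have : IsScalarTower k (MvPolynomial m k) (Module.Dual k E) :=
    ⟨fun c a u => by simp only [hsmul, map_smul, LinearMap.smul_apply]⟩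
  exact mem_of_forall_apply_mem_aux hp hz hinj MvPolynomial.adjoin_range_X
    (fun i u => by rw [hsmul, hψ]; rfl) U hpU hzU

end GradedDual

/-- Prime avoidance by homogeneous elements of positive degree. -/
theorem exists_homogeneous_notMem {A : Type*} [CommRing A] (H : ℕ → Set A) (hone : 1 ∈ H 0)
    (hadd : ∀ n, ∀ a ∈ H n, ∀ b ∈ H n, a + b ∈ H n)
    (hmul : ∀ m n, ∀ a ∈ H m, ∀ b ∈ H n, a * b ∈ H (m + n))
    (hne : ∃ n, 1 ≤ n ∧ (H n).Nonempty) (s : Finset (Ideal A)) (hprime : ∀ q ∈ s, q.IsPrime)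
    (hs : ∀ q ∈ s, ∃ n, 1 ≤ n ∧ ∃ a ∈ H n, a ∉ q) :
    ∃ n, 1 ≤ n ∧ ∃ a ∈ H n, ∀ q ∈ s, a ∉ q := by
  classical
  have hpow : ∀ n, ∀ a ∈ H n, ∀ l : ℕ, a ^ l ∈ H (n * l) := by
    intro n a ha l
    induction l with
    | zero => simpa using hone
    | succ l ih => rw [pow_succ, Nat.mul_succ]; exact hmul _ _ _ ih _ ha
  induction hc : s.card using Nat.strong_induction_on generalizing s with
  | _ c ih =>
    rcases s.eq_empty_or_nonempty with rfl | ⟨q₀, hq₀⟩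
    · obtain ⟨n, hn, a, ha⟩ := hne
      exact ⟨n, hn, a, ha, by simp⟩
    -- Induction on the number of primes: avoid all but one of them. If some such element also
    -- avoids the omitted prime, it is the required one.
    have key : ∀ q ∈ s, ∃ n, 1 ≤ n ∧ ∃ a ∈ H n, ∀ q' ∈ s.erase q, a ∉ q' := fun q hq =>
      ih _ (hc ▸ Finset.card_erase_lt_of_mem hq) (s.erase q)
        (fun q' hq' => hprime q' (Finset.mem_of_mem_erase hq'))
        (fun q' hq' => hs q' (Finset.mem_of_mem_erase hq')) rfl
    choose! n hn f hf hfq using key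
    by_cases hex : ∃ q ∈ s, f q ∉ q
    · obtain ⟨q, hq, hq'⟩ := hex
      refine ⟨n q, hn q hq, f q, hf q hq, fun q' hq'' => ?_⟩
      by_cases h : q' = q
      · rwa [h]
      · exact hfq q hq q' (Finset.mem_erase.2 ⟨h, hq''⟩)
    push Not at hex
    rcases (s.erase q₀).eq_empty_or_nonempty with he | ⟨q₁, hq₁⟩
    · obtain ⟨n, hn, a, ha, haq⟩ := hs q₀ hq₀
      refine ⟨n, hn, a, ha, fun q hq => ?_⟩
      by_cases h : q = q₀
      · rwa [h]
      · exact absurd (Finset.mem_erase.2 ⟨h, hq⟩) (by simp [he])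
    have hprod : ∀ t ⊆ s, ∏ q ∈ t, f q ∈ H (∑ q ∈ t, n q) := by
      intro t
      induction t using Finset.induction_on with
      | empty => intro _; simpa using hone
      | insert q t hq iht =>
        intro hts
        rw [Finset.prod_insert hq, Finset.sum_insert hq]
        exact hmul _ _ _ (hf q (hts (Finset.mem_insert_self q t))) _
          (iht fun x hx => hts (Finset.mem_insert_of_mem hx))
    set N := ∑ q ∈ s.erase q₀, n q with hN
    have hNpos : 1 ≤ N := (hn q₁ (Finset.mem_of_mem_erase hq₁)).trans
      (Finset.single_le_sum (f := n) (fun _ _ => Nat.zero_le _) hq₁)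
    -- The usual sum of prime avoidance; the two exponents bring both summands to degree `n q₀ * N`.
    refine ⟨n q₀ * N, Nat.mul_pos (hn q₀ hq₀) hNpos,
      f q₀ ^ N + (∏ q ∈ s.erase q₀, f q) ^ n q₀, hadd _ _ (hpow _ _ (hf q₀ hq₀) _) _ ?_, ?_⟩
    · rw [mul_comm]
      exact hpow _ _ (hprod _ (Finset.erase_subset _ _)) _
    · intro q hq hmem
      have := hprime q hq
      by_cases h : q = q₀
      · subst h
        rw [Ideal.add_mem_iff_right _ (Ideal.pow_mem_of_mem _ (hex q hq) _ hNpos)] at hmem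
        obtain ⟨q', hq', hq''⟩ := (Ideal.IsPrime.prod_mem_iff).1 (this.mem_of_pow_mem _ hmem)
        have := Finset.mem_erase.1 hq'
        exact hfq q' this.2 q (Finset.mem_erase.2 ⟨this.1.symm, hq⟩) hq''
      · have hb : ∏ q ∈ s.erase q₀, f q ∈ q :=
          Ideal.IsPrime.prod_mem_iff.2 ⟨q, Finset.mem_erase.2 ⟨h, hq⟩, hex q hq⟩
        rw [Ideal.add_mem_iff_left _ (Ideal.pow_mem_of_mem _ hb _ (hn q₀ hq₀))] at hmem
        exact hfq q₀ hq₀ q (Finset.mem_erase.2 ⟨h, hq⟩) (this.mem_of_pow_mem _ hmem)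

/-! ### Operators that are surjective in high degrees -/

section GradedDual

variable {k : Type*} [Field k] {E : Type*} [AddCommGroup E] [Module k E]
variable {p : ℕ → Module.End k E} {m : Type*} {z : m → Module.End k E}

/-- The functionals which vanish on all pieces of degree less than `N`. -/
def dualAbove (p : ℕ → Module.End k E) (N : ℕ) : Submodule k (Module.Dual k E) where
  carrier := {u | ∀ j, j < N → ∀ x, u (p j x) = 0}
  add_mem' hu hv j hj x := by simp [hu j hj x, hv j hj x]
  zero_mem' j _ x := rfl
  smul_mem' c u hu j hj x := by simp [hu j hj x]

lemma eq_zero_of_mem_dualBelow_of_mem_dualAbove (hp : IsGrading p) {N : ℕ}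
    {u : Module.Dual k E} (hu : u ∈ dualBelow p N) (hu' : u ∈ dualAbove p N) : u = 0 := by
  ext x
  refine hp.induction (P := LinearMap.ker u) (fun j y => ?_) x
  rcases lt_or_ge j N with h | h
  · exact hu' j h y
  · exact hu j h y

variable {A : Type*} [CommRing A] [Module A (Module.Dual k E)] {ζ : m → A}

/-- Surjectivity of an operator in high degrees is dual to being a nonzerodivisor on the high-degree
part of the graded dual. A homogeneous nonzerodivisor exists once no associated prime contains all
the `ζ i`. The family `P` records from which operators it may be built. -/
lemma exists_eventually_surjective_aux [Fintype m] [IsNoetherianRing A] [Algebra k A]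
    [IsScalarTower k A (Module.Dual k E)] (hp : IsGrading p)
    [∀ j, Module.Finite k (piece p j)] (hz : ∀ i, Lowers p 2 (z i))
    (hinj : JointlyInjective p z) (hgen : Algebra.adjoin k (Set.range ζ) = ⊤)
    (hact : ∀ i (u : Module.Dual k E), ζ i • u = u ∘ₗ z i)
    (P : ℕ → Set (Module.End k E)) (hlow : ∀ n, ∀ f ∈ P n, Lowers p n f) (hone : 1 ∈ P 0)
    (hzero : 0 ∈ P 2) (hadd : ∀ n, ∀ f ∈ P n, ∀ g ∈ P n, f + g ∈ P n)
    (hmul : ∀ m n, ∀ f ∈ P m, ∀ g ∈ P n, f * g ∈ P (m + n)) (hzP : ∀ i, z i ∈ P 2) :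
    ∃ n, 1 ≤ n ∧ ∃ f ∈ P n, ∃ N, ∀ j, N ≤ j → ∀ x, ∃ y, f (p (j + n) y) = p j x := by
  classical
  let W := submoduleOfStable hgen (gradedDual p) (fun i _ => smul_mem_gradedDual hz hact i)
  have hW : W.FG := finite_gradedDual hp hz hinj hgen hact
  have hWn : IsNoetherian A W := isNoetherian_of_fg_of_noetherian W hW
  -- The socle is finitely generated and the `ζ i` kill it, so it lives in degrees below some `N`.
  let soc : Submodule k (Module.Dual k E) := gradedDual p ⊓
    { carrier := {u | ∀ i, ζ i • u = 0}
      add_mem' := fun hu hv i => by rw [smul_add, hu i, hv i, add_zero]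
      zero_mem' := fun i => smul_zero _
      smul_mem' := fun c u hu i => by rw [smul_comm, hu i, smul_zero] }
  have hsoc : ∀ i, ∀ u ∈ soc, ζ i • u = 0 := fun i u hu => hu.2 i
  let B := submoduleOfStable hgen soc (fun i u hu => by rw [hsoc i u hu]; exact soc.zero_mem)
  have hB : B.FG := isNoetherian_submodule.1 hWn B fun u hu => hu.1
  obtain ⟨s, hs⟩ := hB
  have hbound : ∃ N, ∀ u ∈ s, u ∈ dualBelow p N := by
    have : ∀ u ∈ s, ∃ N, u ∈ dualBelow p N := fun u hu => by
      have : u ∈ B := hs ▸ Submodule.subset_span hu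
      exact this.1
    choose! N hN using this
    exact ⟨s.sup N, fun u hu => dualBelow_mono (Finset.le_sup hu) (hN u hu)⟩
  obtain ⟨N, hN⟩ := hbound
  have hsocN : ∀ u ∈ soc, u ∈ dualBelow p N := by
    let B' := submoduleOfStable hgen (soc ⊓ dualBelow p N) (fun i u hu => by
      rw [hsoc i u hu.1]; exact Submodule.zero_mem _)
    have : B ≤ B' := by
      rw [← hs, Submodule.span_le]
      exact fun u hu => ⟨(hs ▸ Submodule.subset_span hu : u ∈ B), hN u hu⟩
    exact fun u hu => (this hu).2
  -- Truncation above `N` removes the socle; no associated prime of what remains can contain every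
  -- `ζ i`.
  let W' := submoduleOfStable hgen (gradedDual p ⊓ dualAbove p N) (by
    rintro i u ⟨hu, hu'⟩
    refine ⟨smul_mem_gradedDual hz hact i hu, fun j hj x => ?_⟩
    rw [hact, LinearMap.comp_apply]
    rcases lt_or_ge j 2 with h | h
    · rw [(hz i).apply_low hp h, map_zero]
    · obtain ⟨l, rfl⟩ := Nat.exists_eq_add_of_le' h
      rw [← hz i l]
      exact hu' l (by omega) _)
  have hW' : IsNoetherian A W' :=
    isNoetherian_of_le (s := W') (t := W) fun u hu => hu.1
  let H : ℕ → Set A := fun n => {a | ∃ f ∈ P n, ∀ u : Module.Dual k E, a • u = u ∘ₗ f}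
  obtain ⟨n, hn, a, ⟨f, hf, haf⟩, ha⟩ := exists_homogeneous_notMem H
    ⟨1, hone, fun u => by rw [one_smul]; rfl⟩
    (by
      rintro n a ⟨f, hf, haf⟩ b ⟨g, hg, hbg⟩
      exact ⟨f + g, hadd n f hf g hg, fun u => by rw [add_smul, haf, hbg, LinearMap.comp_add]⟩)
    (by
      rintro l n a ⟨f, hf, haf⟩ b ⟨g, hg, hbg⟩
      refine ⟨g * f, add_comm l n ▸ hmul n l g hg f hf, fun u => ?_⟩
      rw [mul_smul, hbg, haf]
      rfl)
    ⟨2, by norm_num, 0, 0, hzero, fun u => by rw [zero_smul, LinearMap.comp_zero]⟩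
    (associatedPrimes.finite A W').toFinset
    (fun q hq => by
      rw [Set.Finite.mem_toFinset] at hq
      exact hq.isPrime)
    (fun q hq => by
      rw [Set.Finite.mem_toFinset, AssociatedPrimes.mem_iff, isAssociatedPrime_iff] at hq
      obtain ⟨hqp, x, hx⟩ := hq
      have hmem : ∀ b : A, b ∈ q ↔ b • x = 0 := fun b => by
        rw [hx, Submodule.mem_colon_singleton, Submodule.mem_bot]
      by_contra hcon
      push Not at hcon
      have hζ : ∀ i, ζ i • (x : Module.Dual k E) = 0 := fun i => by
        have := (hmem _).1 (hcon 2 (by norm_num) (ζ i) ⟨z i, hzP i, hact i⟩)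
        exact congrArg Subtype.val this
      have hx0 : x = 0 := Subtype.ext (eq_zero_of_mem_dualBelow_of_mem_dualAbove hp
        (hsocN _ ⟨x.2.1, hζ⟩) x.2.2)
      exact hqp.ne_top ((Ideal.eq_top_iff_one q).2 ((hmem 1).2 (by rw [hx0, smul_zero]))))
  refine ⟨n, hn, f, hf, N, fun j hj x => ?_⟩
  by_contra hcon
  have hxY : p j x ∉ LinearMap.range (f ∘ₗ p (j + n)) := fun ⟨y, hy⟩ => hcon ⟨y, hy⟩
  obtain ⟨u, hu, huY⟩ := Submodule.exists_le_ker_of_notMem hxY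
  have hmem : u ∘ₗ p j ∈ W' := by
    refine ⟨⟨j + 1, fun i hi y => ?_⟩, fun i hi y => ?_⟩
    · rw [LinearMap.comp_apply, hp.apply_ne _ _ (by omega), map_zero]
    · rw [LinearMap.comp_apply, hp.apply_ne _ _ (by omega), map_zero]
  have hau : a • (⟨u ∘ₗ p j, hmem⟩ : W') = 0 := by
    apply Subtype.ext
    change a • (u ∘ₗ p j) = 0
    rw [haf]
    ext y
    simp only [LinearMap.comp_apply, LinearMap.zero_apply]
    rw [hlow n f hf j y]
    exact huY ⟨y, rfl⟩
  have hmem' : a ∈ ⋃ q ∈ associatedPrimes A W', (q : Set A) := by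
    rw [biUnion_associatedPrimes_eq_zero_divisors]
    refine ⟨_, fun h0 => hu ?_, hau⟩
    have := LinearMap.congr_fun (congrArg Subtype.val h0) (p j x)
    simpa [hp.apply_same] using this
  simp only [Set.mem_iUnion] at hmem'
  obtain ⟨q, hq, haq⟩ := hmem'
  exact ha q ((Set.Finite.mem_toFinset _).2 hq) haq

/-- Commuting operators that are jointly injective in large degrees generate a homogeneous operator
of positive degree that is surjective in large degrees. -/
theorem exists_eventually_surjective [Fintype m] (hp : IsGrading p)
    [∀ j, Module.Finite k (piece p j)] (hz : ∀ i, Lowers p 2 (z i))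
    (hcomm : ∀ i j, z i * z j = z j * z i) (hinj : JointlyInjective p z)
    (P : ℕ → Set (Module.End k E)) (hlow : ∀ n, ∀ f ∈ P n, Lowers p n f) (hone : 1 ∈ P 0)
    (hzero : 0 ∈ P 2) (hadd : ∀ n, ∀ f ∈ P n, ∀ g ∈ P n, f + g ∈ P n)
    (hmul : ∀ m n, ∀ f ∈ P m, ∀ g ∈ P n, f * g ∈ P (m + n)) (hzP : ∀ i, z i ∈ P 2) :
    ∃ n, 1 ≤ n ∧ ∃ f ∈ P n, ∃ N, ∀ j, N ≤ j → ∀ x, ∃ y, f (p (j + n) y) = p j x := by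
  obtain ⟨ψ, hψ⟩ := exists_mvPolynomial_algHom (k := k) (fun i => (z i).dualMap) fun i j => by
    ext u x
    exact congrArg u (LinearMap.congr_fun (hcomm j i) x)
  let _ : Module (MvPolynomial m k) (Module.Dual k E) := Module.compHom _ ψ.toRingHom
  have hsmul : ∀ (a : MvPolynomial m k) (u : Module.Dual k E), a • u = ψ a u := fun _ _ => rfl
  have : IsScalarTower k (MvPolynomial m k) (Module.Dual k E) :=
    ⟨fun c a u => by simp only [hsmul, map_smul, LinearMap.smul_apply]⟩
  exact exists_eventually_surjective_aux hp hz hinj MvPolynomial.adjoin_range_X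
    (fun i u => by rw [hsmul, hψ]; rfl) P hlow hone hzero hadd hmul hzP

end GradedDual

/-! ### Complexes as free modules on a graded basis; change of coefficients -/

section FreeModules

variable {ι : Type*} {S S' S'' : Type*} [CommRing S] [CommRing S'] [CommRing S'']

/-- Change of coefficients in a free module. -/
noncomputable def coef (g : S →+* S') : (ι →₀ S) →+ (ι →₀ S') :=
  Finsupp.mapRange.addMonoidHom g.toAddMonoidHom

@[simp] lemma coef_apply (g : S →+* S') (x : ι →₀ S) (i : ι) : coef g x i = g (x i) := by
  simp [coef]

@[simp] lemma coef_single (g : S →+* S') (i : ι) (r : S) :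
    coef g (Finsupp.single i r) = Finsupp.single i (g r) := by
  simp [coef]

lemma coef_smul (g : S →+* S') (r : S) (x : ι →₀ S) : coef g (r • x) = g r • coef g x := by
  ext i; simp

lemma coef_coef (g : S →+* S') (g' : S' →+* S'') (x : ι →₀ S) :
    coef g' (coef g x) = coef (g'.comp g) x := by
  ext i; simp

lemma coef_surjective {g : S →+* S'} (hg : Function.Surjective g) :
    Function.Surjective (coef (ι := ι) g) :=
  Finsupp.mapRange_surjective _ (map_zero g) hg

lemma end_ext {φ ψ : Module.End S (ι →₀ S)}
    (h : ∀ i, φ (Finsupp.single i 1) = ψ (Finsupp.single i 1)) : φ = ψ := by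
  ext i : 2
  simpa using h i

/-- Change of coefficients for endomorphisms of a free module. -/
noncomputable def bc (g : S →+* S') : Module.End S (ι →₀ S) →+* Module.End S' (ι →₀ S') where
  toFun φ := Finsupp.linearCombination S' fun i => coef g (φ (Finsupp.single i 1))
  map_one' := end_ext fun i => by simp
  map_zero' := end_ext fun i => by simp
  map_add' φ ψ := end_ext fun i => by simp
  map_mul' φ ψ := end_ext fun i => by
    simp only [Finsupp.linearCombination_single, one_smul, Module.End.mul_apply]
    induction ψ (Finsupp.single i 1) using Finsupp.induction_linear with
    | zero => simp
    | add x y hx hy => simp [hx, hy]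
    | single l r =>
      have : Finsupp.single l r = r • Finsupp.single l (1 : S) := by simp
      rw [this, map_smul, coef_smul, coef_smul]
      simp

lemma bc_single (g : S →+* S') (φ : Module.End S (ι →₀ S)) (i : ι) :
    bc g φ (Finsupp.single i 1) = coef g (φ (Finsupp.single i 1)) := by
  simp [bc]

lemma bc_coef (g : S →+* S') (φ : Module.End S (ι →₀ S)) (x : ι →₀ S) :
    bc g φ (coef g x) = coef g (φ x) := by
  induction x using Finsupp.induction_linear with
  | zero => simp
  | add x y hx hy => simp [hx, hy]
  | single l r =>
    have : Finsupp.single l r = r • Finsupp.single l (1 : S) := by simp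
    rw [this, LinearMap.map_smul φ, coef_smul, coef_smul, coef_single, map_one,
      LinearMap.map_smul (bc g φ), bc_single]

lemma bc_smul (g : S →+* S') (r : S) (φ : Module.End S (ι →₀ S)) :
    bc g (r • φ) = g r • bc g φ :=
  end_ext fun i => by simp [bc_single, coef_smul]

lemma bc_bc (g : S →+* S') (g' : S' →+* S'') (φ : Module.End S (ι →₀ S)) :
    bc g' (bc g φ) = bc (g'.comp g) φ :=
  end_ext fun i => by simp [bc_single, coef_coef]

/-- The projection onto the span of the basis vectors of degree `j`. -/
noncomputable def gp (deg : ι → ℕ) (j : ℕ) : Module.End S (ι →₀ S) where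
  toFun x := x.filter fun i => deg i = j
  map_add' _ _ := Finsupp.filter_add
  map_smul' _ _ := Finsupp.filter_smul

variable {deg : ι → ℕ}

lemma gp_apply_of_eq {j : ℕ} {i : ι} (h : deg i = j) (x : ι →₀ S) : gp deg j x i = x i :=
  Finsupp.filter_apply_pos (fun i => deg i = j) x h

lemma gp_apply_of_ne {j : ℕ} {i : ι} (h : deg i ≠ j) (x : ι →₀ S) : gp deg j x i = 0 :=
  Finsupp.filter_apply_neg (fun i => deg i = j) x h

lemma gp_apply (j : ℕ) (i : ι) (x : ι →₀ S) : gp deg j x i = if deg i = j then x i else 0 := by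
  split_ifs with h
  · exact gp_apply_of_eq h x
  · exact gp_apply_of_ne h x

lemma isGrading_gp (deg : ι → ℕ) : IsGrading (gp (S := S) deg) where
  apply_same j x := by ext i; simp only [gp_apply]; split_ifs <;> rfl
  apply_ne i j hij x := by
    ext l; simp only [gp_apply]; split_ifs with h h' <;> first | rfl | omega
  eventually_zero x := by
    refine ⟨x.support.sup deg + 1, fun j hj => ?_⟩
    ext i
    rw [gp_apply]
    split_ifs with h
    · by_contra hi
      have := Finset.le_sup (f := deg) (Finsupp.mem_support_iff.2 hi)
      omega
    · rfl
  ext_zero x hx := by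
    ext i
    rw [← gp_apply_of_eq (deg := deg) rfl x, hx]

lemma coef_gp (g : S →+* S') (j : ℕ) (x : ι →₀ S) : coef g (gp deg j x) = gp deg j (coef g x) := by
  ext i; simp only [gp_apply, coef_apply]; split_ifs <;> simp

lemma gp_single_of_eq {j : ℕ} {i : ι} (h : deg i = j) (r : S) :
    gp deg j (Finsupp.single i r) = Finsupp.single i r := by
  classical
  ext l
  rw [gp_apply, Finsupp.single_apply]
  split_ifs <;> first | rfl | simp_all

lemma gp_single_of_ne {j : ℕ} {i : ι} (h : deg i ≠ j) (r : S) :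
    gp deg j (Finsupp.single i r) = 0 := by
  classical
  ext l
  rw [gp_apply, Finsupp.single_apply]
  split_ifs <;> first | rfl | simp_all

lemma lowers_iff {n : ℕ} {φ : Module.End S (ι →₀ S)} :
    Lowers (gp deg) n φ ↔ ∀ i l, φ (Finsupp.single i 1) l ≠ 0 → deg l + n = deg i := by
  constructor
  · intro h i l hl
    by_contra hne
    have := h (deg l) (Finsupp.single i 1)
    rw [gp_single_of_ne (Ne.symm hne), map_zero] at this
    exact hl (by rw [← gp_apply_of_eq (deg := deg) rfl (φ _), this]; rfl)
  · intro h j x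
    induction x using Finsupp.induction_linear with
    | zero => simp
    | add x y hx hy => simp only [map_add, hx, hy]
    | single i r =>
      have hr : Finsupp.single i r = r • Finsupp.single i (1 : S) := by simp
      rw [hr, map_smul, map_smul, map_smul, map_smul]
      congr 1
      by_cases hi : deg i = j + n
      · rw [gp_single_of_eq hi]
        ext l
        rw [gp_apply]
        split_ifs with hl
        · rfl
        · by_contra hne
          exact hl (by have := h i l (Ne.symm hne); omega)
      · rw [gp_single_of_ne hi, map_zero]
        ext l
        rw [gp_apply]
        split_ifs with hl
        · by_contra hne
          exact hi (by have := h i l hne; omega)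
        · rfl

lemma Lowers.bc {n : ℕ} {φ : Module.End S (ι →₀ S)} (h : Lowers (gp deg) n φ) (g : S →+* S') :
    Lowers (gp deg) n (bc g φ) := by
  rw [lowers_iff] at h ⊢
  intro i l hl
  refine h i l fun h0 => hl ?_
  rw [bc_single, coef_apply, h0, map_zero]

/-- Matrix entries are lifted one at a time. Sending zero to zero keeps the support of each column,
hence the degree. -/
lemma exists_bc_eq {g : S →+* S'} (hg : Function.Surjective g) (φ : Module.End S' (ι →₀ S')) :
    ∃ ψ : Module.End S (ι →₀ S), bc g ψ = φ ∧ ∀ n, Lowers (gp deg) n φ → Lowers (gp deg) n ψ := by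
  classical
  choose s hs using hg
  let s' : S' → S := fun x => if x = 0 then 0 else s x
  have hs'0 : s' 0 = 0 := if_pos rfl
  have hs' : ∀ x, g (s' x) = x := fun x => by
    by_cases h : x = 0 <;> simp [s', h, hs]
  refine ⟨Finsupp.linearCombination S fun i => (φ (Finsupp.single i 1)).mapRange s' hs'0,
    end_ext fun i => ?_, fun n hn => ?_⟩
  · rw [bc_single]
    ext l
    simp [hs']
  · rw [lowers_iff] at hn ⊢
    intro i l hl
    refine hn i l fun h0 => hl ?_
    simp [h0, hs'0]

lemma finite_piece_gp (hdeg : ∀ j, Finite {i // deg i = j}) (j : ℕ) :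
    Module.Finite S (piece (gp (S := S) deg) j) := by
  classical
  rw [Module.Finite.iff_fg]
  have hfin : {i | deg i = j}.Finite := hdeg j
  refine ⟨hfin.toFinset.image fun i => Finsupp.single i (1 : S), le_antisymm ?_ ?_⟩
  · rw [Submodule.span_le]
    intro x hx
    simp only [Finset.coe_image, Set.mem_image] at hx
    obtain ⟨i, hi, rfl⟩ := hx
    exact ⟨Finsupp.single i 1, gp_single_of_eq (by simpa using hi) 1⟩
  · rintro _ ⟨x, rfl⟩
    induction x using Finsupp.induction_linear with
    | zero => simp
    | add x y hx hy => rw [map_add]; exact Submodule.add_mem _ hx hy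
    | single i r =>
      by_cases h : deg i = j
      · rw [gp_single_of_eq h]
        have hr : Finsupp.single i r = r • Finsupp.single i (1 : S) := by simp
        rw [hr]
        exact Submodule.smul_mem _ _ (Submodule.subset_span
          (Finset.mem_coe.2 (Finset.mem_image_of_mem _ (hfin.mem_toFinset.2 h))))
      · rw [gp_single_of_ne h]
        exact Submodule.zero_mem _

end FreeModules

/-! ### Relations on a regular sequence -/

section RegularSequences

variable {S : Type*} [CommRing S] {f : ℕ → S} {c : ℕ}

/-- The ideal generated by `f 0, …, f (c - 1)`. -/
def initIdeal (f : ℕ → S) (c : ℕ) : Ideal S where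
  carrier := {x | ∃ r : ℕ → S, x = ∑ a ∈ Finset.range c, f a * r a}
  add_mem' := by
    rintro _ _ ⟨r, rfl⟩ ⟨s, rfl⟩
    exact ⟨r + s, by simp [mul_add, Finset.sum_add_distrib]⟩
  zero_mem' := ⟨0, by simp⟩
  smul_mem' := by
    rintro b _ ⟨r, rfl⟩
    exact ⟨b • r, by simp [Finset.mul_sum, mul_left_comm]⟩

lemma mem_initIdeal_of_lt {a : ℕ} (h : a < c) (r : S) : f a * r ∈ initIdeal f c :=
  ⟨Pi.single a r, by
    rw [Finset.sum_eq_single a (fun b _ hb => by simp [hb])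
      (fun h' => absurd (Finset.mem_range.2 h) h')]
    simp⟩

lemma initIdeal_mono {c c' : ℕ} (h : c ≤ c') : initIdeal f c ≤ initIdeal f c' := by
  rintro _ ⟨r, rfl⟩
  exact Submodule.sum_mem _ fun a ha =>
    mem_initIdeal_of_lt ((Finset.mem_range.1 ha).trans_le h) _

/-- Each `f i`, `i < c`, is a nonzerodivisor modulo its predecessors. -/
def RegSeq (f : ℕ → S) (c : ℕ) : Prop :=
  ∀ i < c, ∀ x, f i * x ∈ initIdeal f i → x ∈ initIdeal f i

lemma RegSeq.mono {c' : ℕ} (h : RegSeq f c) (hc : c' ≤ c) : RegSeq f c' :=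
  fun i hi => h i (hi.trans_le hc)

lemma RegSeq.last_mem (h : RegSeq f (c + 1)) {x : ℕ → S}
    (hx : ∑ a ∈ Finset.range (c + 1), f a * x a = 0) : x c ∈ initIdeal f c := by
  refine h c (Nat.lt_succ_self c) _ ⟨-x, ?_⟩
  rw [Finset.sum_range_succ, add_comm] at hx
  simpa using eq_neg_of_add_eq_zero_left hx

/-- The last coefficient lies in the ideal of the earlier elements; substituting its expression
there gives a shorter relation, to which induction applies. -/
lemma RegSeq.mem (h : RegSeq f c) {x : ℕ → S} (hx : ∑ a ∈ Finset.range c, f a * x a = 0)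
    {a : ℕ} (ha : a < c) : x a ∈ initIdeal f c := by
  induction c generalizing x a with
  | zero => omega
  | succ c ih =>
    obtain ⟨r, hr⟩ := h.last_mem hx
    rcases Nat.lt_succ_iff_lt_or_eq.1 ha with hac | rfl
    · have hsum : ∑ a ∈ Finset.range c, f a * (x a + f c * r a) = 0 := by
        rw [Finset.sum_range_succ, hr, Finset.mul_sum, ← Finset.sum_add_distrib] at hx
        rw [← hx]
        exact Finset.sum_congr rfl fun b _ => by ring
      have := initIdeal_mono (Nat.le_succ c) (ih (h.mono (Nat.le_succ c)) hsum hac)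
      have h2 := Submodule.sub_mem _ this (mem_initIdeal_of_lt (f := f) (Nat.lt_succ_self c) (r a))
      simpa using h2
    · exact initIdeal_mono (Nat.le_succ a) (h.last_mem hx)

variable {ι : Type*}

/-- The submodule `I • T` of a free module `T`. -/
def coeffsIn (I : Ideal S) : Submodule S (ι →₀ S) where
  carrier := {x | ∀ i, x i ∈ I}
  add_mem' hx hy i := I.add_mem (hx i) (hy i)
  zero_mem' _ := I.zero_mem
  smul_mem' r _ hx i := I.mul_mem_left r (hx i)

lemma map_mem_coeffsIn {I : Ideal S} {ι' : Type*} (φ : (ι →₀ S) →ₗ[S] (ι' →₀ S)) {x : ι →₀ S}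
    (hx : x ∈ coeffsIn I) : φ x ∈ coeffsIn I := by
  rw [← Finsupp.sum_single x, Finsupp.sum, map_sum]
  refine Submodule.sum_mem _ fun i _ j => ?_
  have : Finsupp.single i (x i) = x i • Finsupp.single i (1 : S) := by simp
  rw [this, map_smul]
  exact I.mul_mem_right _ (hx i)

/-- The clause about zero entries ensures that decomposing a homogeneous matrix produces homogeneous
matrices. -/
lemma mem_coeffsIn_initIdeal {x : ι →₀ S} (hx : x ∈ coeffsIn (initIdeal f c)) :
    ∃ y : ℕ → ι →₀ S, x = ∑ a ∈ Finset.range c, f a • y a ∧ ∀ a i, x i = 0 → y a i = 0 := by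
  classical
  have : ∀ s, ∃ r : ℕ → S, s ∈ initIdeal f c →
      s = ∑ a ∈ Finset.range c, f a * r a ∧ (s = 0 → r = 0) := fun s => by
    by_cases h0 : s = 0
    · exact ⟨0, fun _ => by simp [h0]⟩
    by_cases hs : s ∈ initIdeal f c
    · obtain ⟨r, hr⟩ := hs
      exact ⟨r, fun _ => ⟨hr, fun h => absurd h h0⟩⟩
    · exact ⟨0, fun h => absurd h hs⟩
  choose r hr using this
  have hr0 : r 0 = 0 := (hr 0 (initIdeal f c).zero_mem).2 rfl
  refine ⟨fun a => x.mapRange (fun s => r s a) (by rw [hr0]; rfl), ?_, fun a i hi => ?_⟩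
  · ext i
    rw [Finsupp.finsetSum_apply]
    simpa using (hr (x i) (hx i)).1
  · simp [hi, hr0]

lemma smul_mem_coeffsIn {a : ℕ} (h : a < c) (x : ι →₀ S) : f a • x ∈ coeffsIn (initIdeal f c) :=
  fun _ => mem_initIdeal_of_lt h _

lemma sum_smul_mem_coeffsIn (y : ℕ → ι →₀ S) :
    ∑ a ∈ Finset.range c, f a • y a ∈ coeffsIn (initIdeal f c) :=
  Submodule.sum_mem _ fun _ ha => smul_mem_coeffsIn (Finset.mem_range.1 ha) _

/-- Applied to the square of a lifted differential, this produces the Eisenbud operators. -/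
lemma exists_eq_sum_smul {deg : ι → ℕ} {φ : Module.End S (ι →₀ S)}
    (hφ : ∀ x, φ x ∈ coeffsIn (initIdeal f c)) :
    ∃ h : ℕ → Module.End S (ι →₀ S), φ = ∑ a ∈ Finset.range c, f a • h a ∧
      ∀ n, Lowers (gp deg) n φ → ∀ a, Lowers (gp deg) n (h a) := by
  choose y hy hy' using fun i => mem_coeffsIn_initIdeal (hφ (Finsupp.single i 1))
  refine ⟨fun a => Finsupp.linearCombination S fun i => y i a, end_ext fun i => ?_,
    fun n hn a => ?_⟩
  · simp [← hy i]
  · rw [lowers_iff] at hn ⊢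
    intro i l hl
    refine hn i l fun h0 => hl ?_
    simpa using hy' i a l h0

lemma RegSeq.apply_mem (h : RegSeq f c) {X : ℕ → Module.End S (ι →₀ S)}
    (hX : ∑ a ∈ Finset.range c, f a • X a = 0) {a : ℕ} (ha : a < c) (x : ι →₀ S) :
    X a x ∈ coeffsIn (initIdeal f c) := fun i => by
  refine h.mem (x := fun a => X a x i) ?_ ha
  have := DFunLike.congr_fun (LinearMap.congr_fun hX x) i
  simpa [LinearMap.sum_apply, Finsupp.finsetSum_apply] using this

/-- For the last index the membership is sharper than in `RegSeq.apply_mem`: only the preceding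
elements of the sequence are needed. The mapping cone relies on this. -/
lemma RegSeq.last_apply_mem (h : RegSeq f (c + 1)) {X : ℕ → Module.End S (ι →₀ S)}
    (hX : ∑ a ∈ Finset.range (c + 1), f a • X a = 0) (x : ι →₀ S) :
    X c x ∈ coeffsIn (initIdeal f c) := fun i => by
  refine h.last_mem (x := fun a => X a x i) ?_
  have := DFunLike.congr_fun (LinearMap.congr_fun hX x) i
  simpa [LinearMap.sum_apply, Finsupp.finsetSum_apply] using this

lemma coef_eq_zero_of_mem {κ : Type*} [CommRing κ] {π : S →+* κ}
    (hf : ∀ a < c, π (f a) = 0) {x : ι →₀ S} (hx : x ∈ coeffsIn (initIdeal f c)) :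
    coef π x = 0 := by
  ext i
  obtain ⟨r, hr⟩ := hx i
  rw [coef_apply, hr, map_sum]
  refine Finset.sum_eq_zero fun a ha => ?_
  rw [map_mul, hf a (Finset.mem_range.1 ha), zero_mul]

end RegularSequences

/-! ### Homology of a graded module with differential -/

section Homology

variable {κ : Type*} [CommRing κ] {E E' : Type*} [AddCommGroup E] [Module κ E] [AddCommGroup E']
  [Module κ E'] {d : Module.End κ E} {d' : Module.End κ E'}

/-- The homology of a module with a differential. -/
abbrev Hlgy (d : Module.End κ E) : Type _ :=
  LinearMap.ker d ⧸ (LinearMap.range d).submoduleOf (LinearMap.ker d)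

/-- The homology class of a cycle. -/
def cls (x : E) (hx : d x = 0) : Hlgy d := Submodule.Quotient.mk ⟨x, hx⟩

lemma exists_cls (h : Hlgy d) : ∃ x hx, h = cls (d := d) x hx := by
  obtain ⟨⟨x, hx⟩, rfl⟩ := Submodule.Quotient.mk_surjective _ h
  exact ⟨x, hx, rfl⟩

lemma cls_eq_zero_iff {x : E} {hx : d x = 0} : cls x hx = 0 ↔ ∃ y, d y = x := by
  rw [cls, Submodule.Quotient.mk_eq_zero]
  rfl

lemma cls_sub {x y : E} (hx : d x = 0) (hy : d y = 0) :
    cls x hx - cls y hy = cls (x - y) (by rw [map_sub, hx, hy, sub_zero]) := rfl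

lemma cls_eq_iff {x y : E} (hx : d x = 0) (hy : d y = 0) :
    cls x hx = cls y hy ↔ ∃ w, d w = x - y := by
  rw [← sub_eq_zero, cls_sub hx hy, cls_eq_zero_iff]

lemma cls_congr {x y : E} (hx : d x = 0) (h : x = y) : cls x hx = cls y (h ▸ hx) := by
  subst h; rfl

/-- `f` maps cycles to cycles and boundaries to boundaries. -/
structure Compat (d : Module.End κ E) (d' : Module.End κ E') (f : E →ₗ[κ] E') : Prop where
  ker : ∀ x, d x = 0 → d' (f x) = 0
  range : ∀ x, ∃ y, d' y = f (d x)

lemma Compat.of_comm {f : Module.End κ E} (h : d * f = f * d) : Compat d d f where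
  ker x hx := by
    have := LinearMap.congr_fun h x
    simp only [Module.End.mul_apply] at this
    rw [this, hx, map_zero]
  range x := ⟨f x, LinearMap.congr_fun h x⟩

/-- The map induced on homology. -/
def hmap {f : E →ₗ[κ] E'} (h : Compat d d' f) : Hlgy d →ₗ[κ] Hlgy d' :=
  Submodule.mapQ _ _ (f.restrict (p := LinearMap.ker d) (q := LinearMap.ker d') h.ker) (by
    rintro ⟨x, hx⟩ ⟨y, rfl⟩
    obtain ⟨w, hw⟩ := h.range y
    exact ⟨w, hw⟩)

variable {p : ℕ → Module.End κ E}

lemma Lowers.compat (hp : IsGrading p) (hd : Lowers p 1 d) (j : ℕ) : Compat d d (p j) where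
  ker x hx := by
    rcases j with _ | j
    · exact hd.apply_low hp one_pos x
    · rw [← hd j x, hx, map_zero]
  range x := ⟨p (j + 1) x, (hd j x).symm⟩

/-- The grading of homology. -/
def hgr (hp : IsGrading p) (hd : Lowers p 1 d) (j : ℕ) : Module.End κ (Hlgy d) :=
  hmap (hd.compat hp j)

lemma isGrading_hgr (hp : IsGrading p) (hd : Lowers p 1 d) : IsGrading (hgr hp hd) where
  apply_same j h := by
    obtain ⟨x, hx, rfl⟩ := exists_cls h
    exact cls_congr _ (hp.apply_same j x)
  apply_ne i j hij h := by
    obtain ⟨x, hx, rfl⟩ := exists_cls h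
    exact cls_congr _ (hp.apply_ne i j hij x)
  eventually_zero h := by
    obtain ⟨x, hx, rfl⟩ := exists_cls h
    obtain ⟨N, hN⟩ := hp.eventually_zero x
    exact ⟨N, fun j hj => cls_congr _ (hN j hj)⟩
  ext_zero h := by
    obtain ⟨x, hx, rfl⟩ := exists_cls h
    intro hx0
    obtain ⟨N, hN⟩ := hp.eventually_zero x
    have := fun j => cls_eq_zero_iff.1 (hx0 j)
    choose y hy using this
    refine cls_eq_zero_iff.2 ⟨∑ j ∈ Finset.range N, y j, ?_⟩
    rw [map_sum]
    exact (Finset.sum_congr rfl fun j _ => hy j).trans (hp.sum_eq hN)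

lemma finite_piece_hgr (hp : IsGrading p) (hd : Lowers p 1 d) [IsNoetherianRing κ]
    [∀ j, Module.Finite κ (piece p j)] (j : ℕ) : Module.Finite κ (piece (hgr hp hd) j) := by
  let C : Submodule κ E := LinearMap.ker d ⊓ piece p j
  have : Module.Finite κ C := Module.Finite.of_injective
    (Submodule.inclusion (inf_le_right : C ≤ piece p j)) (Submodule.inclusion_injective _)
  let g : C →ₗ[κ] Hlgy d := Submodule.mkQ _ ∘ₗ Submodule.inclusion inf_le_left
  refine Module.Finite.of_surjective
    (g.codRestrict (piece (hgr hp hd) j) ?_) ?_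
  · rintro ⟨x, hx, hx'⟩
    rw [(isGrading_hgr hp hd).mem_piece]
    exact cls_congr _ (hp.mem_piece.1 hx')
  · rintro ⟨_, h, rfl⟩
    obtain ⟨x, hx, rfl⟩ := exists_cls h
    exact ⟨⟨p j x, (hd.compat hp j).ker x hx, x, rfl⟩, rfl⟩

lemma hmap_lowers (hp : IsGrading p) (hd : Lowers p 1 d) {n : ℕ} {f : Module.End κ E}
    (hf : Lowers p n f) (h : Compat d d f) : Lowers (hgr hp hd) n (hmap h) := fun j a => by
  obtain ⟨x, hx, rfl⟩ := exists_cls a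
  exact cls_congr _ (hf j x)

end Homology

/-! ### Eisenbud operators commute with chain maps up to homotopy -/

section Commutator

/-- Expand the identity `d * d² = d² * d`. -/
lemma sum_smul_commutator_eq_zero {S B : Type*} [CommRing S] [Ring B] [Algebra S B] {f : ℕ → S}
    {s : Finset ℕ} {d : B} {t : ℕ → B} (dd : d * d = ∑ a ∈ s, f a • t a) :
    ∑ a ∈ s, f a • (d * t a - t a * d) = 0 := by
  have h1 : d * (d * d) - (d * d) * d = 0 := by rw [mul_assoc, sub_self]
  rw [dd, Finset.mul_sum, Finset.sum_mul, ← Finset.sum_sub_distrib] at h1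
  rw [← h1]
  exact Finset.sum_congr rfl fun a _ => by
    rw [smul_sub, mul_smul_comm, smul_mul_assoc]

/-- Expand `d²φ - φd² = d(dφ - φd) + (dφ - φd)d`. Regularity then turns this relation into
commutation of `t a` and `φ`, modulo the ideal, up to the homotopy `h a`. -/
lemma sum_smul_homotopy_eq_zero {S B : Type*} [CommRing S] [Ring B] [Algebra S B] {f : ℕ → S}
    {s : Finset ℕ} {d φ : B} {t h : ℕ → B} (dd : d * d = ∑ a ∈ s, f a • t a)
    (hh : d * φ - φ * d = ∑ a ∈ s, f a • h a) :
    ∑ a ∈ s, f a • (t a * φ - (φ * t a + (d * h a + h a * d))) = 0 := by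
  have h1 : (d * d) * φ - (φ * (d * d) + (d * (d * φ - φ * d) + (d * φ - φ * d) * d)) = 0 := by
    noncomm_ring
  rw [hh, dd] at h1
  rw [← h1]
  simp only [Finset.mul_sum, Finset.sum_mul, ← Finset.sum_sub_distrib, ← Finset.sum_add_distrib]
  exact Finset.sum_congr rfl fun a _ => by
    simp only [smul_sub, smul_add, mul_smul_comm, smul_mul_assoc]

variable {S : Type*} [CommRing S] {f : ℕ → S} {c : ℕ} {ι : Type*} {deg : ι → ℕ}
  {d : Module.End S (ι →₀ S)} {t : ℕ → Module.End S (ι →₀ S)}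

lemma RegSeq.differential_commutator (hreg : RegSeq f c)
    (dd : d * d = ∑ a ∈ Finset.range c, f a • t a) {a : ℕ} (ha : a < c) (x : ι →₀ S) :
    d (t a x) - t a (d x) ∈ coeffsIn (initIdeal f c) := by
  have key := sum_smul_commutator_eq_zero (B := Module.End S (ι →₀ S)) dd
  exact hreg.apply_mem (X := fun a => d * t a - t a * d) key ha x

/-- The operators attached to a lifted complex commute with chain maps up to homotopy. -/
lemma RegSeq.commutator (hreg : RegSeq f c) (dd : d * d = ∑ a ∈ Finset.range c, f a • t a)
    {φ : Module.End S (ι →₀ S)} (hφ : ∀ x, d (φ x) - φ (d x) ∈ coeffsIn (initIdeal f c)) :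
    ∃ h : ℕ → Module.End S (ι →₀ S), ∀ a < c, ∀ x,
      t a (φ x) - (φ (t a x) + (d (h a x) + h a (d x))) ∈ coeffsIn (initIdeal f c) := by
  obtain ⟨h, hh, -⟩ := exists_eq_sum_smul (deg := fun _ => 0) (φ := d * φ - φ * d) hφ
  have key := sum_smul_homotopy_eq_zero (B := Module.End S (ι →₀ S)) dd hh
  exact ⟨h, fun a ha x => hreg.apply_mem
    (X := fun a => t a * φ - (φ * t a + (d * h a + h a * d))) key ha x⟩

variable {κ : Type*} [CommRing κ] {π : S →+* κ}

lemma bc_eq_of_mem (hπ : ∀ a < c, π (f a) = 0) {φ ψ : Module.End S (ι →₀ S)}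
    (h : ∀ x, φ x - ψ x ∈ coeffsIn (initIdeal f c)) : bc π φ = bc π ψ :=
  end_ext fun i => by
    rw [bc_single, bc_single, ← sub_eq_zero, ← map_sub]
    exact coef_eq_zero_of_mem hπ (h _)

lemma RegSeq.bc_differential_comm (hreg : RegSeq f c)
    (dd : d * d = ∑ a ∈ Finset.range c, f a • t a) (hπ : ∀ a < c, π (f a) = 0) {a : ℕ}
    (ha : a < c) : bc π d * bc π (t a) = bc π (t a) * bc π d := by
  rw [← map_mul, ← map_mul]
  exact bc_eq_of_mem hπ (hreg.differential_commutator dd ha)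

lemma RegSeq.bc_commutator (hreg : RegSeq f c) (dd : d * d = ∑ a ∈ Finset.range c, f a • t a)
    (hπ : ∀ a < c, π (f a) = 0)
    {φ : Module.End S (ι →₀ S)} (hφ : ∀ x, d (φ x) - φ (d x) ∈ coeffsIn (initIdeal f c)) :
    ∃ h : ℕ → Module.End κ (ι →₀ κ), ∀ a < c,
      bc π (t a) * bc π φ = bc π φ * bc π (t a) + (bc π d * h a + h a * bc π d) := by
  obtain ⟨h, hh⟩ := hreg.commutator dd hφ
  refine ⟨fun a => bc π (h a), fun a ha => ?_⟩
  simp only [← map_add, ← map_mul]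
  exact bc_eq_of_mem hπ (hh a ha)

end Commutator

/-! ### Block matrices on a direct sum with one summand shifted -/

section Blocks

variable {ι : Type*} {S S' : Type*} [CommRing S] [CommRing S']

/-- The vector with components `x` and `y`. -/
noncomputable def pr (x y : ι →₀ S) : (ι ⊕ ι) →₀ S :=
  (Finsupp.sumFinsuppLEquivProdFinsupp S).symm (x, y)

lemma exists_pr (w : (ι ⊕ ι) →₀ S) : ∃ x y, w = pr x y :=
  ⟨(Finsupp.sumFinsuppLEquivProdFinsupp S w).1, (Finsupp.sumFinsuppLEquivProdFinsupp S w).2,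
    by simp [pr]⟩

lemma pr_inl (x y : ι →₀ S) (i : ι) : pr x y (Sum.inl i) = x i := by
  simp [pr]

lemma pr_inr (x y : ι →₀ S) (i : ι) : pr x y (Sum.inr i) = y i := by
  simp [pr]

lemma pr_ext {w w' : (ι ⊕ ι) →₀ S} (h : ∀ i, w (Sum.inl i) = w' (Sum.inl i))
    (h' : ∀ i, w (Sum.inr i) = w' (Sum.inr i)) : w = w' :=
  Finsupp.ext fun i => by rcases i with i | i <;> simp [h, h']

lemma pr_injective {x y x' y' : ι →₀ S} (h : pr x y = pr x' y') : x = x' ∧ y = y' :=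
  ⟨Finsupp.ext fun i => by rw [← pr_inl x y, h, pr_inl],
    Finsupp.ext fun i => by rw [← pr_inr x y, h, pr_inr]⟩

lemma pr_add (x y x' y' : ι →₀ S) : pr x y + pr x' y' = pr (x + x') (y + y') :=
  pr_ext (by simp [pr_inl]) (by simp [pr_inr])

lemma pr_sub (x y x' y' : ι →₀ S) : pr x y - pr x' y' = pr (x - x') (y - y') :=
  pr_ext (by simp [pr_inl]) (by simp [pr_inr])

lemma pr_smul (r : S) (x y : ι →₀ S) : r • pr x y = pr (r • x) (r • y) :=
  pr_ext (by simp [pr_inl]) (by simp [pr_inr])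

lemma pr_zero : pr (0 : ι →₀ S) 0 = 0 :=
  pr_ext (by simp [pr_inl]) (by simp [pr_inr])

lemma coef_pr (g : S →+* S') (x y : ι →₀ S) : coef g (pr x y) = pr (coef g x) (coef g y) :=
  pr_ext (by simp [pr_inl]) (by simp [pr_inr])

lemma single_inl (i : ι) (r : S) : Finsupp.single (Sum.inl i) r = pr (Finsupp.single i r) 0 := by
  classical
  exact pr_ext (by simp [pr_inl, Finsupp.single_apply]) (by simp [pr_inr])

lemma single_inr (i : ι) (r : S) : Finsupp.single (Sum.inr i) r = pr 0 (Finsupp.single i r) := by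
  classical
  exact pr_ext (by simp [pr_inl]) (by simp [pr_inr, Finsupp.single_apply])

lemma pr_mem_coeffsIn {I : Ideal S} {x y : ι →₀ S} :
    pr x y ∈ coeffsIn I ↔ x ∈ coeffsIn I ∧ y ∈ coeffsIn I := by
  constructor
  · exact fun h => ⟨fun i => pr_inl x y i ▸ h (Sum.inl i), fun i => pr_inr x y i ▸ h (Sum.inr i)⟩
  · rintro ⟨hx, hy⟩ (i | i)
    · exact (pr_inl x y i).symm ▸ hx i
    · exact (pr_inr x y i).symm ▸ hy i

/-- The first projection. -/
noncomputable def prFst : ((ι ⊕ ι) →₀ S) →ₗ[S] (ι →₀ S) :=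
  LinearMap.fst S _ _ ∘ₗ (Finsupp.sumFinsuppLEquivProdFinsupp S).toLinearMap

lemma prFst_pr (x y : ι →₀ S) : prFst (pr x y) = x := by simp [prFst, pr]

/-- The endomorphism given by a matrix with four blocks. -/
noncomputable def blk (α β γ δ : Module.End S (ι →₀ S)) : Module.End S ((ι ⊕ ι) →₀ S) :=
  (Finsupp.sumFinsuppLEquivProdFinsupp S).symm.toLinearMap ∘ₗ
    ((α.coprod β).prod (γ.coprod δ)) ∘ₗ (Finsupp.sumFinsuppLEquivProdFinsupp S).toLinearMap

lemma blk_pr (α β γ δ : Module.End S (ι →₀ S)) (x y : ι →₀ S) :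
    blk α β γ δ (pr x y) = pr (α x + β y) (γ x + δ y) := by
  simp [blk, pr]

lemma bc_blk (g : S →+* S') (α β γ δ : Module.End S (ι →₀ S)) :
    bc g (blk α β γ δ) = blk (bc g α) (bc g β) (bc g γ) (bc g δ) := by
  refine end_ext fun i => ?_
  rcases i with i | i
  · rw [bc_single, single_inl, single_inl, blk_pr, coef_pr, blk_pr]
    simp [bc_single]
  · rw [bc_single, single_inr, single_inr, blk_pr, coef_pr, blk_pr]
    simp [bc_single]

/-- The degree function on the basis of `T ⊕ T[1]`. -/
def degSum (deg : ι → ℕ) : ι ⊕ ι → ℕ := Sum.elim deg fun i => deg i + 1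

lemma gp_degSum_zero (deg : ι → ℕ) (x y : ι →₀ S) :
    gp (degSum deg) 0 (pr x y) = pr (gp deg 0 x) 0 :=
  pr_ext (fun i => by simp [gp_apply, pr_inl, degSum]) (fun i => by simp [gp_apply, pr_inr, degSum])

lemma gp_degSum_succ (deg : ι → ℕ) (j : ℕ) (x y : ι →₀ S) :
    gp (degSum deg) (j + 1) (pr x y) = pr (gp deg (j + 1) x) (gp deg j y) :=
  pr_ext (fun i => by simp [gp_apply, pr_inl, degSum]) (fun i => by simp [gp_apply, pr_inr, degSum])

lemma prFst_gp (deg : ι → ℕ) (j : ℕ) (w : (ι ⊕ ι) →₀ S) :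
    prFst (gp (degSum deg) j w) = gp deg j (prFst w) := by
  obtain ⟨x, y, rfl⟩ := exists_pr w
  rcases j with _ | j
  · rw [gp_degSum_zero, prFst_pr, prFst_pr]
  · rw [gp_degSum_succ, prFst_pr, prFst_pr]

lemma Lowers.blk {deg : ι → ℕ} {n : ℕ} {α β γ δ : Module.End S (ι →₀ S)}
    (hα : Lowers (gp deg) n α) (hβ : ∀ i l, β (Finsupp.single i 1) l ≠ 0 → deg l + n = deg i + 1)
    (hγ : Lowers (gp deg) (n + 1) γ) (hδ : Lowers (gp deg) n δ) :
    Lowers (gp (degSum deg)) n (blk α β γ δ) := by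
  rw [lowers_iff] at hα hγ hδ ⊢
  rintro (i | i) (l | l) h
  · rw [single_inl, blk_pr, pr_inl, map_zero, add_zero] at h
    exact hα i l h
  · rw [single_inl, blk_pr, pr_inr, map_zero, add_zero] at h
    have := hγ i l h
    simp only [degSum, Sum.elim_inl, Sum.elim_inr]
    omega
  · rw [single_inr, blk_pr, pr_inl, map_zero, zero_add] at h
    exact hβ i l h
  · rw [single_inr, blk_pr, pr_inr, map_zero, zero_add] at h
    have := hδ i l h
    simp only [degSum, Sum.elim_inr]
    omega

end Blocks

/-! ### Projective dimension in short exact sequences -/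

section ProjectiveDimension

variable {S : Type u} [CommRing S] {A B C : Type u} [AddCommGroup A] [Module S A] [AddCommGroup B]
  [Module S B] [AddCommGroup C] [Module S C]

lemma HasShortExact.exists_shortExact (h : HasShortExact (R := S) A B C) :
    ∃ (f : ModuleCat.of S A ⟶ ModuleCat.of S B) (g : ModuleCat.of S B ⟶ ModuleCat.of S C)
      (w : f ≫ g = 0), (ShortComplex.mk f g w).ShortExact := by
  obtain ⟨f, g, hf, hfg, hg⟩ := h
  exact ⟨ModuleCat.ofHom f, ModuleCat.ofHom g,
    by ext x; exact hfg.apply_apply_eq_zero x, ModuleCat.shortComplex_shortExact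
      (ModuleCat.shortComplexOfCompEqZero f g hfg.linearMap_comp_eq_zero) hfg hf hg⟩

/-- `N` has projective dimension less than `n`. -/
abbrev PdLT (S : Type u) [CommRing S] (N : Type u) [AddCommGroup N] [Module S N] (n : ℕ) : Prop :=
  HasProjectiveDimensionLT (ModuleCat.of S N) n

lemma PdLT.mono {m n : ℕ} (h : PdLT S A m) (hmn : m ≤ n) : PdLT S A n :=
  hasProjectiveDimensionLT_of_ge _ m n hmn

lemma HasShortExact.pdLT_left (h : HasShortExact (R := S) A B C) {n : ℕ} (hB : PdLT S B n)
    (hC : PdLT S C (n + 1)) : PdLT S A n := by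
  obtain ⟨f, g, w, hs⟩ := h.exists_shortExact
  exact hs.hasProjectiveDimensionLT_X₁ n hB hC

lemma HasShortExact.pdLT_middle (h : HasShortExact (R := S) A B C) {n : ℕ} (hA : PdLT S A n)
    (hC : PdLT S C n) : PdLT S B n := by
  obtain ⟨f, g, w, hs⟩ := h.exists_shortExact
  exact hs.hasProjectiveDimensionLT_X₂ n hA hC

lemma HasShortExact.pdLT_right (h : HasShortExact (R := S) A B C) {n : ℕ} (hA : PdLT S A n)
    (hB : PdLT S B (n + 1)) : PdLT S C (n + 1) := by
  obtain ⟨f, g, w, hs⟩ := h.exists_shortExact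
  exact hs.hasProjectiveDimensionLT_X₃ n hA hB

lemma pdLT_one_iff : PdLT S A 1 ↔ Module.Projective S A := by
  rw [PdLT, ← projective_iff_hasProjectiveDimensionLT_one]
  exact (IsProjective.iff_projective A).symm

lemma PdLT.of_equiv {n : ℕ} (h : PdLT S A n) (e : A ≃ₗ[S] B) : PdLT S B n :=
  hasProjectiveDimensionLT_of_iso e.toModuleIso n

end ProjectiveDimension

/-! ### Lifted resolutions and removal of one element of the sequence -/

section LiftedComplex

variable {S : Type u} [CommRing S] {ι : Type u} {N : Type u} [AddCommGroup N] [Module S N]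

/-- A lift to `S` of a free resolution of `N` over `S ⧸ (f 0, …, f (c - 1))`, with the operators
`t a` that measure the failure of the lifted differential to square to zero. -/
structure LiftedComplex (f : ℕ → S) (c : ℕ) (deg : ι → ℕ) (d : Module.End S (ι →₀ S))
    (t : ℕ → Module.End S (ι →₀ S)) (ε : (ι →₀ S) →ₗ[S] N) : Prop where
  d_low : Lowers (gp deg) 1 d
  t_low : ∀ a < c, Lowers (gp deg) 2 (t a)
  dd : d * d = ∑ a ∈ Finset.range c, f a • t a
  eps_surj : Function.Surjective ε
  eps_d : ∀ x, ε (d x) = 0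
  eps_pos : ∀ j x, 1 ≤ j → ε (gp deg j x) = 0
  ann : ∀ a < c, ∀ n : N, f a • n = 0
  exact : ∀ x, d x ∈ coeffsIn (initIdeal f c) → ε x = 0 →
    ∃ y, x - d y ∈ coeffsIn (initIdeal f c)

variable {f : ℕ → S} {c : ℕ} {deg : ι → ℕ} {d : Module.End S (ι →₀ S)}
    {t : ℕ → Module.End S (ι →₀ S)} {ε : (ι →₀ S) →ₗ[S] N}

lemma initIdeal_zero : initIdeal f 0 = ⊥ := by
  ext x
  constructor
  · rintro ⟨r, rfl⟩; simp
  · rintro h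
    rw [Ideal.mem_bot] at h
    rw [h]; exact Submodule.zero_mem _

lemma mem_coeffsIn_initIdeal_zero {x : ι →₀ S} : x ∈ coeffsIn (initIdeal f 0) ↔ x = 0 := by
  rw [initIdeal_zero]
  constructor
  · exact fun h => Finsupp.ext h
  · rintro rfl; exact Submodule.zero_mem _

lemma mem_coeffsIn_initIdeal_succ {x : ι →₀ S} (h : x ∈ coeffsIn (initIdeal f (c + 1))) :
    ∃ y, x - f c • y ∈ coeffsIn (initIdeal f c) := by
  obtain ⟨y, hy, -⟩ := mem_coeffsIn_initIdeal h
  refine ⟨y c, ?_⟩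
  rw [hy, Finset.sum_range_succ, add_sub_cancel_right]
  exact sum_smul_mem_coeffsIn y

/-- The mapping cone construction: a lifted complex over `(f 0, …, f c)` gives one for the same
module over `(f 0, …, f (c - 1))`. -/
lemma LiftedComplex.cone (h : LiftedComplex f (c + 1) deg d t ε) (hreg : RegSeq f (c + 1)) :
    ∃ v : ℕ → Module.End S (ι →₀ S),
      LiftedComplex f c (degSum deg) (blk d (f c • 1) (-t c) (-d))
        (fun a => blk (t a) 0 (v a) (t a)) (ε ∘ₗ prFst) := by
  have key := sum_smul_commutator_eq_zero (B := Module.End S (ι →₀ S)) h.dd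
  -- The off-diagonal block of the squared cone differential is `d t_c - t_c d`. Its entries lie in
  -- the ideal of `f 0, …, f (c - 1)`, which provides the blocks `v a`.
  have hlast := hreg.last_apply_mem (X := fun a => d * t a - t a * d) key
  obtain ⟨v, hv, hvlow⟩ := exists_eq_sum_smul (deg := deg) (φ := d * t c - t c * d) hlast
  have hv' : ∀ x, d (t c x) - t c (d x) = ∑ a ∈ Finset.range c, f a • v a x := fun x => by
    have := LinearMap.congr_fun hv x
    simpa [LinearMap.sum_apply] using this
  have hdd : ∀ x, d (d x) = ∑ a ∈ Finset.range c, f a • t a x + f c • t c x := fun x => by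
    have := LinearMap.congr_fun h.dd x
    rw [Finset.sum_range_succ] at this
    simpa [LinearMap.sum_apply] using this
  have hcc : c < c + 1 := Nat.lt_succ_self c
  refine ⟨v, ?_, fun a ha => ?_, ?_, ?_, ?_, ?_, ?_, ?_⟩
  · classical
    refine h.d_low.blk (fun i l hl => ?_) (h.t_low c hcc).neg h.d_low.neg
    rw [LinearMap.smul_apply, Module.End.one_apply, Finsupp.smul_apply, smul_eq_mul] at hl
    have : i = l := by
      by_contra hne
      rw [Finsupp.single_apply, if_neg hne, mul_zero] at hl
      exact hl rfl
    rw [this]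
  · refine (h.t_low a (ha.trans hcc)).blk (fun i l hl => absurd rfl hl) (hvlow 3 ?_ a)
      (h.t_low a (ha.trans hcc))
    have h1 := h.d_low.mul (h.t_low c hcc)
    have h2 := (h.t_low c hcc).mul h.d_low
    exact h1.sub h2
  · ext1 i
    refine LinearMap.ext_ring ?_
    obtain ⟨x, y, hxy⟩ := exists_pr (Finsupp.single i (1 : S))
    change (blk d (f c • 1) (-t c) (-d)) ((blk d (f c • 1) (-t c) (-d)) (Finsupp.single i (1 : S)))
      = (∑ a ∈ Finset.range c, f a • blk (t a) 0 (v a) (t a)) (Finsupp.single i (1 : S))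
    rw [hxy, LinearMap.sum_apply, blk_pr, blk_pr]
    have hsum : ∀ s : Finset ℕ, ∑ a ∈ s, (f a • blk (t a) 0 (v a) (t a)) (pr x y) =
        pr (∑ a ∈ s, f a • t a x) (∑ a ∈ s, f a • (v a x + t a y)) := fun s => by
      classical
      induction s using Finset.induction_on with
      | empty => simp [pr_zero]
      | insert a s ha ih =>
        rw [Finset.sum_insert ha, Finset.sum_insert ha, Finset.sum_insert ha, ih,
          LinearMap.smul_apply, blk_pr, pr_smul, pr_add]
        simp
    rw [hsum]
    congr 1
    · simp only [map_add, LinearMap.smul_apply, Module.End.one_apply, LinearMap.neg_apply,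
        smul_neg, hdd, map_smul]
      abel
    · simp only [map_add, LinearMap.smul_apply, Module.End.one_apply, LinearMap.neg_apply,
        map_neg, neg_add_rev, neg_neg, map_smul, smul_neg, hdd, smul_add, Finset.sum_add_distrib, ← hv']
      abel
  · exact h.eps_surj.comp fun x => ⟨pr x 0, prFst_pr x 0⟩
  · intro w
    obtain ⟨x, y, rfl⟩ := exists_pr w
    rw [LinearMap.comp_apply, blk_pr, prFst_pr, map_add, h.eps_d, zero_add, LinearMap.smul_apply,
      map_smul, h.ann c hcc]
  · intro j w hj
    rw [LinearMap.comp_apply, prFst_gp, h.eps_pos j _ hj]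
  · exact fun a ha => h.ann a (ha.trans hcc)
  -- Exactness of the cone: modulo the smaller ideal, exactness of the given complex gives `x = d x'
  -- + f c • y'`. The second coordinate is then corrected by cancelling `f c`.
  · intro w hw hεw
    obtain ⟨x, y, rfl⟩ := exists_pr w
    rw [blk_pr, pr_mem_coeffsIn] at hw
    rw [LinearMap.comp_apply, prFst_pr] at hεw
    obtain ⟨hw1, hw2⟩ := hw
    have hmono : ∀ z : ι →₀ S, z ∈ coeffsIn (initIdeal f c) → z ∈ coeffsIn (initIdeal f (c + 1)) :=
      fun z hz i => initIdeal_mono (Nat.le_succ c) (hz i)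
    have hdx : d x ∈ coeffsIn (initIdeal f (c + 1)) := by
      have := Submodule.sub_mem _ (hmono _ hw1) (smul_mem_coeffsIn hcc y)
      simpa using this
    obtain ⟨x', hx'⟩ := h.exact x hdx hεw
    obtain ⟨y', hy'⟩ := mem_coeffsIn_initIdeal_succ hx'
    refine ⟨pr x' y', ?_⟩
    rw [blk_pr, pr_sub, pr_mem_coeffsIn]
    have h1 : x - (d x' + (f c • (1 : Module.End S (ι →₀ S))) y') ∈ coeffsIn (initIdeal f c) := by
      simpa [sub_sub] using hy'
    refine ⟨h1, ?_⟩
    set b := y - ((-t c) x' + (-d) y') with hb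
    have h2 : f c • b ∈ coeffsIn (initIdeal f c) := by
      -- Obtained by applying `d` to the error in the first coordinate and replacing `d (d x')` by
      -- `∑ f a • t a x'`; this puts `f c • b` in the smaller ideal.
      have e : f c • b = (d x + (f c • (1 : Module.End S (ι →₀ S))) y)
          - d (x - (d x' + (f c • (1 : Module.End S (ι →₀ S))) y'))
          - ∑ a ∈ Finset.range c, f a • t a x' := by
        simp only [hb, map_sub, map_add, hdd, LinearMap.smul_apply, Module.End.one_apply,
          LinearMap.neg_apply, smul_sub, smul_add, smul_neg, map_smul]
        abel
      rw [e]
      exact Submodule.sub_mem _ (Submodule.sub_mem _ hw1 (map_mem_coeffsIn d h1))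
        (sum_smul_mem_coeffsIn _)
    exact fun i => hreg c hcc _ (h2 i)

end LiftedComplex

/-! ### The empty sequence: resolutions that split in high degrees -/

section Base

variable {S : Type u} [CommRing S] {ι : Type u} {N : Type u} [AddCommGroup N] [Module S N]
  {f : ℕ → S} {deg : ι → ℕ} {d : Module.End S (ι →₀ S)}
  {t : ℕ → Module.End S (ι →₀ S)} {ε : (ι →₀ S) →ₗ[S] N}

/-- The cycles of degree `j` in a free resolution with augmentation `ε`. -/
noncomputable def cyclesIn (deg : ι → ℕ) (d : Module.End S (ι →₀ S)) (ε : (ι →₀ S) →ₗ[S] N) (j : ℕ) :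
    Submodule S (ι →₀ S) :=
  piece (gp deg) j ⊓ (LinearMap.ker d ⊓ LinearMap.ker ε)

lemma mem_cyclesIn {j : ℕ} {x : ι →₀ S} :
    x ∈ cyclesIn deg d ε j ↔ gp deg j x = x ∧ d x = 0 ∧ ε x = 0 := by
  rw [cyclesIn, Submodule.mem_inf, (isGrading_gp deg).mem_piece]
  rfl

lemma projective_piece (deg : ι → ℕ) (j : ℕ) :
    Module.Projective S (piece (gp (S := S) deg) j) :=
  Module.Projective.of_split (piece (gp (S := S) deg) j).subtype (gp deg j).rangeRestrict
    (LinearMap.ext fun x => Subtype.ext ((isGrading_gp deg).mem_piece.1 x.2))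

lemma LiftedComplex.eps_gp_zero {c : ℕ} (h : LiftedComplex f c deg d t ε) (x : ι →₀ S) :
    ε (gp deg 0 x) = ε x := by
  obtain ⟨n, hn⟩ := (isGrading_gp deg).eventually_zero x
  conv_rhs => rw [← (isGrading_gp deg).sum_eq (N := n + 1) fun j hj => hn j (by omega)]
  rw [Finset.sum_range_succ', map_add, map_sum, Finset.sum_eq_zero, zero_add]
  exact fun j _ => h.eps_pos _ _ (Nat.succ_le_succ (Nat.zero_le j))

lemma LiftedComplex.exact_zero (h : LiftedComplex f 0 deg d t ε) {x : ι →₀ S} (hx : d x = 0)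
    (hε : ε x = 0) : ∃ y, x = d y := by
  obtain ⟨y, hy⟩ := h.exact x (mem_coeffsIn_initIdeal_zero.2 hx) hε
  exact ⟨y, sub_eq_zero.1 (mem_coeffsIn_initIdeal_zero.1 hy)⟩

lemma LiftedComplex.d_d (h : LiftedComplex f 0 deg d t ε) (x : ι →₀ S) : d (d x) = 0 := by
  have := LinearMap.congr_fun h.dd x
  simpa using this

lemma LiftedComplex.d_mem_cyclesIn (h : LiftedComplex f 0 deg d t ε) (j : ℕ) (x : ι →₀ S) :
    d (gp deg (j + 1) x) ∈ cyclesIn deg d ε j := by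
  rw [mem_cyclesIn]
  refine ⟨?_, h.d_d _, h.eps_d _⟩
  rw [h.d_low, (isGrading_gp deg).apply_same]

lemma LiftedComplex.exists_of_mem_cyclesIn (h : LiftedComplex f 0 deg d t ε) {j : ℕ} {x : ι →₀ S}
    (hx : x ∈ cyclesIn deg d ε j) : ∃ y, d (gp deg (j + 1) y) = x := by
  obtain ⟨h1, h2, h3⟩ := mem_cyclesIn.1 hx
  obtain ⟨y, rfl⟩ := h.exact_zero h2 h3
  exact ⟨y, by rw [← h.d_low, h1]⟩

/-- The differential, as a map onto the cycles. -/
noncomputable def LiftedComplex.toCycles (h : LiftedComplex f 0 deg d t ε) (j : ℕ) :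
    piece (gp (S := S) deg) (j + 1) →ₗ[S] cyclesIn deg d ε j :=
  d.restrict fun x hx => by
    rw [← (isGrading_gp deg).mem_piece.1 hx]
    exact h.d_mem_cyclesIn j x

lemma LiftedComplex.toCycles_surjective (h : LiftedComplex f 0 deg d t ε) (j : ℕ) :
    Function.Surjective (h.toCycles j) := by
  rintro ⟨x, hx⟩
  obtain ⟨y, hy⟩ := h.exists_of_mem_cyclesIn hx
  exact ⟨⟨_, y, rfl⟩, Subtype.ext hy⟩

lemma LiftedComplex.hasShortExact_zero (h : LiftedComplex f 0 deg d t ε) :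
    HasShortExact (R := S) (cyclesIn deg d ε 0) (piece (gp (S := S) deg) 0) N := by
  refine ⟨Submodule.inclusion inf_le_left, ε ∘ₗ (piece (gp (S := S) deg) 0).subtype,
    Submodule.inclusion_injective _, ?_, fun n => ?_⟩
  · rintro ⟨x, hx⟩
    constructor
    · intro h0
      refine ⟨⟨x, mem_cyclesIn.2 ⟨(isGrading_gp deg).mem_piece.1 hx, ?_, h0⟩⟩, rfl⟩
      rw [← (isGrading_gp deg).mem_piece.1 hx]
      exact h.d_low.apply_low (isGrading_gp deg) one_pos x
    · rintro ⟨⟨y, hy⟩, hxy⟩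
      obtain rfl : y = x := congrArg Subtype.val hxy
      exact (mem_cyclesIn.1 hy).2.2
  · obtain ⟨x, rfl⟩ := h.eps_surj n
    exact ⟨⟨_, x, rfl⟩, h.eps_gp_zero x⟩

lemma LiftedComplex.hasShortExact_succ (h : LiftedComplex f 0 deg d t ε) (j : ℕ) :
    HasShortExact (R := S) (cyclesIn deg d ε (j + 1)) (piece (gp (S := S) deg) (j + 1))
      (cyclesIn deg d ε j) := by
  refine ⟨Submodule.inclusion inf_le_left, h.toCycles j,
    Submodule.inclusion_injective _, ?_, h.toCycles_surjective j⟩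
  rintro ⟨x, hx⟩
  have hx' := (isGrading_gp deg).mem_piece.1 hx
  constructor
  · intro h0
    refine ⟨⟨x, mem_cyclesIn.2 ⟨hx', congrArg Subtype.val h0, ?_⟩⟩, rfl⟩
    rw [← hx']
    exact h.eps_pos (j + 1) x (Nat.succ_le_succ (Nat.zero_le j))
  · rintro ⟨⟨y, hy⟩, hxy⟩
    obtain rfl : y = x := congrArg Subtype.val hxy
    exact Subtype.ext (mem_cyclesIn.1 hy).2.1

/-- Dimension shifting: the cycles of degree `j` form a `(j + 1)`-st syzygy of `N`. -/
lemma LiftedComplex.pdLT_cyclesIn (h : LiftedComplex f 0 deg d t ε) (j m : ℕ)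
    (hN : PdLT S N (m + j + 2)) : PdLT S (cyclesIn deg d ε j) (m + 1) := by
  have hT : ∀ j m, PdLT S (piece (gp (S := S) deg) j) (m + 1) := fun j m =>
    (pdLT_one_iff.2 (projective_piece deg j)).mono (Nat.succ_le_succ (Nat.zero_le m))
  induction j generalizing m with
  | zero => exact h.hasShortExact_zero.pdLT_left (hT 0 m) hN
  | succ j ih =>
    exact (h.hasShortExact_succ j).pdLT_left (hT (j + 1) m)
      (ih (m + 1) (hN.mono (by omega)))

lemma LiftedComplex.exists_section (h : LiftedComplex f 0 deg d t ε) {j : ℕ}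
    (hj : Module.Projective S (cyclesIn deg d ε j)) :
    ∃ σ : cyclesIn deg d ε j →ₗ[S] (ι →₀ S), (∀ y, d (σ y) = y) ∧
      ∀ y, gp deg (j + 1) (σ y) = σ y := by
  obtain ⟨σ, hσ⟩ := Module.projective_lifting_property (h.toCycles j) LinearMap.id
    (h.toCycles_surjective j)
  refine ⟨(piece (gp (S := S) deg) (j + 1)).subtype ∘ₗ σ, fun y => ?_, fun y => ?_⟩
  · exact congrArg Subtype.val (LinearMap.congr_fun hσ y)
  · exact (isGrading_gp deg).mem_piece.1 (σ y).2

/-- A section of `d` over the cycles must be defined on the whole free module, so that its matrix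
can be reduced to the residue field. Projectivity of the cycles in two consecutive degrees supplies
both the section and a retraction onto its domain. -/
lemma LiftedComplex.exists_section_extend (h : LiftedComplex f 0 deg d t ε) {j : ℕ}
    (hN : PdLT S N (j + 2)) :
    ∃ σ : Module.End S (ι →₀ S), ∀ y ∈ cyclesIn deg d ε (j + 1),
      d (σ y) = y ∧ gp deg (j + 2) (σ y) = σ y := by
  obtain ⟨σ, hσ, hσ'⟩ := h.exists_section
    (pdLT_one_iff.1 (h.pdLT_cyclesIn j 0 (hN.mono (by omega))))
  obtain ⟨τ, hτ, hτ'⟩ := h.exists_section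
    (pdLT_one_iff.1 (h.pdLT_cyclesIn (j + 1) 0 (hN.mono (by omega))))
  let δ : (ι →₀ S) →ₗ[S] cyclesIn deg d ε j :=
    (d ∘ₗ gp deg (j + 1)).codRestrict _ fun x => h.d_mem_cyclesIn j x
  -- The splitting `σ` one degree lower makes `1 - σ d` a retraction of the module of degree `j + 1`
  -- onto its cycles.
  let r : (ι →₀ S) →ₗ[S] cyclesIn deg d ε (j + 1) :=
    (gp deg (j + 1) - σ ∘ₗ δ).codRestrict _ fun x => by
      rw [mem_cyclesIn, LinearMap.sub_apply, LinearMap.comp_apply, map_sub, map_sub, map_sub, hσ,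
        hσ', (isGrading_gp deg).apply_same, h.eps_pos _ _ (Nat.succ_le_succ (Nat.zero_le j)),
        ← hσ', h.eps_pos _ _ (Nat.succ_le_succ (Nat.zero_le j))]
      exact ⟨rfl, sub_self _, sub_self _⟩
  refine ⟨τ ∘ₗ r, fun y hy => ?_⟩
  have hr : r y = ⟨y, hy⟩ := by
    obtain ⟨h1, h2, -⟩ := mem_cyclesIn.1 hy
    have hδ : δ y = 0 := Subtype.ext (by
      change d (gp deg (j + 1) y) = 0
      rw [h1, h2])
    refine Subtype.ext ?_
    change gp deg (j + 1) y - σ (δ y) = y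
    rw [hδ, map_zero, sub_zero, h1]
  rw [LinearMap.comp_apply, hr]
  exact ⟨hτ _, hτ' _⟩

variable {κ : Type*} [Field κ] {π : S →+* κ}

/-- If the module has finite projective dimension, then the homology of a free resolution with
coefficients in a field vanishes in large degrees. -/
lemma LiftedComplex.homology_eq_zero (h : LiftedComplex f 0 deg d t ε)
    (hπ : Function.Surjective π) {j : ℕ} (hN : PdLT S N (j + 2)) (x : ι →₀ κ)
    (hx : bc π d (gp deg (j + 2) x) = 0) : ∃ y, bc π d y = gp deg (j + 2) x := by
  obtain ⟨x, rfl⟩ := coef_surjective hπ x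
  rw [← coef_gp] at hx ⊢
  set w := gp deg (j + 2) x with hw
  rw [bc_coef] at hx
  obtain ⟨σ, hσ⟩ := h.exists_section_extend hN
  obtain ⟨h1, h2⟩ := hσ (d w) (h.d_mem_cyclesIn (j + 1) x)
  -- The correction `σ (d w)` makes the lift `w` an honest cycle over `S`, and disappears after
  -- reduction because `d w` reduces to zero.
  obtain ⟨y, hy⟩ := h.exact_zero (x := w - σ (d w)) (by rw [map_sub, h1, sub_self]) (by
    rw [map_sub, ← h2, hw, h.eps_pos _ _ (Nat.succ_le_succ (Nat.zero_le _)),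
      h.eps_pos _ _ (Nat.succ_le_succ (Nat.zero_le _)), sub_self])
  refine ⟨coef π y, ?_⟩
  rw [bc_coef, ← hy, map_sub, ← bc_coef π σ, hx, map_zero, sub_zero]

end Base

/-! ### Finite cogeneration and polynomial growth by induction on the sequence -/

section FiniteGeneration

lemma le_mul_pow_of_recurrence {a b : ℕ → ℕ} {A c : ℕ} (hb : ∀ j, b j ≤ A * (j + 1) ^ c)
    (h : ∀ j, a (j + 2) ≤ a j + b (j + 2)) : ∃ B, ∀ j, a j ≤ B * (j + 1) ^ (c + 1) := by
  refine ⟨a 0 + a 1 + A, fun j => ?_⟩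
  induction j using Nat.strong_induction_on with
  | _ j ih =>
    match j, ih with
    | 0, _ => rw [zero_add, one_pow, mul_one]; omega
    | 1, _ =>
      exact (show a 1 ≤ a 0 + a 1 + A by omega).trans
        (Nat.le_mul_of_pos_right _ (by positivity))
    | j + 2, ih =>
      set B := a 0 + a 1 + A with hB
      calc a (j + 2) ≤ a j + b (j + 2) := h j
        _ ≤ B * (j + 1) ^ (c + 1) + B * (j + 2 + 1) ^ c :=
          Nat.add_le_add (ih j (by omega))
            ((hb _).trans (Nat.mul_le_mul_right _ (by omega)))
        _ ≤ B * ((j + 1) * (j + 2 + 1) ^ c) + B * (j + 2 + 1) ^ c := by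
          rw [pow_succ']
          gcongr
          omega
        _ ≤ B * (j + 2 + 1) ^ (c + 1) := by
          rw [← mul_add, pow_succ', ← Nat.succ_mul]
          gcongr
          omega

variable {κ : Type*} [Field κ] {ι : Type*} {deg : ι → ℕ} {d : Module.End κ (ι →₀ κ)}
  {t v : Module.End κ (ι →₀ κ)}

lemma compat_prFst (d t : Module.End κ (ι →₀ κ)) : Compat (blk d 0 (-t) (-d)) d prFst where
  ker w hw := by
    obtain ⟨x, y, rfl⟩ := exists_pr w
    rw [blk_pr, ← pr_zero] at hw
    simpa [prFst_pr] using (pr_injective hw).1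
  range w := by
    obtain ⟨x, y, rfl⟩ := exists_pr w
    exact ⟨x, by simp [blk_pr, prFst_pr]⟩

lemma finrank_le_add_of_lowers {E E' : Type*} [AddCommGroup E] [Module κ E] [AddCommGroup E']
    [Module κ E'] {p : ℕ → Module.End κ E} {q : ℕ → Module.End κ E'} (hp : IsGrading p)
    [∀ j, Module.Finite κ (piece p j)] [∀ j, Module.Finite κ (piece q j)]
    {z : Module.End κ E} (hz : Lowers p 2 z) (g : E' →ₗ[κ] E) (j : ℕ)
    (hg : ∀ x, z (p (j + 2) x) = 0 → ∃ y, g (q (j + 2) y) = p (j + 2) x) :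
    Module.finrank κ (piece p (j + 2)) ≤
      Module.finrank κ (piece p j) + Module.finrank κ (piece q (j + 2)) := by
  let Z : piece p (j + 2) →ₗ[κ] piece p j := z.restrict fun x hx => hz.map_piece hx
  rw [← LinearMap.finrank_range_add_finrank_ker Z]
  refine Nat.add_le_add (Submodule.finrank_le _) ?_
  have hle : (LinearMap.ker Z).map (piece p (j + 2)).subtype ≤ (piece q (j + 2)).map g := by
    rintro _ ⟨⟨x, hx⟩, hxZ, rfl⟩
    have hx' := hp.mem_piece.1 hx
    obtain ⟨y, hy⟩ := hg x (by rw [hx']; exact congrArg Subtype.val hxZ)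
    exact ⟨_, ⟨y, rfl⟩, hy.trans hx'⟩
  rw [← Submodule.finrank_map_subtype_eq (piece p (j + 2)) (LinearMap.ker Z)]
  exact (Submodule.finrank_mono hle).trans (Submodule.finrank_map_le _ _)

lemma finite_degSum {ι : Type*} {deg : ι → ℕ} (hdeg : ∀ j, Finite {i // deg i = j}) (j : ℕ) :
    Finite {i // degSum deg i = j} := by
  have h : ∀ j, {i | deg i = j}.Finite := hdeg
  refine (((h j).image Sum.inl).union ((h (j - 1)).image Sum.inr)).subset ?_
  rintro (i | i) hi
  · exact Or.inl ⟨i, hi, rfl⟩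
  · have hi' : deg i + 1 = j := hi
    exact Or.inr ⟨i, show deg i = j - 1 by omega, rfl⟩

lemma bc_neg {ι S S' : Type*} [CommRing S] [CommRing S'] (g : S →+* S')
    (φ : Module.End S (ι →₀ S)) : bc g (-φ) = -bc g φ :=
  end_ext fun i => by rw [bc_single, LinearMap.neg_apply, LinearMap.neg_apply, bc_single, map_neg]

section Comparison

variable {E E' : Type*} [AddCommGroup E] [Module κ E] [AddCommGroup E'] [Module κ E']
  {p : ℕ → Module.End κ E} {q : ℕ → Module.End κ E'} {d : Module.End κ E} {d' : Module.End κ E'}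
  {g : E' →ₗ[κ] E}

/-- The image of `H(E')` in `H(E)` is the quotient of `H(E')` by a stable graded subspace, so
`mem_of_forall_apply_mem` carries joint injectivity from `H(E')` to this image. -/
lemma exists_range_of_comparison (hp : IsGrading p) (hq : IsGrading q) (hd : Lowers p 1 d)
    (hd' : Lowers q 1 d') [∀ j, Module.Finite κ (piece q j)] (hg : Compat d' d g)
    (hgq : ∀ j x, g (q j x) = p j (g x)) {c : ℕ} {z : ℕ → Module.End κ E}
    {z' : ℕ → Module.End κ E'} (hz : ∀ a < c, Compat d d (z a)) (hz' : ∀ a < c, Compat d' d' (z' a))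
    (hlow : ∀ a < c, Lowers q 2 (z' a)) (hgz : ∀ a < c, ∀ x, g (z' a x) = z a (g x))
    (hcomm : ∀ a < c, ∀ b < c, ∀ x, d' x = 0 → ∃ y, d' y = z' a (z' b x) - z' b (z' a x))
    (hinj : ∃ N₀, ∀ j, N₀ ≤ j → ∀ x, d' (q (j + 2) x) = 0 →
      (∀ a < c, ∃ y, d' y = z' a (q (j + 2) x)) → ∃ y, d' y = q (j + 2) x) :
    ∃ N₁, ∀ j, N₁ ≤ j → ∀ x, d' (q (j + 2) x) = 0 →
      (∀ a < c, ∃ y, d y = z a (g (q (j + 2) x))) → ∃ y, d y = g (q (j + 2) x) := by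
  have hfin := finite_piece_hgr hq hd'
  obtain ⟨N₀, hN₀⟩ := hinj
  obtain ⟨N₁, hN₁⟩ := mem_of_forall_apply_mem (m := Fin c) (z := fun a => hmap (hz' a a.2))
    (isGrading_hgr hq hd') (fun a => hmap_lowers hq hd' (hlow a a.2) _)
    (fun a b => LinearMap.ext fun w => by
      obtain ⟨x, hx, rfl⟩ := exists_cls w
      exact (cls_eq_iff _ _).2 (hcomm a a.2 b b.2 x hx))
    ⟨N₀, fun j hj w hw => by
      obtain ⟨x, hx, rfl⟩ := exists_cls w
      exact cls_eq_zero_iff.2 (hN₀ j hj x ((hd'.compat hq (j + 2)).ker x hx) fun a ha =>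
        cls_eq_zero_iff.1 (hw ⟨a, ha⟩))⟩
    (LinearMap.ker (hmap hg))
    (fun j w hw => by
      obtain ⟨x, hx, rfl⟩ := exists_cls w
      obtain ⟨y, hy⟩ : ∃ y, d y = g x := cls_eq_zero_iff.1 hw
      obtain ⟨y', hy'⟩ := (hd.compat hp j).range y
      exact cls_eq_zero_iff.2 ⟨y', hy'.trans (by rw [hy]; exact (hgq j x).symm)⟩)
    (fun a w hw => by
      obtain ⟨x, hx, rfl⟩ := exists_cls w
      obtain ⟨y, hy⟩ : ∃ y, d y = g x := cls_eq_zero_iff.1 hw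
      obtain ⟨y', hy'⟩ := (hz a a.2).range y
      exact cls_eq_zero_iff.2 ⟨y', hy'.trans (by rw [hy]; exact (hgz a a.2 x).symm)⟩)
  refine ⟨N₁, fun j hj x hx hy => ?_⟩
  have hcls : hgr hq hd' (j + 2) (cls (q (j + 2) x) hx) = cls (q (j + 2) x) hx :=
    cls_congr _ (hq.apply_same _ x)
  have := hN₁ (j + 2) (by omega) (cls (q (j + 2) x) hx) fun a => by
    rw [hcls]
    obtain ⟨y, hy⟩ := hy a a.2
    exact cls_eq_zero_iff.2 ⟨y, hy.trans (hgz a a.2 _).symm⟩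
  rw [hcls] at this
  exact cls_eq_zero_iff.1 this

lemma finrank_hgr_le_of_comparison (hp : IsGrading p) (hq : IsGrading q) (hd : Lowers p 1 d)
    (hd' : Lowers q 1 d') [∀ j, Module.Finite κ (piece p j)] [∀ j, Module.Finite κ (piece q j)]
    (hg : Compat d' d g) {τ : Module.End κ E} (hτ : Compat d d τ) (hlow : Lowers p 2 τ) (j : ℕ)
    (hlift : ∀ x, d (p (j + 2) x) = 0 → (∃ y, d y = τ (p (j + 2) x)) →
      ∃ w, d' (q (j + 2) w) = 0 ∧ g (q (j + 2) w) = p (j + 2) x) :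
    Module.finrank κ (piece (hgr hp hd) (j + 2)) ≤
      Module.finrank κ (piece (hgr hp hd) j) + Module.finrank κ (piece (hgr hq hd') (j + 2)) := by
  have hfin := finite_piece_hgr hp hd
  have hfin' := finite_piece_hgr hq hd'
  refine finrank_le_add_of_lowers (isGrading_hgr hp hd) (hmap_lowers hp hd hlow hτ) (hmap hg) j
    fun w hw => ?_
  obtain ⟨x, hx, rfl⟩ := exists_cls w
  obtain ⟨w, hw1, hw2⟩ := hlift x ((hd.compat hp _).ker x hx) (cls_eq_zero_iff.1 hw)
  exact ⟨cls _ hw1, cls_congr _ ((congrArg g (hq.apply_same _ w)).trans hw2)⟩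

end Comparison

/-- The homology with coefficients in a field of a lifted complex is finitely cogenerated over the
operators `t a`, and its dimension grows polynomially. -/
theorem LiftedComplex.exists_bound {S : Type u} [CommRing S] {π : S →+* κ} {f : ℕ → S} {N : Type u}
    [AddCommGroup N] [Module S N] {n : ℕ} (hπ : Function.Surjective π) (hN : PdLT S N (n + 1))
    {c : ℕ} (hreg : RegSeq f c) (hf : ∀ a < c, π (f a) = 0) {ι : Type u} {deg : ι → ℕ}
    (hdeg : ∀ j, Finite {i // deg i = j}) {d : Module.End S (ι →₀ S)}
    {t : ℕ → Module.End S (ι →₀ S)} {ε : (ι →₀ S) →ₗ[S] N} (h : LiftedComplex f c deg d t ε) :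
    (∃ N₀, ∀ j, N₀ ≤ j → ∀ x, bc π d (gp deg (j + 2) x) = 0 →
      (∀ a < c, ∃ y, bc π d y = bc π (t a) (gp deg (j + 2) x)) →
        ∃ y, bc π d y = gp deg (j + 2) x) ∧
    ∃ A, ∀ j, Module.finrank κ (piece (hgr (isGrading_gp deg) (h.d_low.bc π)) j) ≤
      A * (j + 1) ^ c := by
  induction c generalizing ι deg d t ε with
  | zero =>
    -- Without relations this is a resolution over `S`, whose homology with field coefficients
    -- vanishes in high degrees.
    have key : ∀ j, n ≤ j → ∀ x, bc π d (gp deg (j + 2) x) = 0 →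
        ∃ y, bc π d y = gp deg (j + 2) x :=
      fun j hj x hx => h.homology_eq_zero hπ (hN.mono (by omega)) x hx
    refine ⟨⟨n, fun j hj x hx _ => key j hj x hx⟩,
      ∑ j ∈ Finset.range (n + 2),
        Module.finrank κ (piece (hgr (isGrading_gp deg) (h.d_low.bc π)) j), fun j => ?_⟩
    rw [pow_zero, mul_one]
    by_cases hj : j < n + 2
    · exact Finset.single_le_sum
        (f := fun j => Module.finrank κ (piece (hgr (isGrading_gp deg) (h.d_low.bc π)) j))
        (fun _ _ => Nat.zero_le _) (Finset.mem_range.2 hj)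
    · obtain ⟨j, rfl⟩ : ∃ i, j = i + 2 := ⟨j - 2, by omega⟩
      have hbot : piece (hgr (isGrading_gp deg) (h.d_low.bc π)) (j + 2) = ⊥ := by
        rw [eq_bot_iff]
        rintro _ ⟨w, rfl⟩
        obtain ⟨x, hx, rfl⟩ := exists_cls w
        exact cls_eq_zero_iff.2 (key j (by omega) x
          (((h.d_low.bc π).compat (isGrading_gp deg) (j + 2)).ker x hx))
      rw [hbot, finrank_bot]
      exact Nat.zero_le _
  | succ c ih =>
    obtain ⟨v, hG⟩ := h.cone hreg
    have hreg' := hreg.mono (Nat.le_succ c)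
    have hf' : ∀ a < c, π (f a) = 0 := fun a ha => hf a (ha.trans (Nat.lt_succ_self c))
    have hdegG : ∀ j, Finite {i // degSum deg i = j} := finite_degSum hdeg
    obtain ⟨⟨N₀, hN₀⟩, A, hA⟩ := ih hreg' hf' hdegG hG
    have hfin := finite_piece_gp (S := κ) hdeg
    have hfinG := finite_piece_gp (S := κ) hdegG
    have hc := Nat.lt_succ_self c
    -- Over the field `f c` becomes zero, so the cone projects onto the complex by a chain map.
    have hbcG : bc π (blk d (f c • 1) (-t c) (-d)) =
        blk (bc π d) 0 (-bc π (t c)) (-bc π d) := by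
      rw [bc_blk, bc_smul, hf c hc, zero_smul, bc_neg, bc_neg]
    have hbct : ∀ a w, prFst (bc π (blk (t a) 0 (v a) (t a)) w) = bc π (t a) (prFst w) :=
      fun a w => by
        obtain ⟨x, y, rfl⟩ := exists_pr w
        rw [bc_blk, blk_pr, map_zero, LinearMap.zero_apply, add_zero, prFst_pr, prFst_pr]
    have hfst : Compat (bc π (blk d (f c • 1) (-t c) (-d))) (bc π d) prFst := by
      rw [hbcG]; exact compat_prFst _ _
    have htG : ∀ a < c, Compat (bc π (blk d (f c • 1) (-t c) (-d)))
        (bc π (blk d (f c • 1) (-t c) (-d))) (bc π (blk (t a) 0 (v a) (t a))) := fun a ha =>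
      Compat.of_comm (hreg'.bc_differential_comm hG.dd hf' ha)
    have ht : ∀ a < c + 1, Compat (bc π d) (bc π d) (bc π (t a)) := fun a ha =>
      Compat.of_comm (hreg.bc_differential_comm h.dd hf ha)
    -- Exactness of `H(cone) → H(T)` followed by `t_c`: a class killed by `t_c` comes from the cone.
    -- Classes killed by every operator thus lie in the image of `H(cone)`, and `h_{j+2} ≤ h_j +
    -- g_{j+2}` for the dimensions `h` of `H(T)` and `g` of `H(cone)`.
    have hlift : ∀ j x, bc π d (gp deg (j + 2) x) = 0 →
        (∃ y, bc π d y = bc π (t c) (gp deg (j + 2) x)) →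
        ∃ w, bc π (blk d (f c • 1) (-t c) (-d)) (gp (degSum deg) (j + 2) w) = 0 ∧
          prFst (gp (degSum deg) (j + 2) w) = gp deg (j + 2) x := fun j x hx hy => by
      obtain ⟨y, hy⟩ := hy
      refine ⟨pr (gp deg (j + 2) x) (-y),
        ((hG.d_low.bc π).compat (isGrading_gp _) (j + 2)).ker _ ?_, ?_⟩
      · rw [hbcG, blk_pr, hx, ← pr_zero]
        congr 1
        · simp
        · simp [hy]
      · rw [prFst_gp, prFst_pr, (isGrading_gp deg).apply_same]
    constructor
    · obtain ⟨N₁, hN₁⟩ := exists_range_of_comparison (isGrading_gp deg)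
        (isGrading_gp (degSum deg)) (h.d_low.bc π) (hG.d_low.bc π) hfst (prFst_gp deg)
        (fun a ha => ht a (ha.trans hc)) htG (fun a ha => (hG.t_low a ha).bc π)
        (fun a _ => hbct a)
        (fun a ha b hb x hx => by
          obtain ⟨s, hs⟩ := hreg'.bc_commutator hG.dd hf' (fun x =>
            hreg'.differential_commutator hG.dd hb x)
          refine ⟨s a x, ?_⟩
          have := LinearMap.congr_fun (hs a ha) x
          simp only [Module.End.mul_apply, LinearMap.add_apply, hx, map_zero, add_zero] at this
          exact (sub_eq_of_eq_add' this).symm) ⟨N₀, hN₀⟩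
      refine ⟨N₁, fun j hj x hx hy => ?_⟩
      obtain ⟨w, hw1, hw2⟩ := hlift j x hx (hy c hc)
      have := hN₁ j hj w hw1 fun a ha => by
        rw [hw2]
        exact hy a (ha.trans hc)
      rwa [hw2] at this
    · exact le_mul_pow_of_recurrence hA fun j =>
        finrank_hgr_le_of_comparison (isGrading_gp deg) (isGrading_gp (degSum deg))
          (h.d_low.bc π) (hG.d_low.bc π) hfst (ht c hc) ((h.t_low c hc).bc π) j (hlift j)

end FiniteGeneration

/-! ### Lengths of Ext into the residue field -/

section ExtLength

open CategoryTheory.Abelian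

lemma length_le_add_of_exact {R X Y Z : Type*} [CommRing R] [AddCommGroup X] [Module R X]
    [AddCommGroup Y] [Module R Y] [AddCommGroup Z] [Module R Z] {f : X →ₗ[R] Y} {g : Y →ₗ[R] Z}
    (h : ∀ y, g y = 0 → ∃ x, f x = y) :
    Module.length R Y ≤ Module.length R X + Module.length R Z := by
  rw [Module.length_eq_add_of_exact (LinearMap.ker g).subtype g.rangeRestrict
    (Submodule.subtype_injective _) g.surjective_rangeRestrict (by
      rw [LinearMap.exact_iff, LinearMap.ker_rangeRestrict, Submodule.range_subtype])]
  refine add_le_add ?_ (Module.length_le_of_injective (LinearMap.range g).subtype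
    (Submodule.subtype_injective _))
  exact (Module.length_le_of_injective (Submodule.inclusion (p' := LinearMap.range f)
    fun y hy => h y hy) (Submodule.inclusion_injective _)).trans
      (Module.length_le_of_surjective f.rangeRestrict f.surjective_rangeRestrict)

variable (R : Type u) [CommRing R] [IsLocalRing R]

/-- The length of `Ext^n(N, k)`, where `k` is the residue field. -/
noncomputable def extLen (N : Type u) [AddCommGroup N] [Module R N] (n : ℕ) : ℕ∞ :=
  Module.length R (Ext (ModuleCat.of R N) (ModuleCat.of R (IsLocalRing.ResidueField R)) n)

variable {R} {A B C : Type u} [AddCommGroup A] [Module R A] [AddCommGroup B]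
  [Module R B] [AddCommGroup C] [Module R C]

/-- The map induced on `Ext^n(-, k)`. -/
noncomputable def extMap (f : A →ₗ[R] B) (n : ℕ) :
    Ext (ModuleCat.of R B) (ModuleCat.of R (IsLocalRing.ResidueField R)) n →ₗ[R]
      Ext (ModuleCat.of R A) (ModuleCat.of R (IsLocalRing.ResidueField R)) n :=
  Ext.precompOfLinear (Ext.mk₀ (ModuleCat.ofHom f)) R _ (zero_add n)

lemma extMap_apply (f : A →ₗ[R] B) (n : ℕ)
    (x : Ext (ModuleCat.of R B) (ModuleCat.of R (IsLocalRing.ResidueField R)) n) :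
    extMap f n x = (Ext.mk₀ (ModuleCat.ofHom f)).comp x (zero_add n) := rfl

lemma extMap_comp (f : A →ₗ[R] B) (g : B →ₗ[R] C) (n : ℕ)
    (x : Ext (ModuleCat.of R C) (ModuleCat.of R (IsLocalRing.ResidueField R)) n) :
    extMap f n (extMap g n x) = extMap (g ∘ₗ f) n x := by
  rw [extMap_apply, extMap_apply, extMap_apply, Ext.mk₀_comp_mk₀_assoc, ModuleCat.ofHom_comp]

lemma extMap_id (n : ℕ)
    (x : Ext (ModuleCat.of R A) (ModuleCat.of R (IsLocalRing.ResidueField R)) n) :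
    extMap LinearMap.id n x = x := by
  rw [extMap_apply, ModuleCat.ofHom_id, Ext.mk₀_id_comp]

lemma extMap_injective {f : A →ₗ[R] B} {g : B →ₗ[R] A} (h : f ∘ₗ g = LinearMap.id) (n : ℕ) :
    Function.Injective (extMap f n) := fun x y hxy => by
  have := congrArg (extMap g n) hxy
  rwa [extMap_comp, extMap_comp, h, extMap_id, extMap_id] at this

lemma extMap_surjective {f : A →ₗ[R] B} {g : B →ₗ[R] A} (h : g ∘ₗ f = LinearMap.id) (n : ℕ) :
    Function.Surjective (extMap f n) := fun x => ⟨extMap g n x, by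
  rw [extMap_comp, h, extMap_id]⟩

lemma extLen_congr (e : A ≃ₗ[R] B) (n : ℕ) : extLen R A n = extLen R B n :=
  le_antisymm (Module.length_le_of_injective (extMap e.symm.toLinearMap n)
      (extMap_injective (g := e.toLinearMap) (by ext x; simp) n))
    (Module.length_le_of_injective (extMap e.toLinearMap n)
      (extMap_injective (g := e.symm.toLinearMap) (by ext x; simp) n))

/-- The exactness properties of the long exact sequence of `Ext(-, k)`. -/
lemma exists_extDelta {f : A →ₗ[R] B} {g : B →ₗ[R] C} (hf : Function.Injective f)
    (hfg : Function.Exact f g) (hg : Function.Surjective g) (n : ℕ) :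
    (∀ x, extMap f n x = 0 → ∃ y, extMap g n y = x) ∧
    ∃ δ : Ext (ModuleCat.of R A) (ModuleCat.of R (IsLocalRing.ResidueField R)) n →ₗ[R]
      Ext (ModuleCat.of R C) (ModuleCat.of R (IsLocalRing.ResidueField R)) (n + 1),
      (∀ x, δ x = 0 → ∃ y, extMap f n y = x) ∧
      (∀ x, extMap g (n + 1) x = 0 → ∃ y, δ y = x) := by
  have hs := ModuleCat.shortComplex_shortExact
      (ModuleCat.shortComplexOfCompEqZero f g hfg.linearMap_comp_eq_zero) hfg hf hg
  refine ⟨fun x hx => Ext.contravariant_sequence_exact₂ hs _ x hx,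
    Ext.precompOfLinear hs.extClass R _ (add_comm 1 n), fun x hx => ?_, fun x hx => ?_⟩
  · exact Ext.contravariant_sequence_exact₁ hs _ x (add_comm 1 n) hx
  · exact Ext.contravariant_sequence_exact₃ hs _ x hx (add_comm 1 n)

lemma HasShortExact.extLen_middle_le (h : HasShortExact (R := R) A B C) (n : ℕ) :
    extLen R B n ≤ extLen R C n + extLen R A n := by
  obtain ⟨f, g, hf, hfg, hg⟩ := h
  exact length_le_add_of_exact (exists_extDelta hf hfg hg n).1

lemma HasShortExact.extLen_left_le (h : HasShortExact (R := R) A B C) (n : ℕ) :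
    extLen R A n ≤ extLen R B n + extLen R C (n + 1) := by
  obtain ⟨f, g, hf, hfg, hg⟩ := h
  obtain ⟨δ, hδ, -⟩ := (exists_extDelta hf hfg hg n).2
  exact length_le_add_of_exact hδ

lemma HasShortExact.extLen_right_le (h : HasShortExact (R := R) A B C) (n : ℕ) :
    extLen R C (n + 1) ≤ extLen R A n + extLen R B (n + 1) := by
  obtain ⟨f, g, hf, hfg, hg⟩ := h
  obtain ⟨δ, -, hδ⟩ := (exists_extDelta hf hfg hg n).2
  exact length_le_add_of_exact hδ

lemma extMap_zero_injective {g : B →ₗ[R] C} (hg : Function.Surjective g) :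
    Function.Injective (extMap g 0) := by
  have : Epi (ModuleCat.ofHom g) := (ModuleCat.epi_iff_surjective _).2 hg
  exact Ext.precomp_mk₀_injective_of_epi _ (ModuleCat.ofHom g)

lemma extLen_zero_le {g : B →ₗ[R] C} (hg : Function.Surjective g) :
    extLen R C 0 ≤ extLen R B 0 :=
  Module.length_le_of_injective (extMap g 0) (extMap_zero_injective hg)

lemma extLen_succ_eq_zero_of_hasProjectiveDimensionLT {n i : ℕ} (h : PdLT R A n) (hi : n ≤ i) :
    extLen R A i = 0 := by
  have := HasProjectiveDimensionLT.subsingleton (ModuleCat.of R A) n i hi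
    (ModuleCat.of R (IsLocalRing.ResidueField R))
  exact Module.length_eq_zero

lemma extLen_succ_eq_zero_of_projective [Module.Projective R A] (n : ℕ) :
    extLen R A (n + 1) = 0 :=
  extLen_succ_eq_zero_of_hasProjectiveDimensionLT (pdLT_one_iff.2 ‹_›) (by omega)

lemma HasShortExact.extLen_add_two (h : HasShortExact (R := R) A B C) [Module.Projective R B]
    (n : ℕ) : extLen R C (n + 2) = extLen R A (n + 1) := by
  refine le_antisymm ?_ ?_
  · simpa [extLen_succ_eq_zero_of_projective] using h.extLen_right_le (n + 1)
  · simpa [extLen_succ_eq_zero_of_projective] using h.extLen_left_le (n + 1)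

lemma HasShortExact.extLen_one_le (h : HasShortExact (R := R) A B C) [Module.Projective R B] :
    extLen R C 1 ≤ extLen R A 0 := by
  simpa [extLen_succ_eq_zero_of_projective] using h.extLen_right_le 0

lemma extLen_prod (n : ℕ) : extLen R (A × B) n = extLen R A n + extLen R B n := by
  rw [add_comm, extLen, Module.length_eq_add_of_exact (extMap (LinearMap.snd R A B) n)
    (extMap (LinearMap.inl R A B) n)
    (extMap_injective (LinearMap.snd_comp_inr R A B) n)
    (extMap_surjective (LinearMap.fst_comp_inl R A B) n)]
  · rfl
  · intro x
    constructor
    · exact (exists_extDelta LinearMap.inl_injective .inl_snd LinearMap.snd_surjective n).1 x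
    · rintro ⟨y, rfl⟩
      rw [extMap_comp, LinearMap.snd_comp_inl, extMap_apply, ModuleCat.ofHom_zero, Ext.mk₀_zero,
        Ext.zero_comp]

lemma extLen_of_subsingleton [Subsingleton A] (n : ℕ) : extLen R A n = 0 := by
  have : Subsingleton (Ext (ModuleCat.of R A) (ModuleCat.of R (IsLocalRing.ResidueField R)) n) := by
    refine subsingleton_of_forall_eq 0 fun x => ?_
    rw [← extMap_id n x, extMap_apply, Subsingleton.elim (LinearMap.id : A →ₗ[R] A) 0,
      ModuleCat.ofHom_zero, Ext.mk₀_zero, Ext.zero_comp]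
  exact Module.length_eq_zero

/-- `Ext^0(A, k)` as a module of linear maps. -/
noncomputable def extZeroEquiv (A : Type u) [AddCommGroup A] [Module R A] :
    Ext (ModuleCat.of R A) (ModuleCat.of R (IsLocalRing.ResidueField R)) 0 ≃ₗ[R]
      (A →ₗ[R] IsLocalRing.ResidueField R) :=
  Ext.linearEquiv₀.trans ModuleCat.homLinearEquiv

lemma extMap_zero_eq (f : A →ₗ[R] B)
    (x : Ext (ModuleCat.of R B) (ModuleCat.of R (IsLocalRing.ResidueField R)) 0) :
    extMap f 0 x = (extZeroEquiv A).symm (extZeroEquiv B x ∘ₗ f) := by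
  obtain ⟨x, rfl⟩ := (extZeroEquiv B).symm.surjective x
  rw [LinearEquiv.apply_symm_apply]
  change (Ext.mk₀ _).comp (Ext.mk₀ _) (zero_add 0) = Ext.mk₀ _
  rw [Ext.mk₀_comp_mk₀]
  rfl

lemma length_residueField : Module.length R (IsLocalRing.ResidueField R) = 1 := by
  rw [Module.length_eq_one_iff]
  exact isSimpleModule_iff_quot_maximal.2 ⟨IsLocalRing.maximalIdeal R, inferInstance,
    ⟨LinearEquiv.refl _ _⟩⟩

lemma extLen_finsupp (α : Type u) : extLen R (α →₀ R) 0 = ENat.card α := by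
  rw [extLen, ((extZeroEquiv (α →₀ R)).trans
    (Finsupp.llift (IsLocalRing.ResidueField R) R R α).symm).length_eq, Module.length_pi,
    length_residueField, mul_one]

/-- Exactness on the right holds because `Ext^1(C, k)` vanishes. -/
lemma HasShortExact.extLen_zero_split (h : HasShortExact (R := R) A B C) [Module.Projective R C] :
    extLen R B 0 = extLen R A 0 + extLen R C 0 := by
  obtain ⟨f, g, hf, hfg, hg⟩ := h
  obtain ⟨h1, δ, h2, -⟩ := exists_extDelta hf hfg hg 0
  have hsub : Module.length R (Ext (ModuleCat.of R C)
    (ModuleCat.of R (IsLocalRing.ResidueField R)) (0 + 1)) = 0 := extLen_succ_eq_zero_of_projective 0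
  rw [Module.length_eq_zero_iff] at hsub
  rw [add_comm, extLen, Module.length_eq_add_of_exact (extMap g 0) (extMap f 0)
    (extMap_zero_injective hg) (fun x => h2 x (Subsingleton.elim _ _))]
  · rfl
  · refine fun x => ⟨h1 x, ?_⟩
    rintro ⟨y, rfl⟩
    rw [extMap_comp, hfg.linearMap_comp_eq_zero, extMap_apply, ModuleCat.ofHom_zero, Ext.mk₀_zero,
        Ext.zero_comp]

lemma extLen_fin (a n : ℕ) : extLen R (Fin a → A) n = a * extLen R A n := by
  induction a with
  | zero =>
    rw [extLen_of_subsingleton, Nat.cast_zero, zero_mul]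
  | succ a ih =>
    rw [extLen_congr (Fin.consLinearEquiv R fun _ => A).symm, extLen_prod, ih]
    push_cast
    ring

end ExtLength

/-! ### Minimal covers and Betti numbers -/

section MinimalCover

variable {R : Type u} [CommRing R]

lemma minimalCover_surjective (M : ModuleCat.{u} R) : Function.Surjective (minimalCover M) := by
  rw [← LinearMap.range_eq_top, minimalCover, Finsupp.range_linearCombination, Subtype.range_coe,
    Submodule.span_generators]

lemma minimalCover_single (M : ModuleCat.{u} R) (g : (⊤ : Submodule R M).generators) (r : R) :
    minimalCover M (Finsupp.single g r) = r • (g : M) := by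
  simp [minimalCover]

lemma hasShortExact_minimalCover (M : ModuleCat.{u} R) :
    HasShortExact (R := R) (syzygy 1 M) ((⊤ : Submodule R M).generators →₀ R) M :=
  ⟨(LinearMap.ker (minimalCover M)).subtype, minimalCover M, Submodule.subtype_injective _,
    LinearMap.exact_subtype_ker_map _, minimalCover_surjective M⟩

lemma syzygy_syzygy (M : ModuleCat.{u} R) (m n : ℕ) : syzygy m (syzygy n M) = syzygy (n + m) M := by
  induction m with
  | zero => rfl
  | succ m ih => rw [← add_assoc, syzygy, syzygy, ih]

lemma betti_syzygy (M : ModuleCat.{u} R) (m n : ℕ) : betti (syzygy n M) m = betti M (n + m) := by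
  rw [betti, syzygy_syzygy, betti]

instance finite_syzygy [IsNoetherianRing R] (M : ModuleCat.{u} R) [Module.Finite R M] (n : ℕ) :
    Module.Finite R (syzygy n M) := by
  induction n with
  | zero => assumption
  | succ n ih =>
    have : Finite (⊤ : Submodule R (syzygy n M)).generators :=
      (Submodule.FG.finite_generators Module.Finite.fg_top).to_subtype
    have : Module.Finite R ((⊤ : Submodule R (syzygy n M)).generators →₀ R) := inferInstance
    exact inferInstanceAs (Module.Finite R (LinearMap.ker (minimalCover (syzygy n M))))

/-- A unit coefficient in a relation would express one generator through the others, contradicting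
least cardinality. -/
lemma mem_maximalIdeal_of_minimalCover_eq_zero [IsLocalRing R] (M : ModuleCat.{u} R)
    [Module.Finite R M] {x : (⊤ : Submodule R M).generators →₀ R} (hx : minimalCover M x = 0)
    (i : (⊤ : Submodule R M).generators) : x i ∈ IsLocalRing.maximalIdeal R := by
  classical
  by_contra hi
  rw [IsLocalRing.mem_maximalIdeal, mem_nonunits_iff, not_not] at hi
  let G := (⊤ : Submodule R M).generators
  have hfg : (⊤ : Submodule R M).FG := Module.Finite.fg_top
  have hmem : (i : M) ∈ Submodule.span R (G \ {(i : M)}) := by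
    have h1 : minimalCover M (x - Finsupp.single i (x i)) ∈ Submodule.span R (G \ {(i : M)}) := by
      rw [minimalCover, Finsupp.linearCombination_apply]
      refine Submodule.sum_mem _ fun g hg => ?_
      rw [Finsupp.mem_support_iff, Finsupp.sub_apply] at hg
      have hne : g ≠ i := by
        rintro rfl
        simp at hg
      exact Submodule.smul_mem _ _ (Submodule.subset_span ⟨g.2, fun h => hne (Subtype.ext h)⟩)
    rw [map_sub, hx, zero_sub, minimalCover_single, Submodule.neg_mem_iff] at h1
    have := Submodule.smul_mem _ (↑hi.unit⁻¹ : R) h1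
    rwa [smul_smul, IsUnit.val_inv_mul, one_smul] at this
  have hspan : Submodule.span R (G \ {(i : M)}) = ⊤ := by
    refine top_le_iff.1 ((Submodule.span_generators (⊤ : Submodule R M)).ge.trans
      (Submodule.span_le.2 fun g hg => ?_))
    by_cases h : g = i
    · rw [h]; exact hmem
    · exact Submodule.subset_span ⟨hg, h⟩
  have hle := Submodule.spanFinrank_span_le_ncard_of_finite
    (R := R) (hfg.finite_generators.subset (Set.sdiff_subset (s := G) (t := {(i : M)})))
  rw [hspan, ← hfg.generators_ncard] at hle
  exact absurd hle (not_le.2 (Set.ncard_sdiff_singleton_lt_of_mem i.2 hfg.finite_generators))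

lemma map_eq_zero_of_mem_maximalIdeal [IsLocalRing R] {α : Type*}
    (ψ : (α →₀ R) →ₗ[R] IsLocalRing.ResidueField R) {x : α →₀ R}
    (hx : ∀ i, x i ∈ IsLocalRing.maximalIdeal R) : ψ x = 0 := by
  rw [← Finsupp.sum_single x, Finsupp.sum, map_sum]
  refine Finset.sum_eq_zero fun i _ => ?_
  have : Finsupp.single i (x i) = x i • Finsupp.single i (1 : R) := by simp
  rw [this, map_smul, Algebra.smul_def]
  have h0 : algebraMap R (IsLocalRing.ResidueField R) (x i) = 0 :=
    Ideal.Quotient.eq_zero_iff_mem.2 (hx i)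
  rw [h0, zero_mul]

/-- By minimality every map from the free cover to `k` vanishes on the syzygy. Hence the connecting
map `Hom(Ω M, k) → Ext^1(M, k)` is injective, and all maps from the cover to `k` factor through `M`.
-/
lemma extLen_zero_eq_card_generators [IsLocalRing R] (M : ModuleCat.{u} R) [Module.Finite R M] :
    extLen R M 0 = ENat.card (⊤ : Submodule R M).generators ∧
      extLen R M 1 = extLen R (syzygy 1 M) 0 := by
  have hzero : ∀ x, extMap (A := LinearMap.ker (minimalCover M))
      (B := (⊤ : Submodule R M).generators →₀ R) (LinearMap.ker (minimalCover M)).subtype 0 x =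
        0 := fun x => by
    rw [extMap_zero_eq, LinearEquiv.map_eq_zero_iff]
    exact LinearMap.ext fun z => map_eq_zero_of_mem_maximalIdeal _
      (mem_maximalIdeal_of_minimalCover_eq_zero M z.2)
  obtain ⟨h1, δ, h2, h3⟩ := exists_extDelta (A := LinearMap.ker (minimalCover M))
    (Submodule.subtype_injective _) (LinearMap.exact_subtype_ker_map (minimalCover M)) (minimalCover_surjective M) 0
  constructor
  · rw [← extLen_finsupp (R := R)]
    refine le_antisymm (extLen_zero_le (minimalCover_surjective M)) ?_
    exact Module.length_le_of_surjective (extMap (minimalCover M) 0) fun x => h1 x (hzero x)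
  · refine le_antisymm (hasShortExact_minimalCover M).extLen_one_le ?_
    refine Module.length_le_of_injective δ ((injective_iff_map_eq_zero _).2 fun x hx => ?_)
    obtain ⟨y, rfl⟩ := h2 x hx
    exact hzero y

theorem extLen_eq_betti [IsLocalRing R] [IsNoetherianRing R] (M : ModuleCat.{u} R)
    [Module.Finite R M] (n : ℕ) : extLen R M n = betti M n := by
  have h0 : ∀ (N : ModuleCat.{u} R) [Module.Finite R N], extLen R N 0 = betti N 0 := fun N _ => by
    have hfg : (⊤ : Submodule R N).FG := Module.Finite.fg_top
    have := hfg.finite_generators.to_subtype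
    rw [(extLen_zero_eq_card_generators N).1, betti, syzygy, ← hfg.generators_ncard,
      ENat.card_eq_coe_natCard, Nat.card_coe_set_eq]
  induction n generalizing M with
  | zero => exact h0 M
  | succ n ih =>
    rw [add_comm, ← betti_syzygy, ← ih]
    cases n with
    | zero => exact (extLen_zero_eq_card_generators M).2
    | succ n => rw [add_comm 1]; exact (hasShortExact_minimalCover M).extLen_add_two n

end MinimalCover

/-! ### Polynomial growth of sequences -/

section Growth

/-- `c n = O(n ^ (s - 1))`. -/
def GrowthLE (s : ℕ) (c : ℕ → ℕ) : Prop := ∃ A : ℕ, ∀ n, n * c n ≤ A * (n + 1) ^ s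

variable {s t : ℕ} {c e : ℕ → ℕ}

lemma GrowthLE.mono (h : GrowthLE s c) (hst : s ≤ t) : GrowthLE t c := by
  obtain ⟨A, hA⟩ := h
  exact ⟨A, fun n => (hA n).trans (Nat.mul_le_mul_left _ (Nat.pow_le_pow_right (by omega) hst))⟩

lemma GrowthLE.of_le (h : GrowthLE s c) (hle : ∀ n, e n ≤ c n) : GrowthLE s e := by
  obtain ⟨A, hA⟩ := h
  exact ⟨A, fun n => (Nat.mul_le_mul_left _ (hle n)).trans (hA n)⟩

lemma GrowthLE.add (h : GrowthLE s c) (h' : GrowthLE s e) : GrowthLE s fun n => c n + e n := by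
  obtain ⟨A, hA⟩ := h
  obtain ⟨B, hB⟩ := h'
  exact ⟨A + B, fun n => by rw [mul_add, add_mul]; exact Nat.add_le_add (hA n) (hB n)⟩

lemma GrowthLE.const_mul (h : GrowthLE s c) (a : ℕ) : GrowthLE s fun n => a * c n := by
  obtain ⟨A, hA⟩ := h
  exact ⟨a * A, fun n => by
    rw [mul_left_comm, mul_assoc]; exact Nat.mul_le_mul_left _ (hA n)⟩

lemma GrowthLE.shift (h : GrowthLE s c) (p : ℕ) : GrowthLE s fun n => c (n + p) := by
  obtain ⟨A, hA⟩ := h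
  refine ⟨A * (p + 1) ^ s, fun n => ?_⟩
  calc n * c (n + p) ≤ (n + p) * c (n + p) := Nat.mul_le_mul_right _ (by omega)
    _ ≤ A * (n + p + 1) ^ s := hA _
    _ ≤ A * ((p + 1) * (n + 1)) ^ s := by gcongr; nlinarith
    _ = A * (p + 1) ^ s * (n + 1) ^ s := by rw [mul_pow, mul_assoc]

lemma GrowthLE.of_eventually {A N : ℕ} (h : ∀ n, N ≤ n → n * c n ≤ A * (n + 1) ^ s) :
    GrowthLE s c := by
  refine ⟨A + ∑ n ∈ Finset.range N, n * c n, fun n => ?_⟩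
  rw [add_mul]
  by_cases hn : N ≤ n
  · exact (h n hn).trans (Nat.le_add_right _ _)
  · refine le_add_left (le_trans ?_ (Nat.le_mul_of_pos_right _ (by positivity)))
    exact Finset.single_le_sum (f := fun n => n * c n) (fun _ _ => Nat.zero_le _)
      (Finset.mem_range.2 (by omega))

lemma GrowthLE.succ_of_eventually_le {C N : ℕ} (h : ∀ n, N ≤ n → c n ≤ C * (n + 1) ^ s) :
    GrowthLE (s + 1) c := by
  refine GrowthLE.of_eventually (A := C) (N := N) fun n hn => ?_
  calc n * c n ≤ (n + 1) * (C * (n + 1) ^ s) := Nat.mul_le_mul (by omega) (h n hn)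
    _ = C * (n + 1) ^ (s + 1) := by ring

lemma GrowthLE.le_pow (h : GrowthLE s c) : ∃ A : ℕ, ∀ n, 1 ≤ n → c n ≤ A * (n + 1) ^ s := by
  obtain ⟨A, hA⟩ := h
  exact ⟨A, fun n hn => (Nat.le_mul_of_pos_left _ hn).trans (hA n)⟩

lemma GrowthLE.zero_iff : GrowthLE 0 c ↔ ∃ N, ∀ n, N ≤ n → c n = 0 := by
  constructor
  · rintro ⟨A, hA⟩
    refine ⟨A + 1, fun n hn => ?_⟩
    by_contra hc
    have := hA n
    have := Nat.le_mul_of_pos_right n (Nat.pos_of_ne_zero hc)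
    simp at *
    omega
  · rintro ⟨N, hN⟩
    exact GrowthLE.of_eventually (A := 0) (N := N) fun n hn => by rw [hN n hn]; simp

lemma GrowthLE.le_pow_pred (h : GrowthLE (s + 1) c) : ∃ A : ℕ, ∀ n, 1 ≤ n → c n ≤ A * n ^ s := by
  obtain ⟨A, hA⟩ := h
  refine ⟨A * 2 ^ (s + 1), fun n hn => ?_⟩
  refine Nat.le_of_mul_le_mul_left (c := n) ?_ hn
  calc n * c n ≤ A * (n + 1) ^ (s + 1) := hA n
    _ ≤ A * (2 * n) ^ (s + 1) := by gcongr; omega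
    _ = n * (A * 2 ^ (s + 1) * n ^ s) := by rw [mul_pow]; ring

/-- Multiplication by `n` in `GrowthLE` clears the exponent `-1` that occurs for `s = 0`. Finitely
many terms are absorbed in the constant. -/
lemma growthLE_iff : GrowthLE s c ↔
    ∃ A : ℝ, ∀ᶠ n : ℕ in atTop, (c n : ℝ) ≤ A * (n : ℝ) ^ ((s : ℤ) - 1) := by
  have hz : ∀ n : ℕ, 1 ≤ n → (n : ℝ) * (n : ℝ) ^ ((s : ℤ) - 1) = (n : ℝ) ^ s := fun n hn => by
    have h0 : (n : ℝ) ≠ 0 := by positivity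
    rw [← zpow_one_add₀ h0, add_sub_cancel, zpow_natCast]
  constructor
  · rintro ⟨A, hA⟩
    refine ⟨A * 2 ^ s, eventually_atTop.2 ⟨1, fun n hn => ?_⟩⟩
    have hn' : (0 : ℝ) < n := by exact_mod_cast hn
    refine le_of_mul_le_mul_left ?_ hn'
    have h1 : n * c n ≤ A * (2 * n) ^ s := (hA n).trans (by gcongr; omega)
    calc (n : ℝ) * c n ≤ A * (2 * n) ^ s := by exact_mod_cast h1
      _ = A * 2 ^ s * (n : ℝ) ^ s := by rw [mul_pow, mul_assoc]
      _ = n * (A * 2 ^ s * (n : ℝ) ^ ((s : ℤ) - 1)) := by rw [← hz n hn]; ring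
  · rintro ⟨A, hA⟩
    obtain ⟨N, hN⟩ := eventually_atTop.1 hA
    refine GrowthLE.of_eventually (A := ⌈A⌉₊) (N := N + 1) fun n hn => ?_
    have hn' : (0 : ℝ) < n := by exact_mod_cast (by omega : 0 < n)
    have h1 : (n : ℝ) * c n ≤ A * (n : ℝ) ^ s := by
      rw [← hz n (by omega)]
      calc (n : ℝ) * c n ≤ n * (A * (n : ℝ) ^ ((s : ℤ) - 1)) :=
            mul_le_mul_of_nonneg_left (hN n (by omega)) hn'.le
        _ = _ := by ring
    have h2 : (n : ℝ) * c n ≤ ⌈A⌉₊ * ((n : ℝ) + 1) ^ s :=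
      h1.trans (mul_le_mul (Nat.le_ceil A) (pow_le_pow_left₀ hn'.le (by linarith) s)
        (by positivity) (by positivity))
    exact_mod_cast h2

/-- Summation along residue classes modulo `p` costs one power. If `s = 0`, the increments
eventually vanish and `c` is bounded. -/
lemma GrowthLE.of_le_add {p : ℕ} (hp : 1 ≤ p) (he : GrowthLE s e)
    (h : ∀ j, c (j + p) ≤ c j + e (j + 1)) : GrowthLE (s + 1) c := by
  rcases s with _ | s
  · obtain ⟨N, hN⟩ := GrowthLE.zero_iff.1 he
    refine GrowthLE.succ_of_eventually_le (C := ∑ i ∈ Finset.range (N + p), c i) (N := 0)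
      fun n _ => ?_
    rw [pow_zero, mul_one]
    induction n using Nat.strong_induction_on with
    | _ n ih =>
      by_cases hn : n < N + p
      · exact Finset.single_le_sum (f := c) (fun _ _ => Nat.zero_le _) (Finset.mem_range.2 hn)
      · have := h (n - p)
        rw [hN (n - p + 1) (by omega), Nat.sub_add_cancel (by omega)] at this
        exact this.trans (ih (n - p) (by omega) (Nat.zero_le _))
  · obtain ⟨A, hA⟩ := he.le_pow_pred
    refine GrowthLE.succ_of_eventually_le (C := A + ∑ i ∈ Finset.range p, c i) (N := 0)
      fun n _ => ?_
    set C := A + ∑ i ∈ Finset.range p, c i with hC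
    induction n using Nat.strong_induction_on with
    | _ n ih =>
      by_cases hn : n < p
      · exact (le_add_left (Finset.single_le_sum (f := c) (fun _ _ => Nat.zero_le _)
          (Finset.mem_range.2 hn))).trans (Nat.le_mul_of_pos_right _ (by positivity))
      · obtain ⟨j, rfl⟩ : ∃ j, n = j + p := ⟨n - p, by omega⟩
        calc c (j + p) ≤ c j + e (j + 1) := h j
          _ ≤ C * (j + 1) ^ (s + 1) + C * (j + 1) ^ s :=
            Nat.add_le_add (ih j (by omega) (Nat.zero_le _)) ((hA _ (by omega)).trans
              (Nat.mul_le_mul_right _ (by omega)))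
          _ = C * ((j + 1) ^ s * (j + 2)) := by ring
          _ ≤ C * ((j + p + 1) ^ s * (j + p + 1)) :=
            Nat.mul_le_mul_left _ (Nat.mul_le_mul (Nat.pow_le_pow_left (by omega) s) (by omega))
          _ = C * (j + p + 1) ^ (s + 1) := by rw [pow_succ]

/-- If `c j` exceeds a suitable multiple `C (j + 1)^s` at one large `j`, the excess is multiplied by
at least `a / b > 1` at every step of length `p`. Exponential growth contradicts the polynomial
bound `hc`. -/
lemma GrowthLE.of_mul_le {p a b q : ℕ} (hba : b < a) (hb : 1 ≤ b) (he : GrowthLE s e)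
    (hc : GrowthLE q c) (h : ∀ j, a * c j ≤ e j + b * c (j + p)) : GrowthLE (s + 1) c := by
  obtain ⟨E, hE⟩ := he.le_pow
  obtain ⟨B, hB⟩ := hc.le_pow
  have hb' : (0 : ℝ) < b := by exact_mod_cast hb
  set ρ : ℝ := a / b with hρ
  have hρ1 : 1 < ρ := by
    rw [hρ, one_lt_div hb']
    exact_mod_cast hba
  -- A number strictly between `1` and `ρ`: for large `j`, replacing `j` by `j + p` multiplies `(j +
  -- 1)^s` by at most `μ`, and `ρ - μ` leaves room to absorb `e j`.
  set μ : ℝ := (1 + ρ) / 2 with hμ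
  have hμ1 : 1 < μ := by rw [hμ]; linarith
  have hδ : 0 < ρ - μ := by rw [hμ]; linarith
  have hlim : Tendsto (fun j : ℕ => (1 + (p : ℝ) / ((j : ℝ) + 1)) ^ s) atTop (nhds 1) := by
    have h0 : Tendsto (fun j : ℕ => (p : ℝ) / ((j : ℝ) + 1)) atTop (nhds 0) :=
      tendsto_const_nhds.div_atTop (tendsto_natCast_atTop_atTop.atTop_add tendsto_const_nhds)
    simpa using (h0.const_add 1).pow s
  obtain ⟨N, hN⟩ := eventually_atTop.1 (hlim.eventually (gt_mem_nhds hμ1))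
  have hstep : ∀ j, N ≤ j → ((j : ℝ) + p + 1) ^ s ≤ μ * ((j : ℝ) + 1) ^ s := fun j hj => by
    have h0 : (0 : ℝ) < (j : ℝ) + 1 := by positivity
    have h1 : (j : ℝ) + p + 1 = (1 + (p : ℝ) / ((j : ℝ) + 1)) * ((j : ℝ) + 1) := by
      field_simp
      ring
    rw [h1, mul_pow]
    exact mul_le_mul_of_nonneg_right (hN j hj).le (by positivity)
  refine GrowthLE.succ_of_eventually_le (C := ⌈E / (b * (ρ - μ))⌉₊) (N := N + 1) fun j hj => ?_
  set C := ⌈E / (b * (ρ - μ))⌉₊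
  have hC : (E : ℝ) / b ≤ C * (ρ - μ) := by
    have h1 : (E : ℝ) / (b * (ρ - μ)) ≤ C := Nat.le_ceil _
    rw [div_le_iff₀ (by positivity)] at h1
    rw [div_le_iff₀ hb']
    linarith
  have hbig : ∀ j, N + 1 ≤ j → ρ * ((c j : ℝ) - C * ((j : ℝ) + 1) ^ s) ≤
      (c (j + p) : ℝ) - C * ((j : ℝ) + p + 1) ^ s := fun j hj => by
    have h1 : (a : ℝ) * c j ≤ e j + b * c (j + p) := by exact_mod_cast h j
    have h2 : (e j : ℝ) ≤ E * ((j : ℝ) + 1) ^ s := by exact_mod_cast hE j (by omega)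
    have h3 : ρ * c j ≤ e j / b + c (j + p) := by
      rw [hρ, div_mul_eq_mul_div, div_le_iff₀ hb', add_mul, div_mul_cancel₀ _ hb'.ne']
      linarith
    have h4 : (e j : ℝ) / b ≤ C * (ρ - μ) * ((j : ℝ) + 1) ^ s := by
      refine le_trans ?_ (mul_le_mul_of_nonneg_right hC (by positivity))
      rw [div_mul_eq_mul_div]
      exact div_le_div_of_nonneg_right h2 hb'.le
    have h5 := mul_le_mul_of_nonneg_left (hstep j (by omega)) (Nat.cast_nonneg (α := ℝ) C)
    linarith
  by_contra hlt
  set D : ℝ := (c j : ℝ) - C * ((j : ℝ) + 1) ^ s with hD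
  have hD0 : 0 < D := by
    rw [hD, sub_pos]
    exact_mod_cast not_le.1 hlt
  have hiter : ∀ t : ℕ, ρ ^ t * D ≤
      (c (j + t * p) : ℝ) - C * (((j + t * p : ℕ) : ℝ) + 1) ^ s := fun t => by
    induction t with
    | zero => simp [hD]
    | succ t ih =>
      have h1 := hbig (j + t * p) (by omega)
      have h2 : j + (t + 1) * p = j + t * p + p := by ring
      rw [h2, pow_succ', mul_assoc]
      refine (mul_le_mul_of_nonneg_left ih (by linarith)).trans ?_
      push_cast at h1 ⊢
      exact h1
  set K : ℝ := B * ((j : ℝ) + p + 1) ^ q with hK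
  -- The excess `D` is bounded by a multiple of `(t + 1)^q / ρ^(t + 1)` for every `t`, and this
  -- tends to zero.
  have hle : ∀ t : ℕ, D ≤ K * ρ * ((((t + 1 : ℕ) : ℝ) ^ q) / ρ ^ (t + 1)) := fun t => by
    have h1 : (c (j + t * p) : ℝ) ≤ B * (((j + t * p : ℕ) : ℝ) + 1) ^ q := by
      exact_mod_cast hB (j + t * p) (by omega)
    have h2 : (((j + t * p : ℕ) : ℝ) + 1) ≤ ((j : ℝ) + p + 1) * ((t : ℝ) + 1) := by
      push_cast
      have h1 : (0 : ℝ) ≤ j * t := by positivity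
      have h2 : (0 : ℝ) ≤ p := by positivity
      have h3 : (0 : ℝ) ≤ t := by positivity
      nlinarith
    have h3 : ρ ^ t * D ≤ K * ((t : ℝ) + 1) ^ q := by
      calc ρ ^ t * D ≤ c (j + t * p) := (hiter t).trans (by
            have : (0 : ℝ) ≤ C * (((j + t * p : ℕ) : ℝ) + 1) ^ s := by positivity
            linarith)
        _ ≤ B * (((j : ℝ) + p + 1) * ((t : ℝ) + 1)) ^ q :=
            h1.trans (mul_le_mul_of_nonneg_left (pow_le_pow_left₀ (by positivity) h2 q)
              (by positivity))
        _ = K * ((t : ℝ) + 1) ^ q := by rw [mul_pow, hK, mul_assoc]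
    have h4 : 0 < ρ ^ t := by positivity
    rw [pow_succ, Nat.cast_add, Nat.cast_one]
    have h5 : K * ρ * (((t : ℝ) + 1) ^ q / (ρ ^ t * ρ)) = K * ((t : ℝ) + 1) ^ q / ρ ^ t := by
      field_simp
    rw [h5, le_div_iff₀ h4]
    linarith
  have h0 := ((tendsto_pow_const_div_const_pow_of_one_lt q hρ1).comp
    (tendsto_add_atTop_nat 1)).const_mul (K * ρ)
  rw [mul_zero] at h0
  exact absurd (ge_of_tendsto' h0 hle) (not_le.2 hD0)

end Growth

/-! ### Complexity along a reducing sequence: the first two assertions -/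

section Complexity

variable {R : Type u} [CommRing R]

lemma complexity_le_iff {M : ModuleCat.{u} R} {r : ℕ} :
    complexity M ≤ r ↔ GrowthLE r (betti M) := by
  constructor
  · intro h
    by_contra hr
    have : ((r + 1 : ℕ) : ℕ∞) ≤ complexity M := le_iInf₂ fun s hs => by
      by_contra hlt
      rw [Nat.cast_le, not_le] at hlt
      exact hr ((growthLE_iff.2 hs).mono (by omega))
    have := this.trans h
    rw [Nat.cast_le] at this
    omega
  · exact fun h => iInf₂_le r (growthLE_iff.1 h)

lemma complexity_lt_top_iff {M : ModuleCat.{u} R} :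
    complexity M < ⊤ ↔ ∃ r, GrowthLE r (betti M) := by
  constructor
  · intro h
    obtain ⟨r, hr⟩ := ENat.ne_top_iff_exists.1 h.ne
    exact ⟨r, complexity_le_iff.1 hr.ge⟩
  · rintro ⟨r, hr⟩
    exact (complexity_le_iff.2 hr).trans_lt (ENat.natCast_lt_top r)

lemma finitePd_iff_exists {M : ModuleCat.{u} R} : FinitePd M ↔ ∃ n, PdLT R M n := by
  constructor
  · intro h
    rw [FinitePd] at h
    induction hM : projectiveDimension M using WithBot.recBotCoe with
    | bot => exact ⟨0, (projectiveDimension_lt_iff (n := 0)).1 (by rw [hM]; exact WithBot.bot_lt_coe _)⟩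
    | coe n =>
      rw [hM] at h
      induction n using ENat.recTopCoe with
      | top => exact absurd h (lt_irrefl _)
      | coe n =>
        refine ⟨n + 1, (projectiveDimension_lt_iff (n := n + 1)).1 ?_⟩
        rw [hM]
        exact WithBot.coe_lt_coe.2 (by exact_mod_cast Nat.lt_succ_self n)
  · rintro ⟨n, hn⟩
    exact ((projectiveDimension_lt_iff (X := M) (n := n)).2 hn).trans_le le_top

/-- Each free cover raises the bound by at most one; the extra one covers the vanishing syzygy `m =
0`. -/
lemma pdLT_syzygy {M : ModuleCat.{u} R} {m n : ℕ}
    (h : PdLT R (syzygy n M) m) : PdLT R M (n + m + 1) := by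
  induction n generalizing m with
  | zero => exact h.mono (by omega)
  | succ n ih =>
    have hs := hasShortExact_minimalCover (syzygy n M)
    rw [syzygy_syzygy] at hs
    have hF : PdLT R ((⊤ : Submodule R (syzygy n M)).generators →₀ R) (m + 1) :=
      (pdLT_one_iff.2 inferInstance).mono (by omega)
    exact (ih (hs.pdLT_right h hF)).mono (by omega)

lemma HasShortExact.fin_one {A B C : Type u} [AddCommGroup A] [Module R A] [AddCommGroup B]
    [Module R B] [AddCommGroup C] [Module R C] (h : HasShortExact (R := R) A B C) :
    HasShortExact (R := R) (Fin 1 → A) B (Fin 1 → C) := by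
  obtain ⟨f, g, hf, hfg, hg⟩ := h
  refine ⟨f ∘ₗ (LinearEquiv.funUnique (Fin 1) R A).toLinearMap,
    (LinearEquiv.funUnique (Fin 1) R C).symm.toLinearMap ∘ₗ g, ?_, fun y => ?_, ?_⟩
  · exact hf.comp (LinearEquiv.funUnique (Fin 1) R A).injective
  · rw [LinearMap.comp_apply, LinearEquiv.coe_coe, LinearEquiv.map_eq_zero_iff, hfg y]
    constructor
    · rintro ⟨x, rfl⟩
      exact ⟨(LinearEquiv.funUnique (Fin 1) R A).symm x, by simp⟩
    · rintro ⟨x, rfl⟩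
      exact ⟨_, rfl⟩
  · exact (LinearEquiv.funUnique (Fin 1) R C).symm.surjective.comp hg

variable [IsLocalRing R] [IsNoetherianRing R]

/-- Complexity zero means that the Betti numbers eventually vanish, that is, some syzygy is zero. -/
lemma finitePd_iff {M : ModuleCat.{u} R} [Module.Finite R M] : FinitePd M ↔ complexity M = 0 := by
  have h0 : complexity M = 0 ↔ GrowthLE 0 (betti M) := by
    rw [← complexity_le_iff, Nat.cast_zero, nonpos_iff_eq_zero]
  rw [h0, GrowthLE.zero_iff, finitePd_iff_exists]
  constructor
  · rintro ⟨N, hN⟩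
    refine ⟨N, fun n hn => ?_⟩
    have := extLen_succ_eq_zero_of_hasProjectiveDimensionLT hN hn
    rw [extLen_eq_betti] at this
    exact_mod_cast this
  · rintro ⟨N, hN⟩
    have hb := hN N le_rfl
    have hfg : (⊤ : Submodule R (syzygy N M)).FG := Module.Finite.fg_top
    have hsub : Subsingleton (syzygy N M) := by
      rw [betti, ← hfg.generators_ncard, Set.ncard_eq_zero hfg.finite_generators] at hb
      have := Submodule.span_generators (⊤ : Submodule R (syzygy N M))
      rw [hb, Submodule.span_empty] at this
      exact (Submodule.subsingleton_iff R).1 (subsingleton_of_bot_eq_top this)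
    have : PdLT R (syzygy N M) 0 :=
      (ModuleCat.isZero_of_subsingleton (syzygy N M)).hasProjectiveDimensionLT_zero
    exact ⟨_, pdLT_syzygy this⟩

section Step

variable {K K₁ : ModuleCat.{u} R} [Module.Finite R K] [Module.Finite R K₁] {a b n : ℕ}

lemma betti_le_of_hasShortExact
    (h : HasShortExact (R := R) (Fin a → K) K₁ (Fin b → syzygy n K)) (j : ℕ) :
    betti K₁ j ≤ b * betti K (n + j) + a * betti K j := by
  have := h.extLen_middle_le j
  rw [extLen_fin, extLen_fin, extLen_eq_betti, extLen_eq_betti, extLen_eq_betti,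
    betti_syzygy] at this
  exact_mod_cast this

lemma mul_betti_le_of_hasShortExact
    (h : HasShortExact (R := R) (Fin a → K) K₁ (Fin b → syzygy n K)) (j : ℕ) :
    a * betti K j ≤ betti K₁ j + b * betti K (j + (n + 1)) := by
  have := h.extLen_left_le j
  rw [extLen_fin, extLen_fin, extLen_eq_betti, extLen_eq_betti, extLen_eq_betti,
    betti_syzygy, show n + (j + 1) = j + (n + 1) by omega] at this
  exact_mod_cast this

lemma mul_betti_le_of_hasShortExact'
    (h : HasShortExact (R := R) (Fin a → K) K₁ (Fin b → syzygy n K)) (j : ℕ) :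
    b * betti K (j + (n + 1)) ≤ a * betti K j + betti K₁ (j + 1) := by
  have := h.extLen_right_le j
  rw [extLen_fin, extLen_fin, extLen_eq_betti, extLen_eq_betti, extLen_eq_betti,
    betti_syzygy, show n + (j + 1) = j + (n + 1) by omega] at this
  exact_mod_cast this

lemma complexity_lt_top_of_hasShortExact
    (h : HasShortExact (R := R) (Fin a → K) K₁ (Fin b → syzygy n K)) (hK : complexity K < ⊤) :
    complexity K₁ < ⊤ := by
  obtain ⟨r, hr⟩ := complexity_lt_top_iff.1 hK
  refine complexity_lt_top_iff.2 ⟨r, (((hr.shift n).const_mul b).add (hr.const_mul a)).of_le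
    fun j => ?_⟩
  rw [add_comm j n]
  exact betti_le_of_hasShortExact h j

/-- Two parts of the long exact sequence serve two cases: `GrowthLE.of_mul_le` when `b < a`, and
`GrowthLE.of_le_add` when `a ≤ b`. Only the first uses that the complexity of `K` is finite. -/
lemma complexity_le_add_one_of_hasShortExact
    (h : HasShortExact (R := R) (Fin a → K) K₁ (Fin b → syzygy n K)) (hb : 1 ≤ b)
    (hK : complexity K < ⊤) : complexity K ≤ complexity K₁ + 1 := by
  obtain ⟨q, hq⟩ := complexity_lt_top_iff.1 hK
  obtain ⟨s, hs⟩ := ENat.ne_top_iff_exists.1 (complexity_lt_top_of_hasShortExact h hK).ne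
  have he := complexity_le_iff.1 hs.ge
  rw [← hs]
  refine complexity_le_iff.2 ?_
  rcases lt_or_ge b a with hab | hab
  · exact he.of_mul_le hab hb hq (mul_betti_le_of_hasShortExact h)
  · refine he.of_le_add (p := n + 1) (by omega) fun j => ?_
    refine Nat.le_of_mul_le_mul_left (c := b) ((mul_betti_le_of_hasShortExact' h j).trans ?_) hb
    rw [mul_add]
    exact Nat.add_le_add (Nat.mul_le_mul_right _ hab) (Nat.le_mul_of_pos_left _ hb)

end Step

lemma complexity_le_of_hasReducingSequence {M : ModuleCat.{u} R} {r : ℕ}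
    (h : HasReducingSequence M r) (hM : complexity M < ⊤) : complexity M ≤ r := by
  obtain ⟨-, K, rfl, hfin, hpd, hK⟩ := h
  have hlt : ∀ i ≤ r, complexity (K i) < ⊤ := fun i => by
    induction i with
    | zero => exact fun _ => hM
    | succ i ih =>
      intro hi
      obtain ⟨a, b, n, -, -, hs⟩ := hK i (by omega)
      have := hfin i (by omega)
      have := hfin (i + 1) hi
      exact complexity_lt_top_of_hasShortExact hs (ih (by omega))
  have hle : ∀ i ≤ r, complexity (K 0) ≤ complexity (K i) + i := fun i => by
    induction i with
    | zero => exact fun _ => by simp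
    | succ i ih =>
      intro hi
      obtain ⟨a, b, n, -, hb, hs⟩ := hK i (by omega)
      have := hfin i (by omega)
      have := hfin (i + 1) hi
      have h1 := complexity_le_add_one_of_hasShortExact hs hb (hlt i (by omega))
      refine (ih (by omega)).trans ((add_le_add_left h1 _).trans_eq ?_)
      push_cast
      rw [add_assoc, add_comm 1]
  have := hfin r le_rfl
  have := hle r le_rfl
  rwa [finitePd_iff.1 hpd, zero_add] at this

theorem complexity_le_reducingPd {M : ModuleCat.{u} R} [Module.Finite R M]
    (hM : complexity M < ⊤) : complexity M ≤ reducingPd M := by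
  rw [reducingPd]
  split_ifs with h
  · exact (finitePd_iff.1 h).le
  · exact le_iInf₂ fun r hr => complexity_le_of_hasReducingSequence hr hM

/-- Strict decrease gives `r ≤ cx M` for the given chain, which is a reducing sequence with `a = b =
1`; item 1 gives the other inequality. -/
theorem HasReducibleComplexity.complexity_eq {M : ModuleCat.{u} R} [Module.Finite R M]
    (h : HasReducibleComplexity M) : complexity M = reducingPd M := by
  rcases h with h | ⟨-, hlt, r, hr, K, rfl, hfin, hpd, hK⟩
  · rw [reducingPd, if_pos h, finitePd_iff.1 h]
  refine le_antisymm (complexity_le_reducingPd hlt) ?_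
  have hle : ∀ i ≤ r, complexity (K i) + i ≤ complexity (K 0) := fun i => by
    induction i with
    | zero => exact fun _ => by simp
    | succ i ih =>
      intro hi
      refine le_trans ?_ (ih (by omega))
      have h1 := Order.add_one_le_of_lt (hK i (by omega)).2
      push_cast
      rw [add_comm (i : ℕ∞), ← add_assoc]
      exact add_le_add_left h1 _
  have hr' := (le_add_self).trans (hle r le_rfl)
  rw [reducingPd]
  split_ifs
  · exact zero_le
  · refine le_trans ?_ hr'
    refine iInf₂_le r ⟨hr, K, rfl, hfin, hpd, fun i hi => ?_⟩
    obtain ⟨n, hs⟩ := (hK i hi).1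
    exact ⟨1, 1, n, le_rfl, le_rfl, hs.fin_one⟩

end Complexity

/-! ### The total minimal free resolution -/

section Resolution

variable {R : Type u} [CommRing R]

/-- A minimal free resolution of `M`, gathered in one free module on a graded basis; `s n` is the
map from the `n`-th free module onto the `n`-th syzygy. -/
structure MinimalResolution [IsLocalRing R] (M : ModuleCat.{u} R) {ι : Type u} (deg : ι → ℕ)
    (d : Module.End R (ι →₀ R)) (s : ∀ n, (ι →₀ R) →ₗ[R] syzygy n M) : Prop where
  d_low : Lowers (gp deg) 1 d
  s_gp : ∀ n x, s n (gp deg n x) = s n x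
  s_surj : ∀ n, Function.Surjective (s n)
  s_d : ∀ n x, s n (d x) = 0
  s_exact : ∀ n x, s n x = 0 → ∃ y, d y = gp deg n x
  d_eq_zero_iff : ∀ n x, d (gp deg (n + 1) x) = 0 ↔ s (n + 1) x = 0
  minimal : ∀ x i, d x i ∈ IsLocalRing.maximalIdeal R
  finite_fiber : ∀ j, Finite {i // deg i = j}
  card_fiber : ∀ j, Nat.card {i // deg i = j} = betti M j

/-- The basis of the total minimal free resolution. -/
abbrev ResIndex (M : ModuleCat.{u} R) : Type u :=
  Σ j, (⊤ : Submodule R (syzygy j M)).generators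

/-- The inclusion of the basis of the `j`-th free module. -/
abbrev resMk (M : ModuleCat.{u} R) (j : ℕ) (g : (⊤ : Submodule R (syzygy j M)).generators) :
    ResIndex M := ⟨j, g⟩

lemma resMk_injective (M : ModuleCat.{u} R) (j : ℕ) : Function.Injective (resMk M j) :=
  fun g g' h => by simpa using h

/-- The inclusion of the `j`-th free module. -/
noncomputable def resInc (M : ModuleCat.{u} R) (j : ℕ) :
    ((⊤ : Submodule R (syzygy j M)).generators →₀ R) →ₗ[R] (ResIndex M →₀ R) :=
  Finsupp.lmapDomain R R (resMk M j)

/-- The projection onto the `j`-th free module. -/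
noncomputable def resProj (M : ModuleCat.{u} R) (j : ℕ) :
    (ResIndex M →₀ R) →ₗ[R] ((⊤ : Submodule R (syzygy j M)).generators →₀ R) :=
  Finsupp.lcomapDomain (resMk M j) (resMk_injective M j)

variable {M : ModuleCat.{u} R}

lemma resInc_apply_same (j : ℕ) (x : (⊤ : Submodule R (syzygy j M)).generators →₀ R)
    (g : (⊤ : Submodule R (syzygy j M)).generators) : resInc M j x ⟨j, g⟩ = x g :=
  Finsupp.mapDomain_apply (resMk_injective M j) x g

lemma resInc_apply_ne {i j : ℕ} (h : i ≠ j) (x : (⊤ : Submodule R (syzygy j M)).generators →₀ R)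
    (g : (⊤ : Submodule R (syzygy i M)).generators) : resInc M j x ⟨i, g⟩ = 0 :=
  Finsupp.mapDomain_of_notMem_range x _ fun ⟨_, hy⟩ => h (congrArg Sigma.fst hy).symm

lemma resProj_apply (j : ℕ) (x : ResIndex M →₀ R)
    (g : (⊤ : Submodule R (syzygy j M)).generators) : resProj M j x g = x ⟨j, g⟩ := rfl

lemma resInc_resProj (j : ℕ) (x : ResIndex M →₀ R) :
    resInc M j (resProj M j x) = gp Sigma.fst j x := by
  ext ⟨i, g⟩
  by_cases h : i = j
  · subst h
    rw [resInc_apply_same, resProj_apply]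
    exact (gp_apply_of_eq (deg := Sigma.fst) rfl x).symm
  · rw [resInc_apply_ne h]
    exact (gp_apply_of_ne (deg := Sigma.fst) h x).symm

lemma resProj_resInc (j : ℕ) (x : (⊤ : Submodule R (syzygy j M)).generators →₀ R) :
    resProj M j (resInc M j x) = x := by
  ext g
  rw [resProj_apply, resInc_apply_same]

/-- The differential of the total minimal free resolution, on basis vectors. -/
noncomputable def resDiffBasis : ResIndex M → (ResIndex M →₀ R)
  | ⟨0, _⟩ => 0
  | ⟨j + 1, g⟩ => resInc M j (show LinearMap.ker (minimalCover (syzygy j M)) from g.1).1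

/-- The differential of the total minimal free resolution. -/
noncomputable def resDiff (M : ModuleCat.{u} R) : Module.End R (ResIndex M →₀ R) :=
  Finsupp.linearCombination R resDiffBasis

lemma resInc_single (j : ℕ) (g : (⊤ : Submodule R (syzygy j M)).generators) (r : R) :
    resInc M j (Finsupp.single g r) = Finsupp.single ⟨j, g⟩ r :=
  Finsupp.mapDomain_single

lemma resDiff_single (i : ResIndex M) : resDiff M (Finsupp.single i 1) = resDiffBasis i := by
  rw [resDiff, Finsupp.linearCombination_single, one_smul]

/-- The inclusion of a syzygy in a free module. -/
noncomputable def syzygyInc (M : ModuleCat.{u} R) (j : ℕ) :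
    syzygy (j + 1) M →ₗ[R] ((⊤ : Submodule R (syzygy j M)).generators →₀ R) :=
  (LinearMap.ker (minimalCover (syzygy j M))).subtype

lemma syzygyInc_injective (M : ModuleCat.{u} R) (j : ℕ) : Function.Injective (syzygyInc M j) :=
  Subtype.val_injective

lemma minimalCover_syzygyInc (j : ℕ) (y : syzygy (j + 1) M) :
    minimalCover (syzygy j M) (syzygyInc M j y) = 0 := y.2

lemma exists_syzygyInc {j : ℕ} {x : (⊤ : Submodule R (syzygy j M)).generators →₀ R}
    (hx : minimalCover (syzygy j M) x = 0) : ∃ y, syzygyInc M j y = x :=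
  ⟨⟨x, hx⟩, rfl⟩

lemma resDiff_resInc_succ (j : ℕ) (x : (⊤ : Submodule R (syzygy (j + 1) M)).generators →₀ R) :
    resDiff M (resInc M (j + 1) x) =
      resInc M j (syzygyInc M j (minimalCover (syzygy (j + 1) M) x)) := by
  induction x using Finsupp.induction_linear with
  | zero => simp only [map_zero]
  | add x y hx hy => simp only [map_add, hx, hy]
  | single g r =>
    rw [← mul_one r, ← smul_eq_mul, ← Finsupp.smul_single, map_smul, map_smul, map_smul, map_smul,
      map_smul, resInc_single, resDiff_single, minimalCover_single, one_smul]
    rfl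

lemma lowers_resDiff (M : ModuleCat.{u} R) : Lowers (gp Sigma.fst) 1 (resDiff M) := by
  rw [lowers_iff]
  rintro ⟨j, g⟩ l hl
  rw [resDiff_single] at hl
  rcases j with _ | j
  · exact absurd rfl hl
  · by_contra hne
    obtain ⟨i, l⟩ := l
    exact hl (resInc_apply_ne (fun h => hne (by simp [h])) _ _)

theorem minimalResolution_resDiff [IsLocalRing R] [IsNoetherianRing R] (M : ModuleCat.{u} R)
    [Module.Finite R M] : MinimalResolution M Sigma.fst (resDiff M)
      fun n => minimalCover (syzygy n M) ∘ₗ resProj M n := by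
  have hproj : ∀ n x, resProj M n (gp Sigma.fst n x) = resProj M n x := fun n x => by
    rw [← resInc_resProj, resProj_resInc]
  have hd : ∀ n x, resDiff M (gp Sigma.fst (n + 1) x) =
      resInc M n (syzygyInc M n (minimalCover (syzygy (n + 1) M) (resProj M (n + 1) x))) :=
    fun n x => by rw [← resInc_resProj, resDiff_resInc_succ]
  refine ⟨lowers_resDiff M, fun n x => ?_, fun n => ?_, fun n x => ?_, fun n x hx => ?_,
    fun n x => ⟨fun hx => ?_, fun hx => ?_⟩, fun x i => ?_, fun j => ?_, fun j => ?_⟩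
  · rw [LinearMap.comp_apply, hproj, LinearMap.comp_apply]
  · exact (minimalCover_surjective _).comp fun x => ⟨resInc M n x, resProj_resInc n x⟩
  · rw [LinearMap.comp_apply, ← hproj, lowers_resDiff, hd, resProj_resInc, minimalCover_syzygyInc]
  · obtain ⟨y, hy⟩ := exists_syzygyInc hx
    obtain ⟨z, rfl⟩ := minimalCover_surjective (syzygy (n + 1) M) y
    exact ⟨resInc M (n + 1) z, by rw [resDiff_resInc_succ, hy, resInc_resProj]⟩
  · rw [hd] at hx
    have h1 := congrArg (resProj M n) hx
    rw [resProj_resInc, map_zero] at h1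
    exact syzygyInc_injective M n (h1.trans (map_zero _).symm)
  · rw [hd, show minimalCover (syzygy (n + 1) M) (resProj M (n + 1) x) = 0 from hx, map_zero,
      map_zero]
  · have hmem : resDiff M x ∈ coeffsIn (IsLocalRing.maximalIdeal R) := by
      rw [resDiff, Finsupp.linearCombination_apply]
      refine Submodule.sum_mem _ fun i _ => Submodule.smul_mem _ _ ?_
      obtain ⟨j, g⟩ := i
      rcases j with _ | j
      · exact Submodule.zero_mem _
      · rintro ⟨i, l⟩
        by_cases h : i = j
        · subst h
          refine (resInc_apply_same (M := M) i _ l).symm ▸ ?_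
          exact mem_maximalIdeal_of_minimalCover_eq_zero _ (minimalCover_syzygyInc i g.1) l
        · exact (resInc_apply_ne (M := M) h _ l).symm ▸ Ideal.zero_mem _
    exact hmem i
  · have hfg : (⊤ : Submodule R (syzygy j M)).FG := Module.Finite.fg_top
    have := hfg.finite_generators.to_subtype
    exact Finite.of_surjective (fun g => (⟨⟨j, g⟩, rfl⟩ : {i : ResIndex M // i.1 = j}))
      fun ⟨⟨i, g⟩, hi⟩ => by subst hi; exact ⟨g, rfl⟩
  · have hfg : (⊤ : Submodule R (syzygy j M)).FG := Module.Finite.fg_top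
    rw [betti, ← hfg.generators_ncard, ← Nat.card_coe_set_eq]
    refine (Nat.card_congr (Equiv.ofBijective
      (fun g => (⟨⟨j, g⟩, rfl⟩ : {i : ResIndex M // i.1 = j})) ⟨fun g g' h => ?_, ?_⟩)).symm
    · exact resMk_injective M j (congrArg Subtype.val h)
    · exact fun ⟨⟨i, g⟩, hi⟩ => by subst hi; exact ⟨g, rfl⟩

end Resolution

/-! ### Lifting cocycles to chain maps and chain maps to homotopies -/

section Solve

variable {A : Type*} [CommRing A] {ι : Type*} {deg : ι → ℕ} {d : Module.End A (ι →₀ A)}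
  {N : Type*} [AddCommGroup N] [Module A N]

lemma linearMap_ext_gp {f g : (ι →₀ A) →ₗ[A] N} (h : ∀ j x, f (gp deg j x) = g (gp deg j x)) :
    f = g :=
  LinearMap.ext fun x => (isGrading_gp deg).induction (P := LinearMap.eqLocus f g) h x

/-- The positive part of a complex of free modules with augmentation `s` is exact. -/
structure ExactAug (deg : ι → ℕ) (d : Module.End A (ι →₀ A)) (s : (ι →₀ A) →ₗ[A] N) : Prop where
  d_low : Lowers (gp deg) 1 d
  d_d : ∀ x, d (d x) = 0
  s_surj : Function.Surjective s
  s_gp : ∀ x, s (gp deg 0 x) = s x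
  s_d : ∀ x, s (d x) = 0
  exact_zero : ∀ x, s x = 0 → ∃ y, d y = gp deg 0 x
  exact_succ : ∀ j x, d (gp deg (j + 1) x) = 0 → ∃ y, d y = gp deg (j + 1) x

variable {s : (ι →₀ A) →ₗ[A] N}

lemma ExactAug.exists_lift (h : ExactAug deg d s) {j m : ℕ} {v : Module.End A (ι →₀ A)}
    (hv : ∀ x, v (gp deg m x) = v x) (hvj : ∀ x, ∃ y, d y = v x)
    (hj : ∀ x, gp deg j (v x) = v x) :
    ∃ Y : Module.End A (ι →₀ A), (∀ x, Y (gp deg m x) = Y x) ∧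
      (∀ x, gp deg (j + 1) (Y x) = Y x) ∧ ∀ x, d (Y x) = v x := by
  choose y hy using fun i => hvj (Finsupp.single i 1)
  let Y : Module.End A (ι →₀ A) := Finsupp.linearCombination A fun i => gp deg (j + 1) (y i)
  have hY : ∀ i, Y (Finsupp.single i 1) = gp deg (j + 1) (y i) := fun i => by simp [Y]
  refine ⟨Y * gp deg m, fun x => ?_, fun x => ?_, fun x => ?_⟩
  · rw [Module.End.mul_apply, (isGrading_gp deg).apply_same]; rfl
  · have : gp deg (j + 1) * Y = Y := end_ext fun i => by
      rw [Module.End.mul_apply, hY, (isGrading_gp deg).apply_same]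
    exact LinearMap.congr_fun this (gp deg m x)
  · have : d * Y = v := end_ext fun i => by
      rw [Module.End.mul_apply, hY, ← h.d_low, hy, hj]
    rw [← hv]
    exact LinearMap.congr_fun this (gp deg m x)

/-- Inductive construction of a solution `X` of `d X = Θ + σ X d`. -/
lemma ExactAug.exists_solution (h : ExactAug deg d s) {n : ℕ} {σ : A}
    {Θ : Module.End A (ι →₀ A)} (hlow : Lowers (gp deg) (n + 1) Θ)
    (hΘ : ∀ x, d (Θ x) + σ • Θ (d x) = 0) (hs : ∀ x, s (Θ x) = 0) :
    ∃ X : Module.End A (ι →₀ A), Lowers (gp deg) n X ∧ (∀ x, X (gp deg n x) = 0) ∧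
      ∀ x, d (X x) = Θ x + σ • X (d x) := by
  have hg := isGrading_gp (S := A) deg
  -- `Y` is the component from degree `n + k` to degree `k`. The third clause makes the right-hand
  -- side of the next equation a cycle, so that exactness solves it.
  let P : ℕ → Module.End A (ι →₀ A) → Prop := fun k Y =>
    (∀ x, Y (gp deg (n + k) x) = Y x) ∧ (∀ x, gp deg k (Y x) = Y x) ∧
      (∀ x, d (Y (d x)) = Θ (gp deg (n + k) (d x))) ∧ (k = 0 → Y = 0)
  have step : ∀ (k : ℕ) (Y : Module.End A (ι →₀ A)), ∃ Y' : Module.End A (ι →₀ A), P k Y →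
      P (k + 1) Y' ∧ ∀ x, d (Y' x) = Θ (gp deg (n + (k + 1)) x) + σ • Y (d x) := fun k Y => by
    by_cases hY : P k Y
    · obtain ⟨h1, h2, h3, h4⟩ := hY
      let v : Module.End A (ι →₀ A) := Θ * gp deg (n + (k + 1)) + σ • (Y * d)
      have hv : ∀ x, v x = Θ (gp deg (n + (k + 1)) x) + σ • Y (d x) := fun x => rfl
      have hvk : ∀ x, gp deg k (v x) = v x := fun x => by
        rw [hv, map_add, map_smul, h2, hlow, show k + (n + 1) = n + (k + 1) by omega, hg.apply_same]
      obtain ⟨Y', h1', h2', h3'⟩ := h.exists_lift (j := k) (m := n + (k + 1)) (v := v)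
        (fun x => by rw [hv, hv, hg.apply_same, ← add_assoc, ← h.d_low, h1])
        (fun x => by
          rw [← hvk]
          rcases k with _ | k
          · refine h.exact_zero _ ?_
            rw [hv, h4 rfl, LinearMap.zero_apply, smul_zero, add_zero, hs]
          · refine h.exact_succ _ _ ?_
            rw [hvk, hv, map_add, map_smul, h3, h.d_low, add_assoc]
            exact hΘ _) hvk
      exact ⟨Y', fun _ => ⟨⟨h1', h2', fun x => by rw [h3', hv, h.d_d, map_zero, smul_zero,
        add_zero], fun h0 => absurd h0 (Nat.succ_ne_zero k)⟩, h3'⟩⟩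
    -- A dummy value: the recursion needs a total step function, but only meets maps satisfying `P`.
    · exact ⟨0, fun hY' => absurd hY' hY⟩
  choose F hF using step
  let Xs : ℕ → Module.End A (ι →₀ A) := fun k => Nat.rec 0 F k
  have hP : ∀ k, P k (Xs k) := fun k => by
    induction k with
    | zero =>
      refine ⟨fun x => rfl, fun x => map_zero _, fun x => ?_, fun _ => rfl⟩
      rw [add_zero, hlow.apply_low hg (Nat.lt_succ_self n)]
      exact map_zero d
    | succ k ih => exact (hF k _ ih).1
  have hXs : ∀ k x, d (Xs (k + 1) x) = Θ (gp deg (n + (k + 1)) x) + σ • Xs k (d x) :=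
    fun k => (hF k _ (hP k)).2
  let X : Module.End A (ι →₀ A) := Finsupp.linearCombination A fun i =>
    if n ≤ deg i then Xs (deg i - n) (Finsupp.single i 1) else 0
  have hX : ∀ i, X (Finsupp.single i 1) =
    if n ≤ deg i then Xs (deg i - n) (Finsupp.single i 1) else 0 := fun i => by simp [X]
  have hXlow : ∀ m, m < n → ∀ x, X (gp deg m x) = 0 := fun m hm x => by
    have : X * gp deg m = 0 := end_ext fun i => by
      rw [Module.End.mul_apply]
      by_cases hi : deg i = m
      · rw [gp_single_of_eq hi, hX, if_neg (by omega)]; rfl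
      · rw [gp_single_of_ne hi, map_zero]; rfl
    exact LinearMap.congr_fun this x
  have hXk : ∀ k x, X (gp deg (n + k) x) = Xs k x := fun k x => by
    have : X * gp deg (n + k) = Xs k := end_ext fun i => by
      rw [Module.End.mul_apply]
      by_cases hi : deg i = n + k
      · rw [gp_single_of_eq hi, hX, if_pos (by omega), hi, Nat.add_sub_cancel_left]
      · rw [gp_single_of_ne hi, map_zero, ← (hP k).1, gp_single_of_ne hi, map_zero]
    exact LinearMap.congr_fun this x
  have hX0 : ∀ x, X (gp deg n x) = 0 := fun x =>
    (hXk 0 x).trans (by rw [(hP 0).2.2.2 rfl]; rfl)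
  refine ⟨X, fun j x => ?_, hX0, fun x => ?_⟩
  · have : gp deg j * X = X * gp deg (j + n) := linearMap_ext_gp fun m x => by
      rw [Module.End.mul_apply, Module.End.mul_apply]
      by_cases hm : m < n
      · rw [hXlow m hm, map_zero, hg.apply_ne _ _ (by omega), map_zero]
      · obtain ⟨k, rfl⟩ : ∃ k, m = n + k := ⟨m - n, by omega⟩
        rw [hXk, ← (hP k).2.1]
        by_cases hjk : j = k
        · subst hjk
          rw [hg.apply_same, add_comm j n, hg.apply_same, hXk, (hP j).2.1]
        · rw [hg.apply_ne _ _ hjk, hg.apply_ne _ _ (by omega), map_zero]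
    exact LinearMap.congr_fun this x
  · have : d * X = Θ + σ • (X * d) := linearMap_ext_gp fun m x => by
      change d (X (gp deg m x)) = Θ (gp deg m x) + σ • X (d (gp deg m x))
      rcases lt_trichotomy m n with hm | rfl | hm
      · rw [hXlow m hm, map_zero, hlow.apply_low hg (by omega), zero_add]
        rcases m with _ | m
        · rw [h.d_low.apply_low hg one_pos, map_zero, smul_zero]
        · rw [← h.d_low, hXlow m (by omega), smul_zero]
      · rw [hX0, map_zero, hlow.apply_low hg (by omega), zero_add]
        rcases m with _ | m
        · rw [h.d_low.apply_low hg one_pos, map_zero, smul_zero]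
        · rw [← h.d_low, hXlow m (by omega), smul_zero]
      · obtain ⟨k, rfl⟩ : ∃ k, m = n + (k + 1) := ⟨m - n - 1, by omega⟩
        rw [hXk, hXs, ← add_assoc, ← h.d_low, hXk]
    exact LinearMap.congr_fun this x

/-- A cocycle with values in the augmented module lifts to a chain map. -/
lemma ExactAug.exists_chainMap (h : ExactAug deg d s) {n : ℕ} {u : (ι →₀ A) →ₗ[A] N}
    (hu : ∀ x, u (gp deg n x) = u x) (hd : ∀ x, u (d x) = 0) :
    ∃ ψ : Module.End A (ι →₀ A), Lowers (gp deg) n ψ ∧ (∀ x, d (ψ x) = ψ (d x)) ∧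
      ∀ x, s (ψ x) = u x := by
  have hg := isGrading_gp (S := A) deg
  choose y hy using fun i => h.s_surj (u (Finsupp.single i 1))
  let Y : Module.End A (ι →₀ A) := Finsupp.linearCombination A fun i => gp deg 0 (y i)
  have hY : ∀ i, Y (Finsupp.single i 1) = gp deg 0 (y i) := fun i => by simp [Y]
  have hY0 : ∀ x, gp deg 0 (Y x) = Y x := fun x => by
    have : gp deg 0 * Y = Y := end_ext fun i => by
      rw [Module.End.mul_apply, hY, hg.apply_same]
    exact LinearMap.congr_fun this x
  have hsY : ∀ x, s (Y x) = u x := fun x => by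
    have : s ∘ₗ Y = u := by
      ext i
      simp only [LinearMap.comp_apply, Finsupp.lsingle_apply, hY, h.s_gp, hy]
    exact LinearMap.congr_fun this x
  let ψ₀ : Module.End A (ι →₀ A) := Y * gp deg n
  have hψ₀ : ∀ x, ψ₀ x = Y (gp deg n x) := fun x => rfl
  have hlow : Lowers (gp deg) n ψ₀ := fun j x => by
    rw [hψ₀, hψ₀, ← hY0]
    rcases j with _ | j
    · rw [hg.apply_same, hY0, zero_add, hg.apply_same]
    · rw [hg.apply_ne _ _ (Nat.succ_ne_zero j), hg.apply_ne _ _ (by omega), map_zero]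
  have hdψ : ∀ x, d (ψ₀ x) = 0 := fun x => by
    rw [hψ₀, ← hY0, h.d_low.apply_low hg one_pos]
  -- The lift `ψ₀` is right only in degree `n`. With `σ = 1` the correction satisfies `d X = (ψ₀ +
  -- X) d`, and `d ψ₀ = 0`, so `ψ₀ + X` is a chain map.
  obtain ⟨X, hX, hX0, hdX⟩ := h.exists_solution (n := n) (σ := 1) (Θ := ψ₀ * d)
    (hlow.mul h.d_low) (fun x => by
      rw [Module.End.mul_apply, hdψ, Module.End.mul_apply, h.d_d, map_zero, smul_zero, add_zero])
    (fun x => by rw [Module.End.mul_apply, hψ₀, hsY, hu, hd])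
  refine ⟨ψ₀ + X, hlow.add hX, fun x => ?_, fun x => ?_⟩
  · rw [LinearMap.add_apply, LinearMap.add_apply, map_add, hdψ, hdX, zero_add, one_smul]
    rfl
  · rw [LinearMap.add_apply, map_add, ← h.s_gp (X x), hX, zero_add, hX0, map_zero, add_zero, hψ₀,
      hsY, hu]

/-- A chain map of degree `-2` that induces zero on the augmented module is null-homotopic. -/
lemma ExactAug.exists_homotopy (h : ExactAug deg d s) {θ : Module.End A (ι →₀ A)}
    (hlow : Lowers (gp deg) 2 θ) (hd : ∀ x, d (θ x) = θ (d x)) (hs : ∀ x, s (θ x) = 0) :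
    ∃ X : Module.End A (ι →₀ A), Lowers (gp deg) 1 X ∧ ∀ x, θ x = d (X x) + X (d x) := by
  -- With `σ = -1` the equation reads `d X = θ - X d`.
  obtain ⟨X, hX, -, hdX⟩ := h.exists_solution (n := 1) (σ := -1) hlow
    (fun x => by rw [neg_one_smul, hd, add_neg_cancel]) hs
  exact ⟨X, hX, fun x => by rw [hdX, neg_one_smul, neg_add_cancel_right]⟩

end Solve

/-! ### Flat base change of kernels and of linear systems -/

section FlatBaseChange

open TensorProduct

variable {R R' : Type*} [CommRing R] [CommRing R'] [Algebra R R'] {ι : Type*}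
  {Y Z : Type*} [AddCommGroup Y] [Module R Y] [AddCommGroup Z] [Module R Z]

/-- The base change to `R'` of a linear map on a free module. -/
noncomputable def hat (R' : Type*) [CommRing R'] [Algebra R R'] (u : (ι →₀ R) →ₗ[R] Y) :
    (ι →₀ R') →ₗ[R'] R' ⊗[R] Y :=
  Finsupp.linearCombination R' fun i => 1 ⊗ₜ[R] u (Finsupp.single i 1)

lemma hat_single (u : (ι →₀ R) →ₗ[R] Y) (i : ι) :
    hat R' u (Finsupp.single i 1) = 1 ⊗ₜ[R] u (Finsupp.single i 1) := by
  rw [hat, Finsupp.linearCombination_single, one_smul]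

lemma hat_coef (u : (ι →₀ R) →ₗ[R] Y) (x : ι →₀ R) :
    hat R' u (coef (algebraMap R R') x) = 1 ⊗ₜ[R] u x := by
  induction x using Finsupp.induction_linear with
  | zero => simp
  | add x y hx hy => rw [map_add, map_add, map_add, hx, hy, TensorProduct.tmul_add]
  | single i r =>
    have h1 : Finsupp.single i r = r • Finsupp.single i (1 : R) := by simp
    have h2 : coef (algebraMap R R') (Finsupp.single i (1 : R)) = Finsupp.single i 1 := by simp
    rw [h1, coef_smul, map_smul, map_smul, h2, hat_single, TensorProduct.tmul_smul,
      algebraMap_smul]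

lemma linearMap_ext_coef {P : Type*} [AddCommGroup P] [Module R' P] {f g : (ι →₀ R') →ₗ[R'] P}
    (h : ∀ x : ι →₀ R, f (coef (algebraMap R R') x) = g (coef (algebraMap R R') x)) : f = g := by
  ext i
  simpa using h (Finsupp.single i 1)

lemma hat_zero (x : ι →₀ R') : hat R' (0 : (ι →₀ R) →ₗ[R] Y) x = 0 := by
  have : hat R' (0 : (ι →₀ R) →ₗ[R] Y) = 0 := linearMap_ext_coef fun x => by
    rw [hat_coef, LinearMap.zero_apply, TensorProduct.tmul_zero, LinearMap.zero_apply]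
  exact LinearMap.congr_fun this x

lemma hat_bc (u : (ι →₀ R) →ₗ[R] Y) (φ : Module.End R (ι →₀ R)) (x : ι →₀ R') :
    hat R' u (bc (algebraMap R R') φ x) = hat R' (u ∘ₗ φ) x := by
  have : hat R' u ∘ₗ bc (algebraMap R R') φ = hat R' (u ∘ₗ φ) := linearMap_ext_coef fun x => by
    rw [LinearMap.comp_apply, bc_coef, hat_coef, hat_coef, LinearMap.comp_apply]
  exact LinearMap.congr_fun this x

lemma bc_gp {S S' : Type*} [CommRing S] [CommRing S'] (g : S →+* S') (deg : ι → ℕ) (j : ℕ) :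
    bc g (gp deg j) = gp deg j :=
  end_ext fun i => by rw [bc_single, coef_gp, coef_single, map_one]

lemma hat_gp (u : (ι →₀ R) →ₗ[R] Y) {deg : ι → ℕ} {n : ℕ} (hu : ∀ x, u (gp deg n x) = u x)
    (x : ι →₀ R') : hat R' u (gp deg n x) = hat R' u x := by
  rw [← bc_gp (algebraMap R R'), hat_bc, show u ∘ₗ gp deg n = u from LinearMap.ext hu]

lemma hat_surjective {u : (ι →₀ R) →ₗ[R] Y} (hu : Function.Surjective u) :
    Function.Surjective (hat R' u) := fun y => by
  induction y using TensorProduct.induction_on with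
  | zero => exact ⟨0, map_zero _⟩
  | add x y hx hy =>
    obtain ⟨a, rfl⟩ := hx
    obtain ⟨b, rfl⟩ := hy
    exact ⟨a + b, map_add _ _ _⟩
  | tmul r y =>
    obtain ⟨x, rfl⟩ := hu y
    exact ⟨r • coef (algebraMap R R') x, by
      rw [map_smul, hat_coef, TensorProduct.smul_tmul', smul_eq_mul, mul_one]⟩

lemma lTensor_exact_ker (R' : Type*) [CommRing R'] [Algebra R R'] [Module.Flat R R']
    (u : Y →ₗ[R] Z) :
    Function.Exact ((LinearMap.ker u).subtype.lTensor R') (u.lTensor R') :=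
  Module.Flat.lTensor_exact R' (LinearMap.exact_subtype_ker_map u)

/-- By flatness the kernel of the base change is the base change of the kernel. -/
lemma mem_span_of_hat_eq_zero [Module.Flat R R'] {u : (ι →₀ R) →ₗ[R] Y} {x : ι →₀ R'}
    (hx : hat R' u x = 0) :
    x ∈ Submodule.span R' (coef (algebraMap R R') '' {z | u z = 0}) := by
  have hex := lTensor_exact_ker R' u
  let c : R' ⊗[R] (ι →₀ R) →ₗ[R'] (ι →₀ R') :=
    LinearMap.liftBaseChange R' (Finsupp.mapRange.linearMap (Algebra.linearMap R R'))
  have hc : ∀ r z, c (r ⊗ₜ z) = r • coef (algebraMap R R') z := fun r z =>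
    LinearMap.liftBaseChange_tmul _ _ _ _
  have hcu : ∀ w, hat R' u (c w) = u.lTensor R' w := fun w => by
    induction w using TensorProduct.induction_on with
    | zero => simp
    | add x y hx hy => rw [map_add, map_add, map_add, hx, hy]
    | tmul r z =>
      rw [hc, map_smul, hat_coef, LinearMap.lTensor_tmul, TensorProduct.smul_tmul', smul_eq_mul,
        mul_one]
  obtain ⟨w, rfl⟩ : ∃ w, c w = x := by
    refine ⟨∑ i ∈ x.support, x i ⊗ₜ Finsupp.single i 1, ?_⟩
    rw [map_sum]
    conv_rhs => rw [← Finsupp.sum_single x, Finsupp.sum]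
    refine Finset.sum_congr rfl fun i _ => ?_
    rw [hc, coef_single, map_one, Finsupp.smul_single, smul_eq_mul, mul_one]
  rw [hcu] at hx
  obtain ⟨v, rfl⟩ := (hex w).1 hx
  clear hx
  induction v using TensorProduct.induction_on with
  | zero => rw [map_zero, map_zero]; exact Submodule.zero_mem _
  | add a b ha hb =>
    rw [map_add, map_add]
    exact Submodule.add_mem _ ha hb
  | tmul r z =>
    rw [LinearMap.lTensor_tmul, hc]
    exact Submodule.smul_mem _ _ (Submodule.subset_span ⟨z.1, z.2, rfl⟩)

lemma mem_span_of_bc_eq_zero [Module.Flat R R'] {φ : Module.End R (ι →₀ R)} {x : ι →₀ R'}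
    (hx : bc (algebraMap R R') φ x = 0) :
    x ∈ Submodule.span R' (coef (algebraMap R R') '' {z | φ z = 0}) := by
  refine mem_span_of_hat_eq_zero (Y := ι →₀ R) (u := φ) ?_
  have h1 := hat_bc (R' := R') (Y := ι →₀ R) LinearMap.id φ x
  rw [LinearMap.id_comp] at h1
  rw [← h1, hx, map_zero]

/-- Solutions of a linear system in a flat base change come from solutions of the system. -/
lemma exists_sum_tmul_eq [Module.Flat R R'] {α β : Type*} [Fintype α] [Fintype β]
    (a : β → α → R) {v : α → R' ⊗[R] Y} (hv : ∀ b, ∑ i, a b i • v i = 0) :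
    ∃ (κ : Type) (_ : Fintype κ) (r : κ → R') (m : κ → α → Y),
      (∀ l b, ∑ i, a b i • m l i = 0) ∧ ∀ i, v i = ∑ l, r l ⊗ₜ[R] m l i := by
  classical
  -- The solution set is the kernel of `Φ`; as `α` and `β` are finite, tensoring commutes with both
  -- powers of `Y`.
  let Φ : (α → Y) →ₗ[R] (β → Y) := LinearMap.pi fun b => ∑ i, a b i • LinearMap.proj i
  have hΦ : ∀ m b, Φ m b = ∑ i, a b i • m i := fun m b => by simp [Φ]
  have hex := lTensor_exact_ker R' Φ
  let eα := TensorProduct.piRight R R R' fun _ : α => Y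
  let eβ := TensorProduct.piRight R R R' fun _ : β => Y
  have hcomm : ∀ w b, eβ (Φ.lTensor R' w) b = ∑ i, a b i • eα w i := fun w b => by
    induction w using TensorProduct.induction_on with
    | zero => simp
    | add x y hx hy =>
      simp only [map_add, Pi.add_apply, hx, hy, smul_add, Finset.sum_add_distrib]
    | tmul r m =>
      rw [LinearMap.lTensor_tmul, TensorProduct.piRight_apply, TensorProduct.piRight_apply,
        TensorProduct.piRightHom_tmul, TensorProduct.piRightHom_tmul]
      beta_reduce
      rw [hΦ, TensorProduct.tmul_sum]
      exact Finset.sum_congr rfl fun i _ => TensorProduct.tmul_smul _ _ _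
  obtain ⟨w, rfl⟩ := eα.surjective v
  have hw : Φ.lTensor R' w = 0 := eβ.injective (by
    rw [map_zero]
    exact funext fun b => (hcomm w b).trans (hv b))
  obtain ⟨z, rfl⟩ := (hex w).1 hw
  obtain ⟨s, rfl⟩ := TensorProduct.exists_finset z
  refine ⟨Fin s.card, inferInstance, fun l => (s.equivFin.symm l).1.1,
    fun l => (s.equivFin.symm l).1.2.1, fun l b => ?_, fun i => ?_⟩
  · rw [← hΦ, show Φ _ = 0 from (s.equivFin.symm l).1.2.2]; rfl
  · rw [map_sum, map_sum, Finset.sum_apply, ← Finset.sum_coe_sort,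
      ← Equiv.sum_comp s.equivFin.symm]
    refine Finset.sum_congr rfl fun l _ => ?_
    rw [LinearMap.lTensor_tmul]
    exact congrFun (TensorProduct.piRight_apply _ _ _ _ _) i

end FlatBaseChange

/-! ### Descent of chain maps along a flat extension -/

section Descent

open TensorProduct

lemma ExactAug.exact {A : Type*} [CommRing A] {ι : Type*} {deg : ι → ℕ}
    {d : Module.End A (ι →₀ A)} {N : Type*} [AddCommGroup N] [Module A N] {s : (ι →₀ A) →ₗ[A] N}
    (h : ExactAug deg d s) {x : ι →₀ A} (hd : d x = 0) (hs : s x = 0) : ∃ y, d y = x := by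
  obtain ⟨n, hn⟩ := (isGrading_gp deg).eventually_zero x
  rw [← (isGrading_gp deg).sum_eq hn]
  refine Submodule.sum_mem (LinearMap.range d) fun j _ => ?_
  rcases j with _ | j
  · exact h.exact_zero x hs
  · exact h.exact_succ j x (by rw [← h.d_low, hd, map_zero])

lemma gp_eq_sum {A : Type*} [CommRing A] {ι : Type*} {deg : ι → ℕ} {j : ℕ}
    [Fintype {i // deg i = j}] (x : ι →₀ A) :
    gp deg j x = ∑ i : {i // deg i = j}, gp deg j x i.1 • Finsupp.single i.1 1 := by
  classical
  ext l
  rw [Finsupp.finsetSum_apply]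
  by_cases hl : deg l = j
  · rw [Finset.sum_eq_single ⟨l, hl⟩]
    · simp
    · intro b _ hb
      rw [Finsupp.smul_apply, Finsupp.single_apply, if_neg fun h => hb (Subtype.ext h), smul_zero]
    · exact fun h => absurd (Finset.mem_univ _) h
  · rw [gp_apply_of_ne hl]
    refine (Finset.sum_eq_zero fun b _ => ?_).symm
    rw [Finsupp.smul_apply, Finsupp.single_apply, if_neg fun h : b.1 = l => hl (h ▸ b.2), smul_zero]

variable {R : Type u} [CommRing R] {ι : Type u} {deg : ι → ℕ} {d : Module.End R (ι →₀ R)}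

lemma MinimalResolution.exactAug [IsLocalRing R] {M : ModuleCat.{u} R}
    {s : ∀ n, (ι →₀ R) →ₗ[R] syzygy n M} (h : MinimalResolution M deg d s) :
    ExactAug deg d (s 0 : (ι →₀ R) →ₗ[R] M) := by
  have hlow : ∀ x, d (gp deg 0 x) = 0 := h.d_low.apply_low (isGrading_gp deg) one_pos
  refine ⟨h.d_low, fun x => ?_, h.s_surj 0, h.s_gp 0, h.s_d 0, h.s_exact 0, fun j x hx =>
    h.s_exact (j + 1) x ((h.d_eq_zero_iff j x).1 hx)⟩
  have : d * d = 0 := linearMap_ext_gp (deg := deg) fun j x => by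
    change d (d (gp deg j x)) = 0
    rcases j with _ | _ | j
    · rw [hlow, map_zero]
    · rw [← h.d_low, hlow]
    · rw [← h.d_low, h.d_eq_zero_iff, h.s_d]
  exact LinearMap.congr_fun this x

variable {M : Type*} [AddCommGroup M] [Module R M] {s : (ι →₀ R) →ₗ[R] M}

lemma ExactAug.baseChange (h : ExactAug deg d s) (R' : Type*) [CommRing R'] [Algebra R R']
    [Module.Flat R R'] : ExactAug deg (bc (algebraMap R R') d) (hat R' s) := by
  have hrange : ∀ z, coef (algebraMap R R') (d z) ∈ LinearMap.range (bc (algebraMap R R') d) :=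
    fun z => ⟨_, bc_coef _ _ _⟩
  refine ⟨h.d_low.bc _, fun x => ?_, hat_surjective h.s_surj, hat_gp _ h.s_gp, fun x => ?_,
    fun x hx => ?_, fun j x hx => ?_⟩
  · rw [← Module.End.mul_apply, ← map_mul, show d * d = 0 from LinearMap.ext h.d_d, map_zero]
    rfl
  · rw [hat_bc, show s ∘ₗ d = 0 from LinearMap.ext h.s_d]
    exact hat_zero x
  · have hle : Submodule.span R' (coef (algebraMap R R') '' {z | s z = 0}) ≤
        (LinearMap.range (bc (algebraMap R R') d)).comap (gp (S := R') deg 0) := by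
      rw [Submodule.span_le]
      rintro _ ⟨z, hz, rfl⟩
      obtain ⟨y, hy⟩ := h.exact_zero z hz
      rw [SetLike.mem_coe, Submodule.mem_comap, ← coef_gp, ← hy]
      exact hrange y
    exact hle (mem_span_of_hat_eq_zero hx)
  · let φ : Module.End R (ι →₀ R) := d * gp deg (j + 1)
    have hle : Submodule.span R' (coef (algebraMap R R') '' {z | φ z = 0}) ≤
        (LinearMap.range (bc (algebraMap R R') d)).comap (gp (S := R') deg (j + 1)) := by
      rw [Submodule.span_le]
      rintro _ ⟨z, hz, rfl⟩
      obtain ⟨y, hy⟩ := h.exact_succ j z hz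
      rw [SetLike.mem_coe, Submodule.mem_comap, ← coef_gp, ← hy]
      exact hrange y
    refine hle (mem_span_of_bc_eq_zero ?_)
    rw [map_mul, bc_gp, Module.End.mul_apply, hx]

/-- A chain map of degree `-2` over a flat extension is, up to homotopy, a combination of chain
maps over the base. -/
theorem ExactAug.exists_descent (h : ExactAug deg d s) (hdeg : ∀ j, Finite {i // deg i = j})
    {R' : Type*} [CommRing R'] [Algebra R R'] [Module.Flat R R'] {t : Module.End R' (ι →₀ R')}
    (hlow : Lowers (gp deg) 2 t)
    (ht : ∀ x, bc (algebraMap R R') d (t x) = t (bc (algebraMap R R') d x)) :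
    ∃ (α : Type) (_ : Fintype α) (r : α → R') (ψ : α → Module.End R (ι →₀ R))
      (X : Module.End R' (ι →₀ R')), (∀ l, Lowers (gp deg) 2 (ψ l)) ∧
      (∀ l x, d (ψ l x) = ψ l (d x)) ∧
      ∀ x, t x = ∑ l, r l • bc (algebraMap R R') (ψ l) x +
        (bc (algebraMap R R') d (X x) + X (bc (algebraMap R R') d x)) := by
  classical
  have h' := h.baseChange R'
  have := hdeg 2
  have := hdeg 3
  cases nonempty_fintype {i // deg i = 2}
  cases nonempty_fintype {i // deg i = 3}
  have hd3 : ∀ b : {i // deg i = 3}, d (Finsupp.single b.1 1) =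
      ∑ i : {i // deg i = 2}, d (Finsupp.single b.1 1) i.1 • Finsupp.single i.1 1 := fun b => by
    have h1 : d (Finsupp.single b.1 1) = gp deg 2 (d (Finsupp.single b.1 1)) := by
      rw [h.d_low, gp_single_of_eq b.2]
    rw [h1]
    exact gp_eq_sum _
  -- The augmentation of `t` is a 2-cocycle with values in `R' ⊗ M`. Being a cocycle is a finite
  -- linear system over `R` on the values at the basis of degree 2, with one equation per basis
  -- vector of degree 3.
  obtain ⟨α, _, r, m, hm, hv⟩ := exists_sum_tmul_eq (R' := R') (Y := M)
    (fun (b : {i // deg i = 3}) (i : {i // deg i = 2}) => d (Finsupp.single b.1 1) i.1)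
    (v := fun i => hat R' s (t (Finsupp.single i.1 1))) (fun b => by
      have h1 : hat R' s (t (bc (algebraMap R R') d (Finsupp.single b.1 1))) = 0 := by
        rw [← ht, h'.s_d]
      rw [bc_single, hd3 b, map_sum, map_sum, map_sum] at h1
      rw [← h1]
      refine Finset.sum_congr rfl fun i _ => ?_
      rw [coef_smul, coef_single, map_one, map_smul, map_smul, algebraMap_smul])
  let u : α → (ι →₀ R) →ₗ[R] M := fun l => Finsupp.linearCombination R fun i =>
    if hi : deg i = 2 then m l ⟨i, hi⟩ else 0
  have hu : ∀ l i, u l (Finsupp.single i 1) = if hi : deg i = 2 then m l ⟨i, hi⟩ else 0 :=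
    fun l i => by simp [u]
  have hu2 : ∀ l x, u l (gp deg 2 x) = u l x := fun l x => by
    have : u l ∘ₗ gp deg 2 = u l := by
      ext i
      simp only [LinearMap.comp_apply, Finsupp.lsingle_apply]
      by_cases hi : deg i = 2
      · rw [gp_single_of_eq hi]
      · rw [gp_single_of_ne hi, map_zero, hu, dif_neg hi]
    exact LinearMap.congr_fun this x
  have hud : ∀ l x, u l (d x) = 0 := fun l x => by
    have : u l ∘ₗ d = 0 := by
      ext b
      simp only [LinearMap.comp_apply, Finsupp.lsingle_apply, LinearMap.zero_apply]
      by_cases hb : deg b = 3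
      · rw [hd3 ⟨b, hb⟩, map_sum, ← hm l ⟨b, hb⟩]
        refine Finset.sum_congr rfl fun i _ => ?_
        rw [map_smul, hu, dif_pos i.2]
      · rw [← hu2, h.d_low, gp_single_of_ne hb, map_zero, map_zero]
    exact LinearMap.congr_fun this x
  choose ψ hψ hdψ hsψ using fun l => h.exists_chainMap (hu2 l) (hud l)
  have hst : ∀ x, hat R' s (t x) = ∑ l, r l • hat R' (u l) x := fun x => by
    have : hat R' s ∘ₗ t = ∑ l, r l • hat R' (u l) := by
      ext i
      simp only [LinearMap.comp_apply, Finsupp.lsingle_apply, LinearMap.sum_apply,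
        LinearMap.smul_apply]
      by_cases hi : deg i = 2
      · rw [hv ⟨i, hi⟩]
        refine Finset.sum_congr rfl fun l _ => ?_
        rw [hat_single, hu, dif_pos hi, TensorProduct.smul_tmul', smul_eq_mul, mul_one]
      · rw [← h'.s_gp, hlow, gp_single_of_ne hi, map_zero, map_zero]
        refine (Finset.sum_eq_zero fun l _ => ?_).symm
        rw [hat_single, hu, dif_neg hi, TensorProduct.tmul_zero, smul_zero]
    have := LinearMap.congr_fun this x
    simpa only [LinearMap.comp_apply, LinearMap.sum_apply, LinearMap.smul_apply] using this
  let Ψ : Module.End R' (ι →₀ R') := ∑ l, r l • bc (algebraMap R R') (ψ l)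
  have hΨ : ∀ x, Ψ x = ∑ l, r l • bc (algebraMap R R') (ψ l) x := fun x => by
    simp only [Ψ, LinearMap.sum_apply, LinearMap.smul_apply]
  have hdbc : ∀ l x, bc (algebraMap R R') d (bc (algebraMap R R') (ψ l) x) =
      bc (algebraMap R R') (ψ l) (bc (algebraMap R R') d x) := fun l x => by
    rw [← Module.End.mul_apply, ← map_mul, ← Module.End.mul_apply, ← map_mul,
      show d * ψ l = ψ l * d from LinearMap.ext (hdψ l)]
  -- By construction `t - Ψ` has zero augmentation, so it is null-homotopic.
  obtain ⟨X, -, hX⟩ := h'.exists_homotopy (θ := t - Ψ)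
    (hlow.sub (Lowers.sum _ fun l _ => ((hψ l).bc _).smul _)) (fun x => by
      rw [LinearMap.sub_apply, LinearMap.sub_apply, map_sub, ht, hΨ, hΨ, map_sum]
      simp only [map_smul, hdbc]) (fun x => by
      rw [LinearMap.sub_apply, map_sub, hst, hΨ, map_sum, sub_eq_zero]
      refine Finset.sum_congr rfl fun l _ => ?_
      rw [map_smul, hat_bc, show s ∘ₗ ψ l = u l from LinearMap.ext (hsψ l)])
  refine ⟨α, inferInstance, r, ψ, X, hψ, hdψ, fun x => ?_⟩
  rw [← hX, ← hΨ, LinearMap.sub_apply, add_sub_cancel]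

end Descent

/-! ### Reductions of chain maps to the residue field -/

section Operators

/-- Independent coefficients allow identities over the larger field to be compared coefficient by
coefficient; compare `eq_zero_of_sum_smul_bc_eq_zero`. -/
lemma exists_linearIndependent_combination {k κ : Type*} [Field k] [Field κ] [Algebra k κ]
    {α : Type*} [Finite α] (r : α → κ) :
    ∃ (n : ℕ) (b : Fin n → κ) (c : α → Fin n → k), LinearIndependent k b ∧
      ∀ l, r l = ∑ i, c l i • b i := by
  let V := Submodule.span k (Set.range r)
  have : Module.Finite k V := Module.Finite.span_of_finite k (Set.finite_range r)
  let B := Module.finBasis k V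
  refine ⟨_, fun i => (B i : κ), fun l i => B.repr ⟨r l, Submodule.subset_span ⟨l, rfl⟩⟩ i,
    B.linearIndependent.map' V.subtype (Submodule.ker_subtype V), fun l => ?_⟩
  have := congrArg V.subtype (B.sum_repr ⟨r l, Submodule.subset_span ⟨l, rfl⟩⟩)
  rw [map_sum] at this
  exact this.symm

lemma eq_zero_of_sum_smul_bc_eq_zero {k κ : Type*} [Field k] [Field κ] [Algebra k κ] {ι : Type*}
    {n : ℕ} {b : Fin n → κ} (hb : LinearIndependent k b) {y : Fin n → Module.End k (ι →₀ k)}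
    (hy : ∀ x, ∑ i, b i • bc (algebraMap k κ) (y i) x = 0) (i : Fin n) : y i = 0 := by
  refine end_ext fun l => Finsupp.ext fun l' => ?_
  have h1 := DFunLike.congr_fun (hy (Finsupp.single l 1)) l'
  rw [Finsupp.finsetSum_apply] at h1
  refine Fintype.linearIndependent_iff.1 hb (fun i => y i (Finsupp.single l 1) l') ?_ i
  refine Eq.trans (Finset.sum_congr rfl fun i _ => ?_) h1
  rw [Finsupp.smul_apply, bc_single, coef_apply, Algebra.smul_def, smul_eq_mul, mul_comm]

lemma piece_gp_eq_supported {A : Type*} [CommRing A] {ι : Type*} (deg : ι → ℕ) (j : ℕ) :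
    piece (gp (S := A) deg) j = Finsupp.supported A A {i | deg i = j} := by
  ext x
  rw [(isGrading_gp deg).mem_piece, Finsupp.mem_supported]
  constructor
  · intro hx i hi
    by_contra hne
    rw [← hx, Finset.mem_coe, Finsupp.mem_support_iff, gp_apply_of_ne hne] at hi
    exact hi rfl
  · intro hx
    ext i
    by_cases hi : deg i = j
    · rw [gp_apply_of_eq hi]
    · rw [gp_apply_of_ne hi]
      by_contra hne
      exact hi (hx (Finsupp.mem_support_iff.2 (Ne.symm hne)))

lemma finrank_piece_gp {k : Type*} [Field k] {ι : Type*} (deg : ι → ℕ) (j : ℕ) :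
    Module.finrank k (piece (gp (S := k) deg) j) = Nat.card {i // deg i = j} := by
  rw [piece_gp_eq_supported, (Finsupp.supportedEquivFinsupp {i | deg i = j}).finrank_eq,
    Module.finrank_eq_nat_card_basis (Finsupp.basisSingleOne (R := k))]
  rfl

/-- For a minimal resolution the reduced differential is zero, so bounds on homology bound the ranks
themselves. -/
lemma finrank_piece_le_hgr {k : Type*} [Field k] {E : Type*} [AddCommGroup E] [Module k E]
    {p : ℕ → Module.End k E} {d : Module.End k E} (hp : IsGrading p) (hd : Lowers p 1 d)
    [∀ j, Module.Finite k (piece p j)] (h0 : ∀ x, d x = 0) (j : ℕ) :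
    Module.finrank k (piece p j) ≤ Module.finrank k (piece (hgr hp hd) j) := by
  have := finite_piece_hgr hp hd
  let F : E →ₗ[k] Hlgy d := (Submodule.mkQ _) ∘ₗ (LinearMap.id.codRestrict (LinearMap.ker d) h0)
  have hF : ∀ x, F x = cls x (h0 x) := fun x => rfl
  let G : piece p j →ₗ[k] piece (hgr hp hd) j := F.restrict (by
    rintro _ ⟨x, rfl⟩
    exact ⟨F x, rfl⟩)
  refine LinearMap.finrank_le_finrank_of_injective (f := G) ((injective_iff_map_eq_zero G).2
    fun x hx => ?_)
  obtain ⟨y, hy⟩ := cls_eq_zero_iff.1 ((hF x).symm.trans (congrArg Subtype.val hx))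
  exact Subtype.ext (hy.symm.trans (h0 y))

variable {R : Type u} [CommRing R] [IsLocalRing R] {ι : Type u} {deg : ι → ℕ}
  {d : Module.End R (ι →₀ R)}

/-- The reductions modulo the maximal ideal of the chain maps of degree `-n`. -/
def chainOps (deg : ι → ℕ) (d : Module.End R (ι →₀ R)) (n : ℕ) :
    Set (Module.End (IsLocalRing.ResidueField R) (ι →₀ IsLocalRing.ResidueField R)) :=
  {φ | ∃ ψ : Module.End R (ι →₀ R), Lowers (gp deg) n ψ ∧ (∀ x, d (ψ x) = ψ (d x)) ∧
    bc (IsLocalRing.residue R) ψ = φ}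

/-- The elements of `chainOps` that commute with all others. -/
def centralOps (deg : ι → ℕ) (d : Module.End R (ι →₀ R)) (n : ℕ) :
    Set (Module.End (IsLocalRing.ResidueField R) (ι →₀ IsLocalRing.ResidueField R)) :=
  {φ | φ ∈ chainOps deg d n ∧ ∀ m, ∀ χ ∈ chainOps deg d m, ∀ x, φ (χ x) = χ (φ x)}

variable {m n : ℕ} {φ χ : Module.End (IsLocalRing.ResidueField R)
  (ι →₀ IsLocalRing.ResidueField R)}

lemma lowers_of_mem_chainOps (h : φ ∈ chainOps deg d n) : Lowers (gp deg) n φ := by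
  obtain ⟨ψ, hψ, -, rfl⟩ := h
  exact hψ.bc _

lemma zero_mem_chainOps (n : ℕ) : 0 ∈ chainOps deg d n :=
  ⟨0, Lowers.zero, fun _ => map_zero d, map_zero _⟩

lemma add_mem_chainOps (h : φ ∈ chainOps deg d n) (h' : χ ∈ chainOps deg d n) :
    φ + χ ∈ chainOps deg d n := by
  obtain ⟨ψ, h1, h2, rfl⟩ := h
  obtain ⟨ψ', h1', h2', rfl⟩ := h'
  exact ⟨ψ + ψ', h1.add h1', fun x => by
    rw [LinearMap.add_apply, LinearMap.add_apply, map_add, h2, h2'], map_add _ _ _⟩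

lemma smul_mem_chainOps (r : IsLocalRing.ResidueField R) (h : φ ∈ chainOps deg d n) :
    r • φ ∈ chainOps deg d n := by
  obtain ⟨ψ, h1, h2, rfl⟩ := h
  obtain ⟨r, rfl⟩ := IsLocalRing.residue_surjective r
  exact ⟨r • ψ, h1.smul r, fun x => by
    rw [LinearMap.smul_apply, LinearMap.smul_apply, map_smul, h2], bc_smul _ _ _⟩

lemma sum_mem_chainOps {α : Type*} (t : Finset α) {φ : α → Module.End (IsLocalRing.ResidueField R)
    (ι →₀ IsLocalRing.ResidueField R)} (h : ∀ a ∈ t, φ a ∈ chainOps deg d n) :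
    ∑ a ∈ t, φ a ∈ chainOps deg d n := by
  classical
  induction t using Finset.induction_on with
  | empty => exact zero_mem_chainOps n
  | insert a t ha ih =>
    rw [Finset.sum_insert ha]
    exact add_mem_chainOps (h a (Finset.mem_insert_self a t))
      (ih fun b hb => h b (Finset.mem_insert_of_mem hb))

lemma mul_mem_chainOps (h : φ ∈ chainOps deg d m) (h' : χ ∈ chainOps deg d n) :
    φ * χ ∈ chainOps deg d (m + n) := by
  obtain ⟨ψ, h1, h2, rfl⟩ := h
  obtain ⟨ψ', h1', h2', rfl⟩ := h'
  exact ⟨ψ * ψ', h1.mul h1', fun x => by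
    rw [Module.End.mul_apply, Module.End.mul_apply, h2, h2'], map_mul _ _ _⟩

lemma zero_mem_centralOps (n : ℕ) : 0 ∈ centralOps deg d n :=
  ⟨zero_mem_chainOps n, fun _ χ _ _ => (map_zero χ).symm⟩

lemma one_mem_centralOps : 1 ∈ centralOps deg d 0 :=
  ⟨⟨1, fun _ _ => rfl, fun _ => rfl, map_one _⟩, fun _ _ _ _ => rfl⟩

lemma add_mem_centralOps (h : φ ∈ centralOps deg d n) (h' : χ ∈ centralOps deg d n) :
    φ + χ ∈ centralOps deg d n :=
  ⟨add_mem_chainOps h.1 h'.1, fun m ω hω x => by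
    rw [LinearMap.add_apply, LinearMap.add_apply, map_add, h.2 m ω hω, h'.2 m ω hω]⟩

lemma mul_mem_centralOps (h : φ ∈ centralOps deg d m) (h' : χ ∈ centralOps deg d n) :
    φ * χ ∈ centralOps deg d (m + n) :=
  ⟨mul_mem_chainOps h.1 h'.1, fun m ω hω x => by
    rw [Module.End.mul_apply, Module.End.mul_apply, h'.2 m ω hω, h.2 m ω hω]⟩

end Operators

/-! ### Central operators on the reduced minimal resolution -/

section Operators

variable {S R' : Type u} [CommRing S] [CommRing R'] {p : S →+* R'} {f : ℕ → S} {c : ℕ}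
  {ι : Type u} {deg : ι → ℕ}

lemma coef_eq_zero_iff_mem (hker : ∀ x, p x = 0 ↔ x ∈ initIdeal f c) {x : ι →₀ S} :
    coef p x = 0 ↔ x ∈ coeffsIn (initIdeal f c) := by
  constructor
  · intro h i
    rw [← hker, ← coef_apply, h]
    rfl
  · intro h
    ext i
    rw [coef_apply]
    exact (hker _).2 (h i)

/-- The lifted differential squares to zero modulo the kernel of `p`, so its square decomposes along
the generators `f a`. -/
lemma ExactAug.exists_liftedComplex (hp : Function.Surjective p)
    (hker : ∀ x, p x = 0 ↔ x ∈ initIdeal f c) {d : Module.End R' (ι →₀ R')} {N : Type u}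
    [AddCommGroup N] [Module R' N] [Module S N] (hN : ∀ (r : S) (n : N), r • n = p r • n)
    {s : (ι →₀ R') →ₗ[R'] N} (h : ExactAug deg d s) :
    ∃ (D : Module.End S (ι →₀ S)) (t : ℕ → Module.End S (ι →₀ S)) (ε : (ι →₀ S) →ₗ[S] N),
      bc p D = d ∧ LiftedComplex f c deg D t ε := by
  obtain ⟨D, hD, hDlow⟩ := exists_bc_eq (deg := deg) hp d
  have hdd : ∀ x, (D * D) x ∈ coeffsIn (initIdeal f c) := fun x => by
    rw [← coef_eq_zero_iff_mem hker, ← bc_coef, map_mul, hD]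
    exact h.d_d _
  obtain ⟨t, ht, htlow⟩ := exists_eq_sum_smul (deg := deg) hdd
  let ε : (ι →₀ S) →ₗ[S] N :=
    { toFun := fun x => s (coef p x)
      map_add' := fun x y => by rw [map_add, map_add]
      map_smul' := fun r x => by rw [coef_smul, map_smul, RingHom.id_apply, hN] }
  have hε : ∀ x, ε x = s (coef p x) := fun x => rfl
  have hlow : Lowers (gp deg) 1 D := hDlow 1 h.d_low
  refine ⟨D, t, ε, hD, hlow, fun a _ => htlow 2 (hlow.mul hlow) a, ht,
    h.s_surj.comp (coef_surjective hp), fun x => ?_, fun j x hj => ?_, fun a ha n => ?_,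
    fun x hx hεx => ?_⟩
  · rw [hε, ← bc_coef, hD, h.s_d]
  · rw [hε, ← h.s_gp, coef_gp, (isGrading_gp deg).apply_ne 0 j (by omega), map_zero]
  · have : p (f a) = 0 := (hker _).2 (by simpa using mem_initIdeal_of_lt (f := f) ha 1)
    rw [hN, this, zero_smul]
  · rw [← coef_eq_zero_iff_mem hker, ← bc_coef, hD] at hx
    obtain ⟨y', hy'⟩ := h.exact hx hεx
    obtain ⟨y, rfl⟩ := coef_surjective hp y'
    refine ⟨y, ?_⟩
    rw [← coef_eq_zero_iff_mem hker, map_sub, ← bc_coef, hD, hy', sub_self]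

variable {R : Type u} [CommRing R] [IsLocalRing R] [IsLocalRing R'] [Algebra R R']
  [IsLocalHom (algebraMap R R')] {d : Module.End R (ι →₀ R)}

lemma bc_residue_baseChange (φ : Module.End R (ι →₀ R)) :
    bc (IsLocalRing.residue R') (bc (algebraMap R R') φ) =
      bc (algebraMap (IsLocalRing.ResidueField R) (IsLocalRing.ResidueField R'))
        (bc (IsLocalRing.residue R) φ) := by
  rw [bc_bc, bc_bc]
  rfl

lemma bc_residue_eq_zero (hmin : ∀ x i, d x i ∈ IsLocalRing.maximalIdeal R) :
    bc (IsLocalRing.residue R) d = 0 :=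
  end_ext fun i => Finsupp.ext fun l => by
    rw [bc_single, coef_apply]
    exact (IsLocalRing.residue_eq_zero_iff _).2 (hmin _ _)

/-- For a module whose base change to `R'` has finite projective dimension over `S`, the Betti
numbers grow polynomially and the minimal resolution has jointly injective central operators. -/
theorem ExactAug.exists_operators [Module.Flat R R'] (hp : Function.Surjective p)
    (hreg : RegSeq f c) (hker : ∀ x, p x = 0 ↔ x ∈ initIdeal f c)
    {M : Type u} [AddCommGroup M] [Module R M] {s : (ι →₀ R) →ₗ[R] M} (h : ExactAug deg d s)
    (hmin : ∀ x i, d x i ∈ IsLocalRing.maximalIdeal R) (hdeg : ∀ j, Finite {i // deg i = j})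
    [Module S (TensorProduct R R' M)] (hN : ∀ (r : S) (n : TensorProduct R R' M), r • n = p r • n)
    {n : ℕ} (hpd : PdLT S (TensorProduct R R' M) n) :
    GrowthLE (c + 1) (fun j => Nat.card {i // deg i = j}) ∧
    ∃ (m : Type) (_ : Fintype m) (z : m → Module.End (IsLocalRing.ResidueField R)
        (ι →₀ IsLocalRing.ResidueField R)),
      (∀ i, z i ∈ centralOps deg d 2) ∧ JointlyInjective (gp deg) z := by
  have h' := h.baseChange R'
  obtain ⟨D, t, ε, hD, hL⟩ := h'.exists_liftedComplex hp hker hN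
  let π : S →+* IsLocalRing.ResidueField R' := (IsLocalRing.residue R').comp p
  have hπ : Function.Surjective π := IsLocalRing.residue_surjective.comp hp
  have hpf : ∀ a < c, p (f a) = 0 := fun a ha =>
    (hker _).2 (by simpa using mem_initIdeal_of_lt (f := f) ha 1)
  have hπf : ∀ a < c, π (f a) = 0 := fun a ha => by
    rw [RingHom.comp_apply, hpf a ha, map_zero]
  have hd0 : bc (IsLocalRing.residue R') (bc (algebraMap R R') d) = 0 := by
    rw [bc_residue_baseChange, bc_residue_eq_zero hmin, map_zero]
  have hD0 : bc π D = 0 := by rw [← bc_bc, hD, hd0]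
  obtain ⟨⟨N₀, hN₀⟩, A, hA⟩ := hL.exists_bound hπ (hpd.mono (Nat.le_succ n)) hreg hπf hdeg
  refine ⟨?_, ?_⟩
  · refine GrowthLE.succ_of_eventually_le (C := A) (N := 0) fun j _ => le_trans ?_ (hA j)
    have := fun j => finite_piece_gp (S := IsLocalRing.ResidueField R') hdeg j
    rw [← finrank_piece_gp (k := IsLocalRing.ResidueField R') deg j]
    exact finrank_piece_le_hgr _ _ (fun x => by rw [hD0]; rfl) j
  have hcomm : ∀ a < c, ∀ x, bc (algebraMap R R') d (bc p (t a) x) =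
      bc p (t a) (bc (algebraMap R R') d x) := fun a ha x => by
    rw [← hD]
    exact LinearMap.congr_fun (hreg.bc_differential_comm hL.dd hpf ha) x
  have key : ∀ a : Fin c, ∃ (n : ℕ) (b : Fin n → IsLocalRing.ResidueField R')
      (z : Fin n → Module.End (IsLocalRing.ResidueField R) (ι →₀ IsLocalRing.ResidueField R)),
      LinearIndependent (IsLocalRing.ResidueField R) b ∧ (∀ i, z i ∈ chainOps deg d 2) ∧
      ∀ x, bc π (t a) x = ∑ i, b i • bc (algebraMap (IsLocalRing.ResidueField R)
        (IsLocalRing.ResidueField R')) (z i) x := fun a => by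
    obtain ⟨α, _, r, ψ, X, hψ, hdψ, ht⟩ := h.exists_descent hdeg
      ((hL.t_low a a.2).bc p) (hcomm a a.2)
    obtain ⟨n, b, e, hb, hr⟩ := exists_linearIndependent_combination
      (k := IsLocalRing.ResidueField R) (fun l => IsLocalRing.residue R' (r l))
    refine ⟨n, b, fun i => ∑ l, e l i • bc (IsLocalRing.residue R) (ψ l), hb, fun i =>
      sum_mem_chainOps _ fun l _ => smul_mem_chainOps _ ⟨ψ l, hψ l, hdψ l, rfl⟩, fun x => ?_⟩
    have ht' : bc p (t a) = ∑ l, r l • bc (algebraMap R R') (ψ l) +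
        (bc (algebraMap R R') d * X + X * bc (algebraMap R R') d) := by
      refine LinearMap.ext fun x => ?_
      rw [ht, LinearMap.add_apply, LinearMap.sum_apply]
      rfl
    -- The homotopy terms vanish: by minimality the differential is zero over the residue field.
    have ht2 : bc π (t a) = ∑ l, (IsLocalRing.residue R' (r l)) • bc (algebraMap
        (IsLocalRing.ResidueField R) (IsLocalRing.ResidueField R'))
          (bc (IsLocalRing.residue R) (ψ l)) := by
      rw [← bc_bc, ht', map_add, map_add, map_mul, map_mul, hd0, zero_mul, mul_zero, add_zero,
        add_zero, map_sum]
      exact Finset.sum_congr rfl fun l _ => by rw [bc_smul, bc_residue_baseChange]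
    rw [ht2, LinearMap.sum_apply]
    simp only [map_sum, bc_smul, LinearMap.sum_apply, LinearMap.smul_apply, Finset.smul_sum]
    rw [Finset.sum_comm]
    refine Finset.sum_congr rfl fun l _ => ?_
    rw [hr, Finset.sum_smul]
    refine Finset.sum_congr rfl fun i _ => ?_
    rw [Algebra.smul_def, mul_comm, mul_smul]
  choose n b z hb hz hzt using key
  refine ⟨Σ a : Fin c, Fin (n a), inferInstance, fun i => z i.1 i.2, fun ⟨a, i⟩ =>
    ⟨hz a i, fun m χ hχ x => ?_⟩, N₀, fun j hj x hx => ?_⟩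
  · obtain ⟨ψ, hψ, hdψ, rfl⟩ := hχ
    -- A chain map over `R` lifts to `S` and commutes with `D` modulo the ideal. Hence its reduction
    -- commutes with that of `t a` up to homotopy, and the homotopy terms vanish.
    obtain ⟨Ψ, hΨ, -⟩ := exists_bc_eq (deg := deg) hp (bc (algebraMap R R') ψ)
    obtain ⟨g, hg⟩ := hreg.bc_commutator (π := π) hL.dd hπf (φ := Ψ) (fun x => by
      rw [← coef_eq_zero_iff_mem hker, map_sub, ← bc_coef, ← bc_coef, ← bc_coef, ← bc_coef, hΨ, hD,
        ← Module.End.mul_apply, ← Module.End.mul_apply, ← map_mul, ← map_mul,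
        show d * ψ = ψ * d from LinearMap.ext hdψ, sub_self])
    have hg := hg a a.2
    rw [hD0, zero_mul, mul_zero, add_zero, add_zero] at hg
    have hΨ' : bc π Ψ = bc (algebraMap (IsLocalRing.ResidueField R)
        (IsLocalRing.ResidueField R')) (bc (IsLocalRing.residue R) ψ) := by
      rw [← bc_bc, hΨ, bc_residue_baseChange]
    let y : Fin (n a) → Module.End (IsLocalRing.ResidueField R)
        (ι →₀ IsLocalRing.ResidueField R) := fun i =>
      z a i * bc (IsLocalRing.residue R) ψ +
        (-1 : IsLocalRing.ResidueField R) • (bc (IsLocalRing.residue R) ψ * z a i)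
    -- Linear independence of `b a` splits commutation with `t a` into commutation with each `z a
    -- i`.
    have hy := eq_zero_of_sum_smul_bc_eq_zero (hb a) (y := y) (fun x => by
      have h1 := LinearMap.congr_fun hg x
      rw [hΨ', Module.End.mul_apply, Module.End.mul_apply, hzt, hzt, map_sum] at h1
      simp only [y, map_add, map_mul, bc_smul, map_neg, map_one, LinearMap.add_apply,
        LinearMap.smul_apply, Module.End.mul_apply, smul_add, Finset.sum_add_distrib, h1,
        neg_smul, one_smul, smul_neg, Finset.sum_neg_distrib, map_smul]
      exact add_neg_cancel _) i
    have := LinearMap.congr_fun hy x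
    simp only [y, LinearMap.add_apply, LinearMap.smul_apply, Module.End.mul_apply, neg_smul,
      one_smul, LinearMap.zero_apply] at this
    exact eq_of_sub_eq_zero ((sub_eq_add_neg _ _).trans this)
  -- If all `z a i` kill a vector, all `t a` kill its image over the larger field. That image is
  -- then a boundary, hence zero since the differential vanishes.
  · have h1 := hN₀ j hj (coef (algebraMap (IsLocalRing.ResidueField R)
        (IsLocalRing.ResidueField R')) x) (by rw [hD0]; rfl) (fun a ha => ⟨0, by
          rw [hzt ⟨a, ha⟩, map_zero]
          refine (Finset.sum_eq_zero fun i _ => ?_).symm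
          rw [← coef_gp, bc_coef, hx ⟨⟨a, ha⟩, i⟩, map_zero, smul_zero]⟩)
    obtain ⟨y, hy⟩ := h1
    rw [hD0, ← coef_gp] at hy
    ext i
    have := DFunLike.congr_fun hy i
    rw [coef_apply] at this
    exact (algebraMap (IsLocalRing.ResidueField R) (IsLocalRing.ResidueField R')).injective
      (this.symm.trans (map_zero _).symm)

end Operators

/-! ### Slower growth of the kernel of a surjective operator -/

section Growth

/-- Over a period `n * n'` the sequence `b` increases by at least `w j`, so `t * w j ≤ b (j + t * (n
* n'))`. Taking `t = j` gives the bound. -/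
lemma GrowthLE.of_periodic_differences {s n n' N : ℕ} {b w : ℕ → ℕ} (hn' : 1 ≤ n')
    (hb : ∀ j, N ≤ j → b (j + n) = b j + w j) (hw : ∀ j, N ≤ j → w j ≤ w (j + n'))
    (h : GrowthLE (s + 1) b) : GrowthLE s w := by
  obtain ⟨A, hA⟩ := h.le_pow_pred
  have hwk : ∀ j, N ≤ j → ∀ k, w j ≤ w (j + k * n') := fun j hj k => by
    induction k with
    | zero => simp
    | succ k ih =>
      refine ih.trans ((hw _ (by omega)).trans (le_of_eq ?_))
      congr 1
      ring
  have hbk : ∀ j, N ≤ j → ∀ k, b j ≤ b (j + k * n) := fun j hj k => by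
    induction k with
    | zero => simp
    | succ k ih =>
      refine ih.trans (((Nat.le_add_right _ _).trans (hb _ (by omega)).ge).trans (le_of_eq ?_))
      congr 1
      ring
  have hbL : ∀ j, N ≤ j → ∀ t, t * w j ≤ b (j + t * (n * n')) := fun j hj t => by
    induction t with
    | zero => simp
    | succ t ih =>
      have h1 := hwk j hj (t * n)
      have h2 := hb (j + t * (n * n')) (by omega)
      have h3 := hbk (j + t * (n * n') + n) (by omega) (n' - 1)
      have e1 : j + t * n * n' = j + t * (n * n') := by ring
      have e2 : j + t * (n * n') + n + (n' - 1) * n = j + (t + 1) * (n * n') := by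
        obtain ⟨q, rfl⟩ := Nat.exists_eq_add_of_le hn'
        rw [Nat.add_sub_cancel_left]
        ring
      rw [e1] at h1
      rw [e2] at h3
      rw [add_mul, one_mul]
      omega
  refine GrowthLE.of_eventually (A := A * (1 + n * n') ^ s) (N := N + 1) fun j hj => ?_
  calc j * w j ≤ b (j + j * (n * n')) := hbL j (by omega) j
    _ ≤ A * (j + j * (n * n')) ^ s := hA _ (by omega)
    _ = A * (1 + n * n') ^ s * j ^ s := by rw [mul_assoc, ← mul_pow]; congr 2; ring
    _ ≤ A * (1 + n * n') ^ s * (j + 1) ^ s :=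
        Nat.mul_le_mul_left _ (Nat.pow_le_pow_left (Nat.le_succ j) s)

variable {k : Type*} [Field k] {E : Type*} [AddCommGroup E] [Module k E]
  {p : ℕ → Module.End k E} {m : Type*} {z : m → Module.End k E}

lemma Lowers.gp_mem_ker (hp : IsGrading p) {n : ℕ} {f : Module.End k E} (hf : Lowers p n f)
    (j : ℕ) {x : E} (hx : f x = 0) : f (p j x) = 0 := by
  by_cases hj : n ≤ j
  · obtain ⟨i, rfl⟩ := Nat.exists_eq_add_of_le' hj
    rw [← hf, hx, map_zero]
  · exact hf.apply_low hp (by omega) x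

/-- A refinement of `exists_eventually_surjective`: the dimensions of the graded pieces of the
kernel of the operator grow more slowly than those of the whole space. -/
theorem exists_surjective_of_growth [Fintype m] (hp : IsGrading p)
    [∀ j, Module.Finite k (piece p j)] (hz : ∀ i, Lowers p 2 (z i)) (hinj : JointlyInjective p z)
    (P : ℕ → Set (Module.End k E)) (hlow : ∀ n, ∀ f ∈ P n, Lowers p n f) (hone : 1 ∈ P 0)
    (hzero : 0 ∈ P 2) (hadd : ∀ n, ∀ f ∈ P n, ∀ g ∈ P n, f + g ∈ P n)
    (hmul : ∀ m n, ∀ f ∈ P m, ∀ g ∈ P n, f * g ∈ P (m + n)) (hzP : ∀ i, z i ∈ P 2)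
    (hcomm : ∀ m n, ∀ f ∈ P m, ∀ g ∈ P n, ∀ x, f (g x) = g (f x)) :
    ∃ n, 1 ≤ n ∧ ∃ f ∈ P n, ∃ N, (∀ j, N ≤ j → ∀ x, ∃ y, f (p (j + n) y) = p j x) ∧
      ∀ s, GrowthLE (s + 1) (fun j => Module.finrank k (piece p j)) →
        GrowthLE s fun j =>
          Module.finrank k (piece p (j + n)) - Module.finrank k (piece p j) := by
  obtain ⟨n, hn, f, hfP, N, hN⟩ := exists_eventually_surjective hp hz
    (fun i j => LinearMap.ext (hcomm 2 2 _ (hzP i) _ (hzP j))) hinj P hlow hone hzero hadd hmul hzP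
  let W := LinearMap.ker f
  let q : ℕ → Module.End k W := fun j =>
    (p j).restrict (p := W) (q := W) fun x hx => (hlow n f hfP).gp_mem_ker hp j hx
  have hq : IsGrading q :=
    { apply_same := fun j x => Subtype.ext (hp.apply_same j x)
      apply_ne := fun i j hij x => Subtype.ext (hp.apply_ne i j hij x)
      eventually_zero := fun x => by
        obtain ⟨M, hM⟩ := hp.eventually_zero (x : E)
        exact ⟨M, fun j hj => Subtype.ext (hM j hj)⟩
      ext_zero := fun x hx =>
        Subtype.ext (hp.ext_zero x fun j => congrArg Subtype.val (hx j)) }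
  have hmap : ∀ j, ∀ x ∈ piece q j, (x : E) ∈ piece p j := fun j x hx => by
    rw [hp.mem_piece]
    exact congrArg Subtype.val (hq.mem_piece.1 hx)
  have hfin : ∀ j, Module.Finite k (piece q j) := fun j =>
    Module.Finite.of_injective (W.subtype.restrict (p := piece q j) (q := piece p j) (hmap j))
      fun x y hxy => Subtype.ext (Subtype.ext (congrArg (fun v => (v.1 : E)) hxy))
  -- The operators act on `ker f` because they commute with `f`, and remain jointly injective there.
  let ζ : m → Module.End k W := fun i => (z i).restrict (p := W) (q := W) fun x hx => by
    rw [LinearMap.mem_ker, hcomm n 2 f hfP _ (hzP i), LinearMap.mem_ker.1 hx, map_zero]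
  have hζ : ∀ i, Lowers q 2 (ζ i) := fun i j x => Subtype.ext (hz i j x)
  let P' : ℕ → Set (Module.End k W) := fun j => {g | ∃ φ ∈ P j, ∀ x : W, (g x : E) = φ x}
  -- Surjectivity on `ker f` of a second operator makes the dimensions of its pieces nondecreasing
  -- along steps of `n'` in high degrees, as `GrowthLE.of_periodic_differences` requires.
  obtain ⟨n', hn', g, ⟨φ, hφ, hgφ⟩, N', hN'⟩ := exists_eventually_surjective (z := ζ) hq hζ
    (fun i j => LinearMap.ext fun x => Subtype.ext (hcomm 2 2 _ (hzP i) _ (hzP j) x))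
    (by
      obtain ⟨M, hM⟩ := hinj
      exact ⟨M, fun j hj x hx => Subtype.ext (hM j hj x fun i => congrArg Subtype.val (hx i))⟩)
    P'
    (fun j g => by
      rintro ⟨φ, hφ, hgφ⟩ i x
      refine Subtype.ext ?_
      rw [hgφ]
      exact (congrArg (p i) (hgφ x)).trans (hlow j φ hφ i x))
    ⟨1, hone, fun x => rfl⟩ ⟨0, hzero, fun x => rfl⟩
    (fun j => by
      rintro _ ⟨φ, hφ, h1⟩ _ ⟨χ, hχ, h2⟩
      exact ⟨φ + χ, hadd j φ hφ χ hχ, fun x => congrArg₂ (· + ·) (h1 x) (h2 x)⟩)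
    (fun i j => by
      rintro g ⟨φ, hφ, h1⟩ g' ⟨χ, hχ, h2⟩
      exact ⟨φ * χ, hmul i j φ hφ χ hχ, fun x => (h1 _).trans (congrArg φ (h2 x))⟩)
    fun i => ⟨z i, hzP i, fun x => rfl⟩
  have hb : ∀ j, N ≤ j → Module.finrank k (piece p (j + n)) =
      Module.finrank k (piece p j) + Module.finrank k (piece q (j + n)) := fun j hj => by
    let F : piece p (j + n) →ₗ[k] piece p j :=
      f.restrict fun x hx => (hlow n f hfP).map_piece hx
    have hF : Function.Surjective F := by
      rintro ⟨_, x, rfl⟩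
      obtain ⟨y, hy⟩ := hN j hj x
      exact ⟨⟨p (j + n) y, y, rfl⟩, Subtype.ext hy⟩
    rw [← F.finrank_range_add_finrank_ker, LinearMap.range_eq_top.2 hF, finrank_top]
    congr 1
    refine (LinearEquiv.ofBijective (LinearMap.codRestrict (LinearMap.ker F)
      (W.subtype.restrict (p := piece q (j + n)) (q := piece p (j + n)) (hmap _))
      fun x => Subtype.ext x.1.2) ⟨fun x y hxy => ?_, fun x => ?_⟩).finrank_eq.symm
    · exact Subtype.ext (Subtype.ext (congrArg (fun v => (v.1.1 : E)) hxy))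
    · have hx : f x.1.1 = 0 := congrArg Subtype.val x.2
      exact ⟨⟨⟨x.1.1, hx⟩, hq.mem_piece.2 (Subtype.ext (hp.mem_piece.1 x.1.2))⟩, rfl⟩
  refine ⟨n, hn, f, hfP, N, hN, fun s hs => ?_⟩
  refine GrowthLE.of_periodic_differences (n := n) (n' := n') (N := N + N') hn'
    (fun j hj => ?_) (fun j hj => ?_) hs
  · have := hb j (by omega)
    omega
  · have e1 := hb j (by omega)
    have e2 := hb (j + n') (by omega)
    have hle : Module.finrank k (piece q (j + n)) ≤ Module.finrank k (piece q (j + n' + n)) := by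
      have hg : Lowers q n' g := fun i x => by
        refine Subtype.ext ?_
        rw [hgφ]
        exact (congrArg (p i) (hgφ x)).trans (hlow n' φ hφ i x)
      let G : piece q (j + n + n') →ₗ[k] piece q (j + n) := g.restrict fun x hx => hg.map_piece hx
      have hG : Function.Surjective G := by
        rintro ⟨_, x, rfl⟩
        obtain ⟨y, hy⟩ := hN' (j + n) (by omega) x
        exact ⟨⟨q (j + n + n') y, y, rfl⟩, Subtype.ext hy⟩
      rw [show j + n' + n = j + n + n' by omega]
      exact LinearMap.finrank_le_finrank_of_surjective hG
    omega

end Growth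

/-! ### The mapping cone of a chain map of negative degree -/

section Cone

variable {R : Type u} [CommRing R]

lemma hasShortExact_of_submodule {V C : Type u} [AddCommGroup V] [Module R V] [AddCommGroup C]
    [Module R C] {B F : Submodule R V} (hBF : B ≤ F) (g : F →ₗ[R] C) (hg : Function.Surjective g)
    (hker : ∀ x : F, g x = 0 ↔ (x : V) ∈ B) : HasShortExact (R := R) B F C :=
  ⟨Submodule.inclusion hBF, g, Submodule.inclusion_injective hBF, fun x => by
    rw [hker]
    exact ⟨fun hx => ⟨⟨x, hx⟩, rfl⟩, fun ⟨y, hy⟩ => hy ▸ y.2⟩, hg⟩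

lemma hasShortExact_map {V W : Type u} [AddCommGroup V] [Module R V] [AddCommGroup W]
    [Module R W] {B F : Submodule R V} (hBF : B ≤ F) (g : V →ₗ[R] W)
    (hker : ∀ x ∈ F, g x = 0 ↔ x ∈ B) : HasShortExact (R := R) B F (F.map g) :=
  hasShortExact_of_submodule hBF (g.submoduleMap F) (g.submoduleMap_surjective F) fun x =>
    (Subtype.ext_iff.trans Iff.rfl).trans (hker x x.2)

/-- Here `A` is the image of the first factor and `C` the quotient by it; `h1` gives injectivity and
`h3` exactness in the middle. -/
lemma hasShortExact_prod_quotient {T A C : Type u} [AddCommGroup T] [Module R T] [AddCommGroup A]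
    [Module R A] [AddCommGroup C] [Module R C] {a : T →ₗ[R] A} {b : T →ₗ[R] C}
    (ha : Function.Surjective a) (hb : Function.Surjective b) {U : Submodule R (T × T)}
    (h1 : ∀ x, (x, 0) ∈ U ↔ a x = 0) (h2 : ∀ v ∈ U, b v.2 = 0)
    (h3 : ∀ y, b y = 0 → ∃ x, (x, y) ∈ U) : HasShortExact (R := R) A ((T × T) ⧸ U) C := by
  let f : A →ₗ[R] (T × T) ⧸ U := ((LinearMap.ker a).liftQ (U.mkQ ∘ₗ LinearMap.inl R T T)
    fun x hx => (Submodule.Quotient.mk_eq_zero U).2 ((h1 x).2 hx)) ∘ₗ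
      (a.quotKerEquivOfSurjective ha).symm.toLinearMap
  have hf : ∀ x, f (a x) = U.mkQ (x, 0) := fun x => by
    have : (a.quotKerEquivOfSurjective ha).symm (a x) = (LinearMap.ker a).mkQ x := by
      rw [LinearEquiv.symm_apply_eq]
      rfl
    rw [LinearMap.comp_apply, LinearEquiv.coe_coe, this]
    rfl
  let g : (T × T) ⧸ U →ₗ[R] C := U.liftQ (b ∘ₗ LinearMap.snd R T T) fun v hv => h2 v hv
  have hg : ∀ v, g (U.mkQ v) = b v.2 := fun v => rfl
  refine ⟨f, g, (injective_iff_map_eq_zero f).2 fun y hy => ?_, fun y => ⟨fun hy => ?_, ?_⟩,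
    fun y => ?_⟩
  · obtain ⟨x, rfl⟩ := ha y
    rw [hf] at hy
    exact (h1 x).1 ((Submodule.Quotient.mk_eq_zero U).1 hy)
  · obtain ⟨⟨v, w⟩, rfl⟩ := U.mkQ_surjective y
    obtain ⟨x, hx⟩ := h3 w hy
    refine ⟨a (v - x), ?_⟩
    rw [hf]
    refine ((Submodule.Quotient.eq U).2 ?_)
    have : (v - x, (0 : T)) - (v, w) = -(x, w) := by simp
    rw [this]
    exact U.neg_mem hx
  · rintro ⟨z, rfl⟩
    obtain ⟨x, rfl⟩ := ha z
    rw [hf, hg, map_zero]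
  · obtain ⟨x, rfl⟩ := hb y
    exact ⟨U.mkQ (0, x), hg _⟩

variable {ι : Type u}

/-- The differential of the mapping cone of `φ`. -/
noncomputable def coneDiff (d φ : Module.End R (ι →₀ R)) :
    Module.End R ((ι →₀ R) × (ι →₀ R)) :=
  (d.coprod φ).prod (-d ∘ₗ LinearMap.snd R _ _)

/-- The grading of the mapping cone of a chain map of degree `-(e + 1)`. -/
noncomputable def coneGr (deg : ι → ℕ) (e j : ℕ) : Module.End R ((ι →₀ R) × (ι →₀ R)) :=
  (gp deg j).prodMap (gp deg (j + e))

/-- The boundaries of degree `j` in the mapping cone. -/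
noncomputable def coneBound (deg : ι → ℕ) (e : ℕ) (d φ : Module.End R (ι →₀ R)) (j : ℕ) :
    Submodule R ((ι →₀ R) × (ι →₀ R)) :=
  (piece (coneGr deg e) (j + 1)).map (coneDiff d φ)

variable {deg : ι → ℕ} {e : ℕ} {d φ : Module.End R (ι →₀ R)}

lemma coneDiff_apply (v : (ι →₀ R) × (ι →₀ R)) : coneDiff d φ v = (d v.1 + φ v.2, -d v.2) := rfl

lemma coneGr_apply (j : ℕ) (v : (ι →₀ R) × (ι →₀ R)) :
    coneGr deg e j v = (gp deg j v.1, gp deg (j + e) v.2) := rfl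

lemma isIdempotent_coneGr (j : ℕ) (v : (ι →₀ R) × (ι →₀ R)) :
    coneGr deg e j (coneGr deg e j v) = coneGr deg e j v := by
  simp only [coneGr_apply, (isGrading_gp deg).apply_same]

lemma mem_piece_coneGr {j : ℕ} {v : (ι →₀ R) × (ι →₀ R)} :
    v ∈ piece (coneGr deg e) j ↔ coneGr deg e j v = v :=
  ⟨fun ⟨w, hw⟩ => hw ▸ isIdempotent_coneGr j w, fun h => ⟨v, h⟩⟩

lemma projective_piece_coneGr (j : ℕ) :
    Module.Projective R (piece (coneGr (R := R) deg e) j) :=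
  Module.Projective.of_split (piece (coneGr (R := R) deg e) j).subtype
    (coneGr (R := R) deg e j).rangeRestrict (LinearMap.ext fun x => Subtype.ext (mem_piece_coneGr.1 x.2))

lemma coneGr_coneDiff (hd : Lowers (gp deg) 1 d) (hφ : Lowers (gp deg) (e + 1) φ) (j : ℕ)
    (v : (ι →₀ R) × (ι →₀ R)) :
    coneGr deg e j (coneDiff d φ v) = coneDiff d φ (coneGr deg e (j + 1) v) := by
  simp only [coneGr_apply, coneDiff_apply, map_add, map_neg, hd j, hd (j + e), hφ j]
  rw [show j + (e + 1) = j + 1 + e by omega, show j + e + 1 = j + 1 + e by omega]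

lemma coneBound_le (hd : Lowers (gp deg) 1 d) (hφ : Lowers (gp deg) (e + 1) φ) (j : ℕ) :
    coneBound deg e d φ j ≤ piece (coneGr deg e) j := by
  rintro _ ⟨_, ⟨v, rfl⟩, rfl⟩
  exact ⟨coneDiff d φ v, coneGr_coneDiff hd hφ j v⟩

lemma coneDiff_coneDiff (hdd : ∀ x, d (d x) = 0) (hφd : ∀ x, d (φ x) = φ (d x))
    (v : (ι →₀ R) × (ι →₀ R)) : coneDiff d φ (coneDiff d φ v) = 0 := by
  simp only [coneDiff_apply, map_add, map_neg, hdd, hφd]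
  simp

variable {N : Type u} [AddCommGroup N] [Module R N] {s : (ι →₀ R) →ₗ[R] N}

lemma ExactAug.exists_gp (h : ExactAug deg d s) {j : ℕ} {x : ι →₀ R} (hx : gp deg (j + 1) x = x)
    (hdx : d x = 0) : ∃ y, gp deg (j + 2) y = y ∧ d y = x := by
  obtain ⟨y, hy⟩ := h.exact_succ j x (by rw [hx, hdx])
  exact ⟨gp deg (j + 2) y, (isGrading_gp deg).apply_same _ _, by
    rw [← h.d_low, hy, (isGrading_gp deg).apply_same, hx]⟩

/-- The cone is exact in positive degrees, since both of its constituents are; it therefore resolves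
its zeroth homology. -/
lemma ExactAug.mem_coneBound_iff (h : ExactAug deg d s) (hφ : Lowers (gp deg) (e + 1) φ)
    (hφd : ∀ x, d (φ x) = φ (d x)) {j : ℕ} {v : (ι →₀ R) × (ι →₀ R)}
    (hv : v ∈ piece (coneGr deg e) (j + 1)) :
    coneDiff d φ v = 0 ↔ v ∈ coneBound deg e d φ (j + 1) := by
  constructor
  · intro h0
    have hv' := mem_piece_coneGr.1 hv
    obtain ⟨x, y⟩ := v
    rw [coneGr_apply, Prod.mk.injEq] at hv'
    rw [coneDiff_apply, Prod.mk_eq_zero, neg_eq_zero] at h0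
    obtain ⟨hx, hy⟩ := hv'
    obtain ⟨h1, h2⟩ := h0
    obtain ⟨y', hy', rfl⟩ := h.exists_gp (j := j + e)
      (by rw [show j + e + 1 = j + 1 + e by omega]; exact hy) h2
    obtain ⟨x', hx', hx''⟩ := h.exists_gp (j := j) (x := x + φ y') (by
      rw [map_add, hφ, show j + 1 + (e + 1) = j + e + 2 by omega, hy']
      exact congrArg (· + φ y') hx) (by rw [map_add, hφd]; exact h1)
    refine ⟨(x', -y'), mem_piece_coneGr.2 ?_, ?_⟩
    · rw [coneGr_apply, Prod.mk.injEq, map_neg, show j + 1 + 1 + e = j + e + 2 by omega, hy']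
      exact ⟨hx', rfl⟩
    · rw [coneDiff_apply, hx'', map_neg, map_neg, neg_neg, add_neg_cancel_right]
  · rintro ⟨w, _, rfl⟩
    exact coneDiff_coneDiff h.d_d hφd w

/-- The zeroth homology of the mapping cone. -/
abbrev coneHomology (deg : ι → ℕ) (e : ℕ) (d φ : Module.End R (ι →₀ R)) : Type u :=
  ((ι →₀ R) × (ι →₀ R)) ⧸ (LinearMap.range (coneDiff d φ)).comap (coneGr deg e 0)

lemma ExactAug.hasShortExact_coneBound_zero (h : ExactAug deg d s)
    (hφ : Lowers (gp deg) (e + 1) φ) :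
    HasShortExact (R := R) (coneBound deg e d φ 0) (piece (coneGr (R := R) deg e) 0)
      (coneHomology deg e d φ) := by
  let U := (LinearMap.range (coneDiff d φ)).comap (coneGr deg e 0)
  refine hasShortExact_of_submodule (coneBound_le h.d_low hφ 0)
    (U.mkQ ∘ₗ (piece (coneGr (R := R) deg e) 0).subtype) (fun y => ?_) fun v => ?_
  · obtain ⟨v, rfl⟩ := U.mkQ_surjective y
    refine ⟨⟨coneGr deg e 0 v, v, rfl⟩, (Submodule.Quotient.eq U).2 ?_⟩
    change coneGr deg e 0 (coneGr deg e 0 v - v) ∈ LinearMap.range (coneDiff d φ)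
    rw [map_sub, isIdempotent_coneGr, sub_self]
    exact Submodule.zero_mem _
  · have h1 : (U.mkQ ∘ₗ (piece (coneGr (R := R) deg e) 0).subtype) v = 0 ↔ coneGr deg e 0 (v : _) ∈
        LinearMap.range (coneDiff d φ) := Submodule.Quotient.mk_eq_zero U
    rw [h1, mem_piece_coneGr.1 v.2]
    constructor
    · rintro ⟨w, hw⟩
      refine ⟨coneGr deg e 1 w, ⟨w, rfl⟩, ?_⟩
      rw [← coneGr_coneDiff h.d_low hφ, hw, mem_piece_coneGr.1 v.2]
    · rintro ⟨w, -, hw⟩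
      exact ⟨w, hw⟩

variable [IsLocalRing R]

/-- Dimension shifting along the cone: the boundaries of degree `j` are a `(j + 1)`-st syzygy of its
zeroth homology, in a resolution that need not be minimal. -/
lemma ExactAug.extLen_coneHomology (h : ExactAug deg d s) (hφ : Lowers (gp deg) (e + 1) φ)
    (hφd : ∀ x, d (φ x) = φ (d x)) (j : ℕ) :
    extLen R (coneHomology deg e d φ) (j + 2) = extLen R (coneBound deg e d φ j) 1 := by
  have hproj := projective_piece_coneGr (R := R) (deg := deg) (e := e)
  have key : ∀ j i, extLen R (coneBound deg e d φ 0) (i + j + 1) =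
      extLen R (coneBound deg e d φ j) (i + 1) := fun j => by
    induction j with
    | zero => exact fun i => rfl
    | succ j ih =>
      intro i
      have hs : HasShortExact (R := R) (coneBound deg e d φ (j + 1))
          (piece (coneGr (R := R) deg e) (j + 1)) (coneBound deg e d φ j) :=
        hasShortExact_map (coneBound_le h.d_low hφ (j + 1)) _ fun v hv =>
          h.mem_coneBound_iff hφ hφd hv
      rw [← hs.extLen_add_two, ← ih (i + 1)]
      congr 1
      omega
  rw [(h.hasShortExact_coneBound_zero hφ).extLen_add_two, ← key j 0, zero_add]

/-- Where `φ` is surjective the cone can be replaced by `ker φ`. With `Z` the part of `ker φ` in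
degree `j + e + 2`, the boundaries are a quotient of a free module by `d Z`, so their `Ext^1` is
bounded by `Hom(Z, k)`, whose length is the difference of two ranks. -/
lemma ExactAug.extLen_coneBound_le (h : ExactAug deg d s) (hφ : Lowers (gp deg) (e + 1) φ)
    (hφd : ∀ x, d (φ x) = φ (d x)) {j : ℕ}
    (hsurj : ∀ i, j ≤ i → ∀ x, ∃ y, φ (gp deg (i + (e + 1)) y) = gp deg i x) :
    extLen R (coneBound deg e d φ j) 1 + extLen R (piece (gp (S := R) deg) (j + 1)) 0 ≤
      extLen R (piece (gp (S := R) deg) (j + 1 + (e + 1))) 0 := by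
  have hg := isGrading_gp (S := R) deg
  have hproj := projective_piece (S := R) deg
  have hsurj' : ∀ i, j ≤ i → ∀ x, gp deg i x = x →
      ∃ y, gp deg (i + (e + 1)) y = y ∧ φ y = x := fun i hi x hx => by
    obtain ⟨y, hy⟩ := hsurj i hi x
    exact ⟨_, hg.apply_same _ y, hy.trans hx⟩
  have hmap : (piece (gp (S := R) deg) (j + 1 + (e + 1))).map φ = piece (gp deg) (j + 1) := by
    ext x
    constructor
    · rintro ⟨y, hy, rfl⟩
      exact hφ.map_piece hy
    · intro hx
      obtain ⟨y, hy, rfl⟩ := hsurj' (j + 1) (by omega) x (hg.mem_piece.1 hx)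
      exact ⟨y, hg.mem_piece.2 hy, rfl⟩
  have hs1 : HasShortExact (R := R)
      (piece (gp (S := R) deg) (j + 1 + (e + 1)) ⊓ LinearMap.ker φ : Submodule R (ι →₀ R))
      (piece (gp (S := R) deg) (j + 1 + (e + 1))) (piece (gp (S := R) deg) (j + 1)) := by
    rw [← hmap]
    exact hasShortExact_map inf_le_left φ fun x hx => ⟨fun h0 => ⟨hx, h0⟩, fun h0 => h0.2⟩
  let Z : Submodule R (ι →₀ R) := piece (gp (S := R) deg) (j + 1 + (e + 1)) ⊓ LinearMap.ker φ
  -- Surjectivity makes the first coordinate superfluous: writing `x = φ w`, the vectors `(x, y)`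
  -- and `(0, y + d w)` have the same boundary.
  have hmap2 : (piece (gp (S := R) deg) (j + 1 + e)).map (coneDiff d φ ∘ₗ LinearMap.inr R _ _) =
      coneBound deg e d φ j := by
    ext v
    constructor
    · rintro ⟨y, hy, rfl⟩
      refine ⟨(0, y), mem_piece_coneGr.2 ?_, rfl⟩
      rw [coneGr_apply, map_zero]
      exact congrArg (Prod.mk 0) (hg.mem_piece.1 hy)
    · rintro ⟨⟨x, y⟩, hxy, rfl⟩
      have hxy := mem_piece_coneGr.1 hxy
      rw [coneGr_apply, Prod.mk.injEq] at hxy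
      obtain ⟨w, hw, hwx⟩ := hsurj' (j + 1) (by omega) x hxy.1
      refine ⟨y + d w, hg.mem_piece.2 ?_, ?_⟩
      · rw [map_add, h.d_low, show j + 1 + e + 1 = j + 1 + (e + 1) by omega, hw]
        exact congrArg (· + d w) hxy.2
      · change coneDiff d φ (0, y + d w) = _
        simp only [coneDiff_apply, map_add, map_zero, zero_add, h.d_d, add_zero, ← hwx, hφd]
        rw [add_comm]
  have hs2 : HasShortExact (R := R) (Z.map d) (piece (gp (S := R) deg) (j + 1 + e))
      (coneBound deg e d φ j) := by
    rw [← hmap2]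
    refine hasShortExact_map ?_ _ fun y hy => ?_
    · rintro _ ⟨x, hx, rfl⟩
      exact h.d_low.map_piece hx.1
    · have hD : (coneDiff d φ ∘ₗ LinearMap.inr R _ _) y = (φ y, -d y) := by
        change coneDiff d φ (0, y) = _
        rw [coneDiff_apply, map_zero, zero_add]
      rw [hD, Prod.mk_eq_zero, neg_eq_zero]
      constructor
      · rintro ⟨h1, h2⟩
        obtain ⟨w, hw, rfl⟩ := h.exists_gp (j := j + e)
          (by rw [show j + e + 1 = j + 1 + e by omega]; exact hg.mem_piece.1 hy) h2
        obtain ⟨v, hv, hv'⟩ := h.exists_gp (j := j) (x := φ w)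
          (by rw [hφ, show j + 1 + (e + 1) = j + e + 2 by omega, hw]) (by rw [hφd, h1])
        obtain ⟨u, hu, rfl⟩ := hsurj' (j + 2) (by omega) v hv
        -- Here `y = d w` and `φ w = d (φ u)`; subtracting `d u` moves `w` into `ker φ` without
        -- changing its boundary.
        refine ⟨w - d u, ⟨hg.mem_piece.2 ?_, ?_⟩, ?_⟩
        · rw [map_sub, h.d_low, show j + 1 + (e + 1) + 1 = j + 2 + (e + 1) by omega, hu,
            show j + 1 + (e + 1) = j + e + 2 by omega, hw]
        · change φ (w - d u) = 0
          rw [map_sub, ← hφd, hv', sub_self]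
        · rw [map_sub, h.d_d, sub_zero]
      · rintro ⟨w, hw, rfl⟩
        exact ⟨by rw [← hφd, LinearMap.mem_ker.1 hw.2, map_zero], h.d_d w⟩
  rw [hs1.extLen_zero_split]
  refine add_le_add ?_ le_rfl
  exact hs2.extLen_one_le.trans (extLen_zero_le (d.submoduleMap_surjective Z))

end Cone

/-! ### Reduction of the complexity by a mapping cone -/

section Reduction

variable {R : Type u} [CommRing R] [IsLocalRing R] {ι : Type u} {deg : ι → ℕ}

/-- Nakayama's lemma, applied to one finitely generated graded piece. -/
lemma surjective_of_residue (hdeg : ∀ j, Finite {i // deg i = j}) {φ : Module.End R (ι →₀ R)}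
    {m j : ℕ}
    (h : ∀ x, ∃ y, bc (IsLocalRing.residue R) φ (gp deg (j + m) y) = gp deg j x) (x : ι →₀ R)
    (hφ : Lowers (gp deg) m φ) : ∃ y, φ (gp deg (j + m) y) = gp deg j x := by
  have hle : piece (gp (S := R) deg) j ≤ (piece (gp (S := R) deg) (j + m)).map φ := by
    have hfin := Module.Finite.iff_fg.1 (finite_piece_gp (S := R) hdeg j)
    refine Submodule.le_of_le_smul_of_le_jacobson_bot hfin
      (IsLocalRing.maximalIdeal_le_jacobson ⊥) ?_
    rintro _ ⟨x, rfl⟩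
    obtain ⟨y', hy'⟩ := h (coef (IsLocalRing.residue R) x)
    obtain ⟨y, rfl⟩ := coef_surjective IsLocalRing.residue_surjective y'
    rw [← coef_gp, ← coef_gp, bc_coef] at hy'
    refine Submodule.mem_sup.2 ⟨φ (gp deg (j + m) y), ⟨_, ⟨y, rfl⟩, rfl⟩,
      gp deg j x - φ (gp deg (j + m) y), ?_, add_sub_cancel _ _⟩
    have hfix : gp deg j (gp deg j x - φ (gp deg (j + m) y)) =
        gp deg j x - φ (gp deg (j + m) y) := by
      rw [map_sub, hφ, (isGrading_gp deg).apply_same, (isGrading_gp deg).apply_same]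
    have := hdeg j
    cases nonempty_fintype {i // deg i = j}
    rw [← hfix, gp_eq_sum]
    refine Submodule.sum_mem _ fun i _ => Submodule.smul_mem_smul ?_
      ⟨Finsupp.single i.1 1, gp_single_of_eq i.2 1⟩
    rw [hfix, ← IsLocalRing.residue_eq_zero_iff, ← coef_apply, map_sub, hy', sub_self]
    rfl
  obtain ⟨_, ⟨y, rfl⟩, hy⟩ := hle ⟨x, rfl⟩
  exact ⟨y, hy⟩

lemma extLen_piece_gp (hdeg : ∀ j, Finite {i // deg i = j}) (j : ℕ) :
    extLen R (piece (gp (S := R) deg) j) 0 = Nat.card {i // deg i = j} := by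
  have := hdeg j
  rw [piece_gp_eq_supported, extLen_congr (Finsupp.supportedEquivFinsupp {i | deg i = j}),
    extLen_finsupp]
  exact ENat.card_eq_coe_natCard {i // deg i = j}

variable {M : ModuleCat.{u} R} {d : Module.End R (ι →₀ R)}
  {s : ∀ n, (ι →₀ R) →ₗ[R] syzygy n M}

/-- The low end of the long exact sequence of the cone: the first summand contributes `M`, the
shifted one `F_e / d F_{e+1} = Ω^e M`. -/
lemma MinimalResolution.hasShortExact_coneHomology (h : MinimalResolution M deg d s) {e : ℕ}
    {φ : Module.End R (ι →₀ R)} (hφ : Lowers (gp deg) (e + 1) φ)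
    (hφd : ∀ x, d (φ x) = φ (d x)) :
    HasShortExact (R := R) M (coneHomology deg e d φ) (syzygy e M) := by
  have hg := isGrading_gp (S := R) deg
  have hU : ∀ x y : ι →₀ R, (x, y) ∈ (LinearMap.range (coneDiff d φ)).comap (coneGr deg e 0) ↔
      ∃ v w, d v + φ w = gp deg 0 x ∧ -d w = gp deg e y := fun x y => by
    constructor
    · rintro ⟨⟨v, w⟩, hvw⟩
      have := Prod.mk.inj hvw
      rw [zero_add] at this
      exact ⟨v, w, this⟩
    · rintro ⟨v, w, h1, h2⟩
      refine ⟨(v, w), Prod.ext h1 (h2.trans ?_)⟩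
      rw [coneGr_apply, zero_add]
  refine hasShortExact_prod_quotient (h.s_surj 0) (h.s_surj e) (fun x => ?_) (fun v hv => ?_)
    fun y hy => ?_
  · rw [hU]
    constructor
    · rintro ⟨v, w, h1, h2⟩
      rw [map_zero, neg_eq_zero] at h2
      obtain ⟨u, hu⟩ := h.exactAug.exact_succ e w (by rw [← h.d_low, h2, map_zero])
      have h3 : gp deg 0 (φ w) = gp deg 0 (d (φ u)) := by
        rw [hφd, hu, hφ, zero_add, hφ, zero_add, hg.apply_same]
      have h4 := congrArg (s 0 ∘ gp deg 0) h1
      simp only [Function.comp_apply, map_add, h3, hg.apply_same, h.s_gp, h.s_d, add_zero] at h4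
      exact h4.symm
    · intro hx
      obtain ⟨v, hv⟩ := h.s_exact 0 x hx
      exact ⟨v, 0, by rw [map_zero, add_zero, hv], by rw [map_zero, map_zero, neg_zero]⟩
  · obtain ⟨x, w, -, hw⟩ := (hU v.1 v.2).1 hv
    rw [← h.s_gp, ← hw, map_neg, h.s_d, neg_zero]
  · obtain ⟨w, hw⟩ := h.s_exact e y hy
    refine ⟨φ (-w), (hU _ _).2 ⟨0, gp deg (e + 1) (-w), ?_, ?_⟩⟩
    · rw [map_zero, zero_add, hφ, zero_add]
    · rw [← h.d_low, map_neg, map_neg, neg_neg, hw, hg.apply_same]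

/-- A module of finite complexity and infinite projective dimension whose minimal resolution has
jointly injective central operators admits a reduction of its complexity. -/
theorem MinimalResolution.exists_reduction [IsNoetherianRing R] [Module.Finite R M]
    (h : MinimalResolution M deg d s) (hcx : complexity M < ⊤) (hM : ¬ FinitePd M) {m : Type} [Fintype m]
    {z : m → Module.End (IsLocalRing.ResidueField R) (ι →₀ IsLocalRing.ResidueField R)}
    (hz : ∀ i, z i ∈ centralOps deg d 2) (hinj : JointlyInjective (gp deg) z) :
    ∃ (K : ModuleCat.{u} R) (n : ℕ), Module.Finite R K ∧
      HasShortExact (R := R) M K (syzygy n M) ∧ complexity K < complexity M := by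
  have hg := isGrading_gp (S := IsLocalRing.ResidueField R) deg
  have := finite_piece_gp (S := IsLocalRing.ResidueField R) h.finite_fiber
  obtain ⟨n, hn, f, hf, N, hsurj, hgrow⟩ := exists_surjective_of_growth hg
    (fun i => lowers_of_mem_chainOps (hz i).1) hinj (centralOps deg d)
    (fun n f hf => lowers_of_mem_chainOps hf.1) one_mem_centralOps (zero_mem_centralOps 2)
    (fun n f hf g hg => add_mem_centralOps hf hg) (fun m n f hf g hg => mul_mem_centralOps hf hg)
    hz fun m n f hf g hg => hf.2 n g hg.1
  obtain ⟨⟨φ, hφ, hφd, rfl⟩, -⟩ := hf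
  obtain ⟨e, rfl⟩ := Nat.exists_eq_add_of_le' hn
  simp only [finrank_piece_gp, h.card_fiber] at hgrow
  have hses := h.hasShortExact_coneHomology hφ hφd
  let K := ModuleCat.of R (coneHomology deg e d φ)
  have hK : Module.Finite R K := by
    obtain ⟨f, g, -, hfg, hg⟩ := hses
    exact Module.Finite.of_exact hfg hg
  refine ⟨K, e, hK, hses, ?_⟩
  obtain ⟨r, hr⟩ := ENat.ne_top_iff_exists.1 hcx.ne
  rcases r with _ | r
  · exact absurd (finitePd_iff.2 hr.symm) hM
  have hbetti : GrowthLE (r + 1) (betti M) := complexity_le_iff.1 hr.symm.le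
  obtain ⟨A, hA⟩ := (hgrow r hbetti).shift 1
  have hle : complexity K ≤ r := by
    rw [complexity_le_iff]
    -- The right-hand side is the difference of ranks controlled by `hgrow`, shifted by one.
    have hKle : ∀ j, N ≤ j → betti K (j + 2) ≤ betti M (j + 1 + (e + 1)) - betti M (j + 1) :=
      fun j hj => by
        have h1 := h.exactAug.extLen_coneBound_le hφ hφd (j := j) fun i hi x =>
          surjective_of_residue h.finite_fiber (hsurj i (hj.trans hi)) x hφ
        rw [← h.exactAug.extLen_coneHomology hφ hφd, extLen_piece_gp h.finite_fiber,
          extLen_piece_gp h.finite_fiber, h.card_fiber, h.card_fiber] at h1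
        have h2 : extLen R (coneHomology deg e d φ) (j + 2) = betti K (j + 2) :=
          extLen_eq_betti K _
        rw [h2] at h1
        have h3 : betti K (j + 2) + betti M (j + 1) ≤ betti M (j + 1 + (e + 1)) := by
          exact_mod_cast h1
        omega
    refine GrowthLE.of_eventually (A := 3 * A) (N := N + 3) fun j hj => ?_
    obtain ⟨i, rfl⟩ := Nat.exists_eq_add_of_le' (show 2 ≤ j by omega)
    calc (i + 2) * betti K (i + 2)
        ≤ (3 * i) * (betti M (i + 1 + (e + 1)) - betti M (i + 1)) :=
          Nat.mul_le_mul (by omega) (hKle i (by omega))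
      _ = 3 * (i * (betti M (i + 1 + (e + 1)) - betti M (i + 1))) := mul_assoc _ _ _
      _ ≤ 3 * (A * (i + 1) ^ r) := Nat.mul_le_mul_left _ (hA i)
      _ ≤ 3 * A * (i + 2 + 1) ^ r := by
          rw [mul_assoc]
          exact Nat.mul_le_mul_left _ (Nat.mul_le_mul_left _ (Nat.pow_le_pow_left (by omega) r))
  rw [← hr]
  exact hle.trans_lt (by exact_mod_cast Nat.lt_succ_self r)

end Reduction

/-! ### Regular sequences as lists -/

section RegularSequences

open RingTheory.Sequence

lemma initIdeal_getD {S : Type*} [CommRing S] (rs : List S) {i : ℕ} (hi : i ≤ rs.length) :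
    initIdeal (fun a => rs.getD a 0) i = Ideal.ofList (rs.take i) := by
  refine le_antisymm ?_ (Ideal.span_le.2 fun r hr => ?_)
  · rintro _ ⟨r, rfl⟩
    refine Submodule.sum_mem _ fun a ha => Ideal.mul_mem_right _ _ (Ideal.subset_span ?_)
    have hai := Finset.mem_range.1 ha
    have hal : a < rs.length := hai.trans_le hi
    change rs.getD a 0 ∈ rs.take i
    rw [List.getD_eq_getElem _ _ hal]
    exact List.mem_take_iff_getElem.2 ⟨a, by omega, rfl⟩
  · obtain ⟨a, ha, rfl⟩ := List.mem_take_iff_getElem.1 hr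
    have := mem_initIdeal_of_lt (f := fun a => rs.getD a 0) (show a < i by omega) 1
    rw [mul_one] at this
    change rs.getD a 0 ∈ _ at this
    rwa [List.getD_eq_getElem _ _ (by omega)] at this

lemma regSeq_of_isWeaklyRegular {S : Type*} [CommRing S] {rs : List S}
    (h : IsWeaklyRegular S rs) : RegSeq (fun a => rs.getD a 0) rs.length := fun i hi x hx => by
  rw [initIdeal_getD rs hi.le] at hx ⊢
  have h1 := (isSMulRegular_quotient_iff_mem_of_smul_mem _ _).1
    ((isWeaklyRegular_iff S rs).1 h i hi) x
  rw [smul_eq_mul, smul_eq_mul, Ideal.mul_top] at h1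
  change rs.getD i 0 * x ∈ _ at hx
  rw [List.getD_eq_getElem _ _ hi] at hx
  exact h1 hx

end RegularSequences

/-! ### Finite projective dimension over the deformation -/

section FlatExtension

variable {R R' S : Type u} [CommRing R] [CommRing R'] [Algebra R R'] [CommRing S]

/-- The `S`-module structure on `R' ⊗ M` given by a ring homomorphism `S → R'`. -/
abbrev tensorModule (R : Type u) {R' S : Type u} [CommRing R] [CommRing R'] [Algebra R R']
    [CommRing S] (p : S →+* R') (M : Type u) [AddCommGroup M] [Module R M] :
    Module S (TensorProduct R R' M) := Module.compHom _ p

/-- `R' ⊗ M` has finite projective dimension over `S`. -/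
def FinitePdOver (R : Type u) {R' S : Type u} [CommRing R] [CommRing R'] [Algebra R R']
    [CommRing S] (p : S →+* R') (M : Type u) [AddCommGroup M] [Module R M] : Prop :=
  ∃ n, @PdLT S _ (TensorProduct R R' M) _ (tensorModule R p M) n

variable {p : S →+* R'} {A B C : Type u} [AddCommGroup A] [Module R A] [AddCommGroup B]
  [Module R B] [AddCommGroup C] [Module R C]

/-- The base change of a linear map to `R'`, as an `S`-linear map. -/
def tensorMap (p : S →+* R') (f : A →ₗ[R] B) :
    letI := tensorModule R p A
    letI := tensorModule R p B
    TensorProduct R R' A →ₗ[S] TensorProduct R R' B :=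
  letI := tensorModule R p A
  letI := tensorModule R p B
  { toFun := f.baseChange R'
    map_add' := map_add _
    map_smul' := fun r x => map_smul (f.baseChange R') (p r) x }

lemma HasShortExact.tensor [Module.Flat R R'] (p : S →+* R')
    (h : HasShortExact (R := R) A B C) :
    letI := tensorModule R p A
    letI := tensorModule R p B
    letI := tensorModule R p C
    HasShortExact (R := S) (TensorProduct R R' A) (TensorProduct R R' B) (TensorProduct R R' C) := by
  obtain ⟨f, g, hf, hfg, hg⟩ := h
  exact ⟨tensorMap p f, tensorMap p g, Module.Flat.lTensor_preserves_injective_linearMap f hf,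
    lTensor_exact R' hfg hg, LinearMap.lTensor_surjective R' hg⟩

lemma finitePdOver_of_subsingleton [Subsingleton A] : FinitePdOver R p A := by
  let _ := tensorModule R p A
  refine ⟨1, pdLT_one_iff.2 ?_⟩
  infer_instance

/-- `R'` is the quotient of `S` by a regular sequence, so its projective dimension over `S` is the
length of that sequence. -/
lemma finitePdOver_self [IsLocalRing S] [IsNoetherianRing S] (hp : Function.Surjective p)
    {rs : List S} (hreg : RingTheory.Sequence.IsRegular S rs)
    (hker : RingHom.ker p = Ideal.ofList rs) : FinitePdOver R p R := by
  have h1 : PdLT S (Shrink.{u} (S ⧸ Ideal.ofList rs)) (rs.length + 1) :=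
    (projectiveDimension_lt_iff (n := rs.length + 1)).1 (by
      rw [ModuleCat.projectiveDimension_quotient_eq_length rs hreg]
      exact_mod_cast Nat.lt_succ_self rs.length)
  let _ := tensorModule R p R
  let e : TensorProduct R R' R ≃ₗ[R'] R' := TensorProduct.AlgebraTensorModule.rid R R' R'
  let ψ : S →ₗ[S] TensorProduct R R' R :=
    { toFun := fun r => e.symm (p r)
      map_add' := fun r s => by rw [map_add, map_add]
      map_smul' := fun r s => by
        rw [smul_eq_mul, map_mul, ← smul_eq_mul, map_smul]
        rfl }
  have hψ : Function.Surjective ψ := e.symm.surjective.comp hp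
  have hψker : LinearMap.ker ψ = Ideal.ofList rs := by
    rw [← hker]
    ext r
    exact e.symm.map_eq_zero_iff
  refine ⟨rs.length + 1, h1.of_equiv ?_⟩
  exact (Shrink.linearEquiv S _).trans
    ((Submodule.quotEquivOfEq _ _ hψker.symm).trans (ψ.quotKerEquivOfSurjective hψ))

variable [Module.Flat R R']

lemma HasShortExact.finitePdOver_middle (h : HasShortExact (R := R) A B C)
    (hA : FinitePdOver R p A) (hC : FinitePdOver R p C) : FinitePdOver R p B := by
  obtain ⟨m, hm⟩ := hA
  obtain ⟨n, hn⟩ := hC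
  let _ := tensorModule R p A
  let _ := tensorModule R p B
  let _ := tensorModule R p C
  exact ⟨m + n, (h.tensor p).pdLT_middle (hm.mono (by omega)) (hn.mono (by omega))⟩

lemma HasShortExact.finitePdOver_left (h : HasShortExact (R := R) A B C)
    (hB : FinitePdOver R p B) (hC : FinitePdOver R p C) : FinitePdOver R p A := by
  obtain ⟨m, hm⟩ := hB
  obtain ⟨n, hn⟩ := hC
  let _ := tensorModule R p A
  let _ := tensorModule R p B
  let _ := tensorModule R p C
  exact ⟨m + n, (h.tensor p).pdLT_left (hm.mono (by omega)) (hn.mono (by omega))⟩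

lemma FinitePdOver.of_equiv (h : FinitePdOver R p A) (e : A ≃ₗ[R] B) : FinitePdOver R p B :=
  HasShortExact.finitePdOver_middle (C := PUnit.{u + 1}) ⟨e.toLinearMap, 0, e.injective,
    fun x => ⟨fun _ => e.surjective x, fun _ => rfl⟩, fun _ => ⟨0, rfl⟩⟩ h
    finitePdOver_of_subsingleton

lemma finitePdOver_finsupp (h : FinitePdOver R p R) (α : Type u) [Finite α] :
    FinitePdOver R p (α →₀ R) := by
  have hfin : ∀ n, FinitePdOver R p (Fin n → R) := fun n => by
    induction n with
    | zero => exact finitePdOver_of_subsingleton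
    | succ n ih =>
      refine FinitePdOver.of_equiv ?_ (Fin.consLinearEquiv R fun _ => R)
      exact HasShortExact.finitePdOver_middle ⟨LinearMap.inl R R _, LinearMap.snd R R _,
        LinearMap.inl_injective, .inl_snd, LinearMap.snd_surjective⟩ h ih
  obtain ⟨n, ⟨e⟩⟩ := Finite.exists_equiv_fin α
  exact (hfin n).of_equiv ((Finsupp.domLCongr e).trans (Finsupp.linearEquivFunOnFinite R R _)).symm

/-- Free `R`-modules of finite rank become sums of copies of `R'`, so two-out-of-three applies along
the minimal resolution. This is what makes the reduction step repeatable. -/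
lemma finitePdOver_syzygy [IsNoetherianRing R] (h : FinitePdOver R p R) (M : ModuleCat.{u} R)
    [Module.Finite R M] (hM : FinitePdOver R p M) (n : ℕ) : FinitePdOver R p (syzygy n M) := by
  induction n with
  | zero => exact hM
  | succ n ih =>
    have hs := hasShortExact_minimalCover (syzygy n M)
    rw [syzygy_syzygy] at hs
    have : Finite (⊤ : Submodule R (syzygy n M)).generators :=
      (Submodule.FG.finite_generators Module.Finite.fg_top).to_subtype
    exact hs.finitePdOver_left (finitePdOver_finsupp h _) ih

end FlatExtension

/-! ### Repeated reduction of the complexity -/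

section Main

variable {R : Type u} [CommRing R] [IsLocalRing R] [IsNoetherianRing R]

/-- Prepends `M` to the chain of `K`, which has length zero if `K` has finite projective dimension.
-/
lemma HasReducibleComplexity.of_hasShortExact {M K : ModuleCat.{u} R} [Module.Finite R M]
    [Module.Finite R K] (hM : ¬ FinitePd M) (hcx : complexity M < ⊤) {n : ℕ}
    (hs : HasShortExact (R := R) M K (syzygy n M)) (hlt : complexity K < complexity M)
    (hK : HasReducibleComplexity K) : HasReducibleComplexity M := by
  refine Or.inr ⟨pos_iff_ne_zero.2 fun h => hM (finitePd_iff.2 h), hcx, ?_⟩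
  rcases hK with hK | ⟨-, -, r, -, L, hL0, hLfin, hLpd, hL⟩
  · refine ⟨1, le_rfl, fun i => Nat.casesOn i M fun _ => K, rfl, fun i _ => ?_, hK, fun i hi => ?_⟩
    · cases i <;> assumption
    · obtain rfl : i = 0 := by omega
      exact ⟨⟨n, hs⟩, hlt⟩
  · subst hL0
    refine ⟨r + 1, by omega, fun i => Nat.casesOn i M L, rfl, fun i hi => ?_, hLpd, fun i hi => ?_⟩
    · cases i with
      | zero => assumption
      | succ i => exact hLfin i (by omega)
    · cases i with
      | zero => exact ⟨⟨n, hs⟩, hlt⟩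
      | succ i => exact hL i (by omega)

variable {R' S : Type u} [CommRing R'] [IsLocalRing R'] [Algebra R R'] [Module.Flat R R']
  [IsLocalHom (algebraMap R R')] [CommRing S] {p : S →+* R'} {rs : List S}

theorem exists_reduction_of_finitePdOver (hp : Function.Surjective p)
    (hreg : RingTheory.Sequence.IsRegular S rs) (hker : RingHom.ker p = Ideal.ofList rs)
    (M : ModuleCat.{u} R) [Module.Finite R M] (hM : FinitePdOver R p M) :
    complexity M < ⊤ ∧ (¬ FinitePd M → ∃ (K : ModuleCat.{u} R) (n : ℕ), Module.Finite R K ∧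
      HasShortExact (R := R) M K (syzygy n M) ∧ complexity K < complexity M) := by
  have h := minimalResolution_resDiff M
  have hex : ExactAug Sigma.fst (resDiff M) (minimalCover M ∘ₗ resProj M 0) := h.exactAug
  obtain ⟨n, hn⟩ := hM
  let _ := tensorModule R p M
  obtain ⟨hgrow, m, _, z, hz, hinj⟩ := hex.exists_operators hp
    (regSeq_of_isWeaklyRegular hreg.toIsWeaklyRegular)
    (fun x => by rw [initIdeal_getD rs le_rfl, List.take_length, ← hker, RingHom.mem_ker])
    h.minimal h.finite_fiber (fun _ _ => rfl) hn
  simp only [h.card_fiber] at hgrow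
  have hcx : complexity M < ⊤ := complexity_lt_top_iff.2 ⟨_, hgrow⟩
  exact ⟨hcx, fun hpd => h.exists_reduction hcx hpd hz hinj⟩

theorem hasReducibleComplexity_of_finitePdOver [IsLocalRing S] [IsNoetherianRing S]
    (hp : Function.Surjective p) (hreg : RingTheory.Sequence.IsRegular S rs)
    (hker : RingHom.ker p = Ideal.ofList rs)
    (M : ModuleCat.{u} R) [Module.Finite R M] (hM : FinitePdOver R p M) :
    HasReducibleComplexity M := by
  -- Induction on a bound for the complexity, with the quasi-deformation fixed: `K` inherits finite
  -- projective dimension over `S` from `M` and its syzygy.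
  have key : ∀ (r : ℕ) (M : ModuleCat.{u} R) [Module.Finite R M], FinitePdOver R p M →
      complexity M ≤ r → HasReducibleComplexity M := fun r => by
    induction r with
    | zero => exact fun M _ _ h => Or.inl (finitePd_iff.2 (nonpos_iff_eq_zero.1 h))
    | succ r ih =>
      intro M _ hM hr
      by_cases hpd : FinitePd M
      · exact Or.inl hpd
      obtain ⟨hcx, hred⟩ := exists_reduction_of_finitePdOver hp hreg hker M hM
      obtain ⟨K, n, hK, hs, hlt⟩ := hred hpd
      refine HasReducibleComplexity.of_hasShortExact hpd hcx hs hlt (ih K ?_ ?_)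
      · exact hs.finitePdOver_middle hM
          (finitePdOver_syzygy (finitePdOver_self hp hreg hker) M hM n)
      · exact Order.le_of_lt_add_one (hlt.trans_le (by exact_mod_cast hr))
  obtain ⟨r, hr⟩ := ENat.ne_top_iff_exists.1
    (exists_reduction_of_finitePdOver hp hreg hker M hM).1.ne
  exact key r M hM hr.ge

lemma toExtendedReal_lt_top_iff {x : WithBot ℕ∞} : toExtendedReal x < ⊤ ↔ x < ⊤ := by
  induction x using WithBot.recBotCoe with
  | bot => exact ⟨fun _ => bot_lt_top, fun _ => bot_lt_top⟩
  | coe n =>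
    induction n using ENat.recTopCoe with
    | top => exact ⟨fun h => absurd h (lt_irrefl _), fun h => absurd h (lt_irrefl _)⟩
    | coe n =>
      refine ⟨fun _ => WithBot.coe_lt_coe.2 (ENat.natCast_lt_top n), fun _ => ?_⟩
      change (((n : ℕ∞) : ENNReal) : EReal) < ⊤
      rw [lt_top_iff_ne_top]
      simp

end Main

/-! ### Finite complete intersection dimension -/

section CIDimension

variable {R : Type u} [CommRing R] [IsLocalRing R] [IsNoetherianRing R]

theorem hasReducibleComplexity_of_ciDim_lt_top (M : ModuleCat.{u} R) [Module.Finite R M]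
    (h : ciDim M < ⊤) : HasReducibleComplexity M := by
  obtain ⟨Q, hQ⟩ := iInf_lt_iff.1 h
  let _ : Algebra R Q.R' := Q.ext.toAlgebra
  have : Module.Flat R Q.R' := Q.flat_ext
  have : IsLocalHom (algebraMap R Q.R') := Q.isLocalHom_ext
  obtain ⟨rs, hreg, hker⟩ := Q.ker_proj
  -- Finiteness of the subtracted term is needed: in the extended reals `⊤ - ⊤ = ⊥`, so the bound on
  -- the difference alone would not control the first term.
  have hring : projectiveDimension Q.ringAsModule < ⊤ := by
    let _ := tensorModule R Q.proj R
    obtain ⟨n, hn⟩ := finitePdOver_self (R := R) Q.surjective_proj hreg hker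
    let _ : Module Q.S Q.R' := Module.compHom _ Q.proj
    let e : TensorProduct R Q.R' R ≃ₗ[Q.S] Q.R' :=
      { TensorProduct.AlgebraTensorModule.rid R Q.R' Q.R' with
        map_smul' := fun r x =>
          map_smul (TensorProduct.AlgebraTensorModule.rid R Q.R' Q.R') (Q.proj r) x }
    exact finitePd_iff_exists.2 ⟨n, hn.of_equiv e⟩
  have hpd : projectiveDimension (Q.baseChange M) < ⊤ := by
    rw [← toExtendedReal_lt_top_iff] at hring ⊢
    by_contra htop
    rw [not_lt_top_iff.1 htop, EReal.top_sub hring.ne] at hQ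
    exact lt_irrefl _ hQ
  exact hasReducibleComplexity_of_finitePdOver Q.surjective_proj hreg hker M
    (finitePd_iff_exists.1 hpd)

end CIDimension

end ReducingDim

theorem corollary4p3 {R : Type u} [CommRing R] [IsLocalRing R] [IsNoetherianRing R]
    (M : ModuleCat.{u} R) [Module.Finite R M] :
    (ReducingDim.complexity M < ⊤ → ReducingDim.complexity M ≤ ReducingDim.reducingPd M) ∧
    (ReducingDim.HasReducibleComplexity M →
      ReducingDim.complexity M = ReducingDim.reducingPd M) ∧
    (ReducingDim.ciDim M < ⊤ →
      ReducingDim.HasReducibleComplexity M ∧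
        ReducingDim.complexity M = ReducingDim.reducingPd M) :=
  ⟨ReducingDim.complexity_le_reducingPd, fun h => h.complexity_eq, fun h =>
    ⟨ReducingDim.hasReducibleComplexity_of_ciDim_lt_top M h,
      (ReducingDim.hasReducibleComplexity_of_ciDim_lt_top M h).complexity_eq⟩⟩
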